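/- Let $(M,g)$ be a compact smooth Riemannian manifold with (possibly empty) boundary $\partial M$, of dimension $n\ge 3$. Let $K\in C^\infty(M)$ with $K<0$ everywhere on $M$, and let $H\in C^\infty(\partial M)$. For $x\in\partial M$ put $$\mathfrak D_n(x)=\sqrt{n(n-1)}\,\frac{H(x)}{\sqrt{|K(x)|}},\qquad \bar D=\max\Big(\{0\}\cup\{\mathfrak D_n(x):x\in\partial M\}\Big).$$ Let $H^1(M)$ be the completion of $C^\infty(M)$ (functions smooth up to the boundary) with respect to the norm $\big(\int_M|u|^2+\int_M|\nabla u|^2\big)^{1/2}$; the boundary values of $u\in H^1(M)$ are taken in the sense of traces, the trace operator being the continuous extension to $H^1(M)\to L^2(\partial M)$ of the restriction $u\mapsto u|_{\partial M}$. Then for every $\varepsilon>0$ there exists $C>0$ (depending on $M,g,K,H,\varepsilon$, but not on $u$) such that for every $u\in H^1(M)$ the trace of $u$ exists, all the integrals below converge absolutely, and $$\int_{\partial M}H\,|u|^{\frac{2(n-1)}{n-2}}\,d\sigma_g\ \le\ (\bar D+\varepsilon)\left(\frac{2(n-1)}{(n-2)^2}\int_M|\nabla u|^2\,dv_g+\frac1{2n}\int_M|K|\,|u|^{\frac{2n}{n-2}}\,dv_g\right)+C\int_M|u|^{\frac{2(n-1)}{n-2}}\,dv_g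 .$$ -/

import Mathlib

open MeasureTheory Set Filter Topology Bundle
open scoped Manifold ContDiff ENNReal

noncomputable section

namespace RiemannianBoundary

variable {n : ℕ} [NeZero n] {M : Type*} [TopologicalSpace M]
  [ChartedSpace (EuclideanHalfSpace n) M] [IsManifold (𝓡∂ n) ∞ M]

/-- Smooth Riemannian metrics on the smooth `n`-manifold with boundary `M`. -/
abbrev Metric (n : ℕ) [NeZero n] (M : Type*) [TopologicalSpace M]
    [ChartedSpace (EuclideanHalfSpace n) M] [IsManifold (𝓡∂ n) ∞ M] :=
  ContMDiffRiemannianMetric (𝓡∂ n) ∞ (EuclideanSpace ℝ (Fin n))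
    (fun p : M => TangentSpace (𝓡∂ n) p)

/-- The coordinate vector `∂ᵢ`, at the point of coordinates `y`, of the preferred chart at `x`. -/
def coordVector (x : M) (y : EuclideanSpace ℝ (Fin n)) (i : Fin n) :
    TangentSpace (𝓡∂ n) ((extChartAt (𝓡∂ n) x).symm y) :=
  mfderivWithin 𝓘(ℝ, EuclideanSpace ℝ (Fin n)) (𝓡∂ n) (extChartAt (𝓡∂ n) x).symm
    (range (𝓡∂ n)) y (EuclideanSpace.single i (1 : ℝ) : EuclideanSpace ℝ (Fin n))

/-- The matrix `(g_ij)` of the metric in the preferred chart at `x`, as a function of the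
coordinates `y`. -/
def gram (g : Metric n M) (x : M) (y : EuclideanSpace ℝ (Fin n)) : Matrix (Fin n) (Fin n) ℝ :=
  fun i j => g.inner ((extChartAt (𝓡∂ n) x).symm y) (coordVector x y i) (coordVector x y j)

/-- The measure `√(det g_ij) dy¹ ⋯ dyⁿ` of the preferred chart at `x`, carried to `M`. -/
def chartVolume [MeasurableSpace M] (g : Metric n M) (x : M) : Measure M :=
  (((volume : Measure (EuclideanSpace ℝ (Fin n))).restrict (extChartAt (𝓡∂ n) x).target).withDensity
    (fun y => ENNReal.ofReal (Real.sqrt (gram g x y).det))).map (extChartAt (𝓡∂ n) x).symm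

/-- The Riemannian volume measure `dv_g`. On overlaps the chart measures agree (change of
variables), so the least measure that dominates all of them is the one measure that coincides
with the chart measure `√(det g_ij) dy` on the domain of each chart. -/
def vol [MeasurableSpace M] (g : Metric n M) : Measure M := ⨆ x : M, chartVolume g x

/-- The inclusion of the boundary hyperplane `{y | y 0 = 0}` of the half-space, parametrized by
the remaining `n - 1` coordinates. -/
def boundaryEmb (n : ℕ) [NeZero n] (z : EuclideanSpace ℝ {i : Fin n // i ≠ 0}) :
    EuclideanSpace ℝ (Fin n) :=
  WithLp.toLp 2 (fun i => if h : i = 0 then 0 else z ⟨i, h⟩)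

/-- The surface measure `√(det (g_ij)_{i,j ≠ 0}) dz` on the part of `∂M` in the domain of the
preferred chart at `x`, carried to `M`. -/
def chartSurface [MeasurableSpace M] (g : Metric n M) (x : M) : Measure M :=
  (((volume : Measure (EuclideanSpace ℝ {i : Fin n // i ≠ 0})).restrict
      (boundaryEmb n ⁻¹' (extChartAt (𝓡∂ n) x).target)).withDensity
    (fun z => ENNReal.ofReal (Real.sqrt
      ((gram g x (boundaryEmb n z)).submatrix
        (Subtype.val : {i : Fin n // i ≠ 0} → Fin n) Subtype.val).det))).map
    (fun z => (extChartAt (𝓡∂ n) x).symm (boundaryEmb n z))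

/-- The Riemannian surface measure `dσ_g` of `∂M` for the metric induced by `g`, as a measure on
`M` that is concentrated on `∂M`. As for `vol`, the chart measures agree on overlaps. -/
def surface [MeasurableSpace M] (g : Metric n M) : Measure M := ⨆ x : M, chartSurface g x

/-- The metric at `p`, as a bilinear form on the tangent space. -/
def bilin (g : Metric n M) (p : M) : LinearMap.BilinForm ℝ (TangentSpace (𝓡∂ n) p) :=
  LinearMap.mk₂ ℝ (fun v w => g.inner p v w) (by simp) (by simp) (by simp) (by simp)

lemma bilin_nondegenerate (g : Metric n M) (p : M) : (bilin g p).Nondegenerate := by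
  constructor
  · intro v hv
    by_contra h
    exact (g.pos p v h).ne' (hv v)
  · intro v hv
    by_contra h
    exact (g.pos p v h).ne' (hv v)

instance (p : M) : FiniteDimensional ℝ (TangentSpace (𝓡∂ n) p) :=
  inferInstanceAs (FiniteDimensional ℝ (EuclideanSpace ℝ (Fin n)))

/-- The gradient `∇f`: the vector field with `g(∇f, v) = df(v)` for all tangent vectors `v`. -/
def grad (g : Metric n M) (f : M → ℝ) (p : M) : TangentSpace (𝓡∂ n) p :=
  ((bilin g p).toDual (bilin_nondegenerate g p)).symm
    (show TangentSpace (𝓡∂ n) p →L[ℝ] ℝ from mfderiv (𝓡∂ n) 𝓘(ℝ, ℝ) f p).toLinearMap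

lemma inner_grad (g : Metric n M) (f : M → ℝ) (p : M) (v : TangentSpace (𝓡∂ n) p) :
    g.inner p (grad g f p) v = mfderiv (𝓡∂ n) 𝓘(ℝ, ℝ) f p v :=
  LinearMap.BilinForm.apply_toDual_symm_apply (hB := bilin_nondegenerate g p)
    (show TangentSpace (𝓡∂ n) p →L[ℝ] ℝ from mfderiv (𝓡∂ n) 𝓘(ℝ, ℝ) f p).toLinearMap v

/-- The squared length `|v|²` of a tangent vector. -/
def normSq (g : Metric n M) (p : M) (v : TangentSpace (𝓡∂ n) p) : ℝ := g.inner p v v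

/-- `X` is a measurable vector field: its components in every chart are measurable, up to null
sets. -/
def AEMeasurableField [MeasurableSpace M] (g : Metric n M)
    (X : (p : M) → TangentSpace (𝓡∂ n) p) : Prop :=
  ∀ x : M, AEMeasurable
    (fun p => (mfderiv (𝓡∂ n) 𝓘(ℝ, EuclideanSpace ℝ (Fin n)) (extChartAt (𝓡∂ n) x) p (X p) :
      EuclideanSpace ℝ (Fin n)))
    ((vol g).restrict (chartAt (EuclideanHalfSpace n) x).source)

/-- The functions `f k` are smooth on `M` (up to the boundary), `f k → u` in `L²(M)`, and
`∇(f k) → X` in `L²(M)`. -/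
structure TendstoH1 [MeasurableSpace M] (g : Metric n M) (f : ℕ → M → ℝ) (u : M → ℝ)
    (X : (p : M) → TangentSpace (𝓡∂ n) p) : Prop where
  smooth : ∀ k, ContMDiff (𝓡∂ n) 𝓘(ℝ, ℝ) ∞ (f k)
  aestronglyMeasurable : AEStronglyMeasurable u (vol g)
  aemeasurableField : AEMeasurableField g X
  tendsto_fun : Tendsto (fun k => eLpNorm (fun p => f k p - u p) 2 (vol g)) atTop (𝓝 0)
  tendsto_grad : Tendsto
    (fun k => ∫⁻ p, ENNReal.ofReal (normSq g p (grad g (f k) p - X p)) ∂(vol g)) atTop (𝓝 0)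

/-- `u ∈ H¹(M)` with weak gradient `X`. For a compact manifold with boundary `H¹(M)` is the
completion of `C^∞(M)` in the norm `(∫ |u|² + ∫ |∇u|²)^{1/2}`, realized inside `L²(M)`. -/
def IsH1 [MeasurableSpace M] (g : Metric n M) (u : M → ℝ)
    (X : (p : M) → TangentSpace (𝓡∂ n) p) : Prop :=
  ∃ f : ℕ → M → ℝ, TendstoH1 g f u X

/-- `w ∈ L²(∂M)` is the boundary trace of the element `u ∈ H¹(M)` with weak gradient `X`: the
trace operator is the continuous extension `H¹(M) → L²(∂M)` of the restriction
`C^∞(M) → L²(∂M)`. Only the values of `w` on `∂M` matter. -/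
def IsTrace [MeasurableSpace M] (g : Metric n M) (u : M → ℝ)
    (X : (p : M) → TangentSpace (𝓡∂ n) p) (w : M → ℝ) : Prop :=
  AEStronglyMeasurable w (surface g) ∧ ∃ f : ℕ → M → ℝ, TendstoH1 g f u X ∧
    Tendsto (fun k => eLpNorm (fun p => f k p - w p) 2 (surface g)) atTop (𝓝 0)

/-- The scaling invariant function `𝔇_n = √(n(n-1)) H / √|K|` (of interest on `∂M` only). -/
def frakD (n : ℕ) (H K : M → ℝ) (p : M) : ℝ :=
  Real.sqrt ((n : ℝ) * ((n : ℝ) - 1)) * (H p / Real.sqrt |K p|)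

variable (n) in
/-- `D̄`, the maximum of `0` and of the values of `𝔇_n` on `∂M`. -/
def barD (H K : M → ℝ) : ℝ := sSup (insert 0 (frakD n H K '' (𝓡∂ n).boundary M))

end RiemannianBoundary

end

open MeasureTheory Set Filter Topology Bundle
open scoped Manifold ContDiff ENNReal

noncomputable section

set_option linter.unusedSectionVars false

/-! Everything rests on a trace inequality whose gradient term has constant exactly one: for smooth
φ ≥ 0 there is C with ∫_{∂M} φ|f|^r ≤ ∫_M φ r|f|^{r-1}|∇f| + C ∫_M |f|^r for all smooth f and all r
> 1 (`exists_trace_inequality`). In a chart it is the divergence theorem on the half-space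
(`integral_divergence_halfSpace`) for the field η |f|^r √(det g) N, where N is the g-unit normal to
the level sets of the coordinate `y 0`. On the boundary the zeroth component of √(det g) N is the
surface density; in the interior Cauchy–Schwarz bounds |df(N)| by |∇f|; the derivatives of η √(det
g) N only feed the term with C. A partition of unity adds up the charts without loss, because the
cutoffs enter linearly.

Take r = 2(n-1)/(n-2) and φ = D √|K| / √(n(n-1)), which dominates H on ∂M as soon as D ≥ 𝔇_n there.
Since 2(r-1) = 2n/(n-2), Young's inequality turns φ r|f|^{r-1}|∇f| into D times the two energy
densities of the theorem: their coefficients are those for which the difference is a perfect square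
(`young_gradient`). This settles smooth functions.

The passage to H¹(M) needs convergence in stronger norms. A Gagliardo–Nirenberg–Sobolev inequality
on the half-space gives the Sobolev inequality on M (`exists_sobolev_inequality`), so approximating
sequences converge in L^{2n/(n-2)} and, the volume being finite, in L^{2(n-1)/(n-2)}. The right side
then passes to the limit, and Fatou's lemma handles the boundary integral
(`boundary_inequality_of_isTrace`). Traces exist by the trace inequality with φ = 1 and r = 2.

All integrals are computed in charts. This is legitimate because the measures, defined as suprema of
chart measures, restrict on each chart domain to its own chart measure (`vol_restrict_source`,
`surface_restrict_source`); that is the change of variables formula for the transition maps. -/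

namespace RiemannianBoundary

/-! ### Sobolev inequalities on the half-space -/

section

/-- On a ray, a function that vanishes somewhere is bounded by the integral of its derivative. -/
lemma enorm_le_lintegral_Ioi_deriv {h h' : ℝ → ℝ} {a b : ℝ} (hab : a ≤ b)
    (hd : ∀ t ∈ Ici a, HasDerivWithinAt h (h' t) (Ici a) t) (hc : ContinuousOn h' (Ici a))
    (hb : h b = 0) : ‖h a‖ₑ ≤ ∫⁻ t in Ioi a, ‖h' t‖ₑ := by
  have hFTC : ∫ t in a..b, h' t = h b - h a := by
    apply intervalIntegral.integral_eq_sub_of_hasDeriv_right_of_le hab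
    · intro t ht
      exact ((hd t ht.1).continuousWithinAt).mono Icc_subset_Ici_self
    · intro t ht
      exact (hd t ht.1.le).mono (Ioi_subset_Ici ht.1.le)
    · exact (hc.mono (by rw [uIcc_of_le hab]; exact Icc_subset_Ici_self)).intervalIntegrable
  have : h a = -∫ t in a..b, h' t := by rw [hFTC, hb]; ring
  rw [this, enorm_neg, intervalIntegral.integral_of_le hab]
  exact (enorm_integral_le_lintegral_enorm _).trans
    (lintegral_mono_set Ioc_subset_Ioi_self)

/-- The half-space `{y | 0 ≤ y 0}`. -/
abbrev halfSpace (n : ℕ) [NeZero n] : Set (EuclideanSpace ℝ (Fin n)) := range (𝓡∂ n)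

lemma mem_halfSpace {n : ℕ} [NeZero n] {y : EuclideanSpace ℝ (Fin n)} :
    y ∈ halfSpace n ↔ 0 ≤ y 0 := by
  rw [halfSpace, range_modelWithCornersEuclideanHalfSpace]; rfl

lemma isClosed_halfSpace (n : ℕ) [NeZero n] : IsClosed (halfSpace n) := (𝓡∂ n).isClosed_range

lemma uniqueDiffOn_halfSpace (n : ℕ) [NeZero n] : UniqueDiffOn ℝ (halfSpace n) :=
  (𝓡∂ n).uniqueDiffOn

lemma boundaryEmb_mem_halfSpace {n : ℕ} [NeZero n] (z : EuclideanSpace ℝ {i : Fin n // i ≠ 0}) :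
    boundaryEmb n z ∈ halfSpace n := by
  rw [mem_halfSpace]; simp [boundaryEmb]

/-- Extension by zero of a function that vanishes off a compact set. -/
lemma contDiffOn_indicator_of_eq_zero {F G : Type*} [NormedAddCommGroup F] [NormedSpace ℝ F]
    [NormedAddCommGroup G] [NormedSpace ℝ G] {k : ℕ∞ω} {R T K : Set F} {U : Set F} (hU : IsOpen U)
    (hT : T = U ∩ R) (hK : IsClosed K) (hKT : K ⊆ T) {f : F → G} (hf : ContDiffOn ℝ k f T)
    (h0 : ∀ y ∈ T, y ∉ K → f y = 0) : ContDiffOn ℝ k (T.indicator f) R := by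
  intro y hy
  by_cases hyT : y ∈ T
  · have hTR : T ∈ 𝓝[R] y := by
      rw [hT] at hyT ⊢
      exact inter_mem (mem_nhdsWithin_of_mem_nhds (hU.mem_nhds hyT.1)) self_mem_nhdsWithin
    refine ((hf y hyT).mono_of_mem_nhdsWithin hTR).congr_of_eventuallyEq ?_ ?_
    · filter_upwards [hTR] with z hz using indicator_of_mem hz f
    · exact indicator_of_mem hyT f
  · have hyK : Kᶜ ∈ 𝓝 y := hK.isOpen_compl.mem_nhds fun h => hyT (hKT h)
    refine (contDiffWithinAt_const (c := (0 : G))).congr_of_eventuallyEq ?_ ?_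
    · filter_upwards [mem_nhdsWithin_of_mem_nhds hyK] with z hz
      by_cases hzT : z ∈ T
      · rw [indicator_of_mem hzT, h0 z hzT hz]
      · exact indicator_of_notMem hzT f
    · exact indicator_of_notMem hyT f

section HalfSpace

variable {n : ℕ} [NeZero n]

local notation "𝔼" => EuclideanSpace ℝ (Fin n)

lemma fderivWithin_eq_zero_of_eq_zero {F : Type*} [NormedAddCommGroup F] [NormedSpace ℝ F]
    {R K : Set F} (hK : IsClosed K) {f : F → ℝ} (h0 : ∀ y ∈ R, y ∉ K → f y = 0) {y : F}
    (hyR : y ∈ R) (hy : y ∉ K) : fderivWithin ℝ f R y = 0 := by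
  have : f =ᶠ[𝓝[R] y] fun _ => (0 : ℝ) := by
    filter_upwards [mem_nhdsWithin_of_mem_nhds (hK.isOpen_compl.mem_nhds hy), self_mem_nhdsWithin]
      with z hz hzR using h0 z hzR hz
  rw [this.fderivWithin_eq (h0 y hyR hy)]
  simp

lemma continuousOn_fderivWithin_halfSpace {f : 𝔼 → ℝ} (hf : ContDiffOn ℝ 1 f (halfSpace n)) :
    ContinuousOn (fderivWithin ℝ f (halfSpace n)) (halfSpace n) :=
  hf.continuousOn_fderivWithin (uniqueDiffOn_halfSpace n) le_rfl

/-- A ray in a positive coordinate direction never leaves the half-space, and it does leave the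
bounded set `K`. Integrating along such rays makes an extension across the boundary hyperplane
unnecessary. -/
lemma enorm_le_lintegral_ray {f : 𝔼 → ℝ} (hf : ContDiffOn ℝ 1 f (halfSpace n))
    {K : Set 𝔼} (hK : IsCompact K) (h0 : ∀ y ∈ halfSpace n, y ∉ K → f y = 0)
    {x : 𝔼} (hx : x ∈ halfSpace n) (i : Fin n) :
    ‖f x‖ₑ ≤ ∫⁻ t, (halfSpace n).indicator (fun y => ‖fderivWithin ℝ f (halfSpace n) y‖ₑ)
      (WithLp.toLp 2 (Function.update x.ofLp i t)) := by
  set γ : ℝ → 𝔼 := fun t => WithLp.toLp 2 (Function.update x.ofLp i t) with hγ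
  have hγR : MapsTo γ (Ici (x i)) (halfSpace n) := by
    intro t ht
    rw [mem_halfSpace] at hx ⊢
    by_cases hi : (0 : Fin n) = i
    · subst hi; simpa [hγ] using le_trans hx ht
    · simpa [hγ, Function.update_of_ne hi] using hx
  have hγd : ∀ t, HasDerivAt γ (EuclideanSpace.single i (1 : ℝ)) t := by
    intro t
    have h1 := hasDerivAt_update x.ofLp i t
    have := (PiLp.hasFDerivAt_toLp (𝕜 := ℝ) 2 (Function.update x.ofLp i t)).comp_hasDerivAt t h1
    exact this
  have hγc : Continuous γ := continuous_iff_continuousAt.2 fun t => (hγd t).continuousAt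
  obtain ⟨r, hr⟩ := hK.isBounded.subset_closedBall 0
  have hb : ∃ b, x i ≤ b ∧ f (γ b) = 0 := by
    refine ⟨max (x i) (r + 1), le_max_left _ _, h0 _ (hγR (mem_Ici.2 (le_max_left _ _))) fun hmem => ?_⟩
    have h1 := hr hmem
    rw [mem_closedBall_zero_iff] at h1
    have h2 := (PiLp.norm_apply_le (γ (max (x i) (r + 1))) i).trans h1
    have h3 : (γ (max (x i) (r + 1))) i = max (x i) (r + 1) := by simp [hγ]
    rw [h3, Real.norm_eq_abs] at h2
    have := le_abs_self (max (x i) (r + 1))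
    have := le_max_right (x i) (r + 1)
    linarith
  obtain ⟨b, hxb, hb⟩ := hb
  have key := enorm_le_lintegral_Ioi_deriv (h := f ∘ γ)
    (h' := fun t => fderivWithin ℝ f (halfSpace n) (γ t) (EuclideanSpace.single i (1 : ℝ))) hxb
    (fun t ht => ((hf.differentiableOn one_ne_zero _ (hγR ht)).hasFDerivWithinAt).comp_hasDerivWithinAt
      t (hγd t).hasDerivWithinAt hγR)
    (((continuousOn_fderivWithin_halfSpace hf).comp hγc.continuousOn hγR).clm_apply
      continuousOn_const) hb
  have hγx : γ (x i) = x := by simp [hγ]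
  rw [Function.comp_apply, hγx] at key
  refine key.trans ?_
  rw [← lintegral_indicator measurableSet_Ioi]
  refine lintegral_mono fun t => ?_
  by_cases ht : t ∈ Ioi (x i)
  · rw [indicator_of_mem ht, indicator_of_mem (hγR (mem_Ici.2 (le_of_lt ht)))]
    have := ContinuousLinearMap.le_opNorm (fderivWithin ℝ f (halfSpace n) (γ t))
      (EuclideanSpace.single i (1 : ℝ))
    rw [PiLp.norm_single, norm_one, mul_one] at this
    exact enorm_le_iff_norm_le.2 this
  · rw [indicator_of_notMem ht]; exact zero_le

lemma measurableSet_halfSpace : MeasurableSet (halfSpace n) := (isClosed_halfSpace n).measurableSet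

lemma measurable_indicator_enorm_fderivWithin {f : 𝔼 → ℝ} (hf : ContDiffOn ℝ 1 f (halfSpace n)) :
    Measurable ((halfSpace n).indicator fun y => ‖fderivWithin ℝ f (halfSpace n) y‖ₑ) := by
  classical
  rw [← piecewise_eq_indicator]
  exact (continuousOn_fderivWithin_halfSpace hf).enorm.measurable_piecewise
    continuousOn_const measurableSet_halfSpace

/-- The Gagliardo–Nirenberg–Sobolev inequality with exponent one on the half-space. -/
lemma lintegral_rpow_le_lintegral_fderivWithin {p : ℝ} (hp : Real.HolderConjugate n p)
    {f : 𝔼 → ℝ} (hf : ContDiffOn ℝ 1 f (halfSpace n))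
    {K : Set 𝔼} (hK : IsCompact K) (h0 : ∀ y ∈ halfSpace n, y ∉ K → f y = 0) :
    ∫⁻ y in halfSpace n, ‖f y‖ₑ ^ p ≤
      (∫⁻ y in halfSpace n, ‖fderivWithin ℝ f (halfSpace n) y‖ₑ) ^ p := by
  set D := (halfSpace n).indicator fun y => ‖fderivWithin ℝ f (halfSpace n) y‖ₑ with hD
  have hDm : Measurable D := measurable_indicator_enorm_fderivWithin hf
  have hn1 : (1 : ℝ) < n := hp.lt
  have hgrid := lintegral_prod_lintegral_pow_le (ι := Fin n) (A := fun _ => ℝ)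
    (fun _ => (volume : Measure ℝ)) (p := p) (by simpa using hp)
    (f := fun x => D (WithLp.toLp 2 x)) (by fun_prop)
  have e := EuclideanSpace.volume_preserving_symm_measurableEquiv_toLp (Fin n)
  have e2 : MeasurePreserving (fun x : Fin n → ℝ => (WithLp.toLp 2 x : 𝔼)) volume volume :=
    PiLp.volume_preserving_toLp (Fin n)
  have hmem : MeasurableEmbedding (fun x : Fin n → ℝ => (WithLp.toLp 2 x : 𝔼)) :=
    (MeasurableEquiv.toLp 2 (Fin n → ℝ)).measurableEmbedding
  calc ∫⁻ y in halfSpace n, ‖f y‖ₑ ^ p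
      = ∫⁻ y, (halfSpace n).indicator (fun y => ‖f y‖ₑ ^ p) y :=
        (lintegral_indicator measurableSet_halfSpace _).symm
    _ = ∫⁻ x : Fin n → ℝ, (halfSpace n).indicator (fun y => ‖f y‖ₑ ^ p) (WithLp.toLp 2 x) :=
        (e2.lintegral_comp_emb hmem _).symm
    _ ≤ ∫⁻ x : Fin n → ℝ, ∏ i, (∫⁻ t, D (WithLp.toLp 2 (Function.update x i t))) ^
          ((1 : ℝ) / ((Fintype.card (Fin n) : ℝ) - 1)) := by
        refine lintegral_mono fun x => ?_
        by_cases hx : (WithLp.toLp 2 x : 𝔼) ∈ halfSpace n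
        · rw [indicator_of_mem hx]
          -- As p = n/(n-1), the power splits into n equal factors, one for each coordinate line;
          -- this is the shape that the grid-lines inequality `hgrid` bounds.
          have : ‖f (WithLp.toLp 2 x)‖ₑ ^ p = ∏ _i : Fin n, ‖f (WithLp.toLp 2 x)‖ₑ ^
              ((1 : ℝ) / ((Fintype.card (Fin n) : ℝ) - 1)) := by
            rw [Finset.prod_const, Finset.card_univ, Fintype.card_fin, ← ENNReal.rpow_natCast,
              ← ENNReal.rpow_mul, hp.conjugate_eq]
            congr 1; ring
          rw [this]
          gcongr with i
          · rw [Fintype.card_fin]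
            exact div_nonneg zero_le_one (by linarith)
          · exact enorm_le_lintegral_ray hf hK h0 hx i
        · rw [indicator_of_notMem hx]; exact zero_le
    _ ≤ (∫⁻ x : Fin n → ℝ, D (WithLp.toLp 2 x)) ^ p := hgrid
    _ = _ := by
        rw [e2.lintegral_comp_emb hmem, hD, lintegral_indicator measurableSet_halfSpace]

/-- Finiteness is what later allows a power of this integral to be absorbed into the left side. -/
lemma lintegral_rpow_lt_top {f : 𝔼 → ℝ} (hf : ContinuousOn f (halfSpace n))
    {K : Set 𝔼} (hK : IsCompact K) (h0 : ∀ y ∈ halfSpace n, y ∉ K → f y = 0) {p : ℝ} (hp : 0 < p) :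
    ∫⁻ y in halfSpace n, ‖f y‖ₑ ^ p < ⊤ := by
  have hKR : IsCompact (K ∩ halfSpace n) := hK.inter_right (isClosed_halfSpace n)
  obtain ⟨C, hC⟩ := hKR.exists_bound_of_continuousOn (hf.mono inter_subset_right)
  calc ∫⁻ y in halfSpace n, ‖f y‖ₑ ^ p
      ≤ ∫⁻ y, (K ∩ halfSpace n).indicator (fun _ => ENNReal.ofReal C ^ p) y := by
        rw [← lintegral_indicator measurableSet_halfSpace]
        refine lintegral_mono fun y => ?_
        by_cases hy : y ∈ halfSpace n
        · rw [indicator_of_mem hy]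
          by_cases hyK : y ∈ K
          · rw [indicator_of_mem (show y ∈ K ∩ halfSpace n from ⟨hyK, hy⟩)]
            gcongr
            rw [← ofReal_norm]
            exact ENNReal.ofReal_le_ofReal (hC y ⟨hyK, hy⟩)
          · rw [h0 y hy hyK]; simp [hp]
        · rw [indicator_of_notMem hy]; exact zero_le
    _ = ENNReal.ofReal C ^ p * volume (K ∩ halfSpace n) := by
        rw [lintegral_indicator hKR.measurableSet, setLIntegral_const]
    _ < ⊤ := ENNReal.mul_lt_top (ENNReal.rpow_lt_top_of_nonneg hp.le ENNReal.ofReal_ne_top)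
        hKR.measure_lt_top

lemma contDiffOn_abs_rpow {F : Type*} [NormedAddCommGroup F] [NormedSpace ℝ F] {S : Set F}
    {f : F → ℝ} (hf : ContDiffOn ℝ 1 f S) {r : ℝ} (hr : 1 < r) :
    ContDiffOn ℝ 1 (fun y => |f y| ^ r) S := by
  have := (contDiff_norm_rpow (E := ℝ) hr).comp_contDiffOn hf
  simpa [Function.comp_def] using this

lemma hasFDerivWithinAt_abs_rpow {F : Type*} [NormedAddCommGroup F] [NormedSpace ℝ F] {S : Set F}
    {f : F → ℝ} {f' : F →L[ℝ] ℝ} {y : F} (hf : HasFDerivWithinAt f f' S y) {r : ℝ} (hr : 1 < r) :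
    HasFDerivWithinAt (fun y => |f y| ^ r) ((r * |f y| ^ (r - 2) * f y) • f') S y :=
  (hasDerivAt_abs_rpow (f y) hr).comp_hasFDerivWithinAt y hf

lemma abs_rpow_sub_two_mul_self {r : ℝ} (hr : 1 < r) (t : ℝ) :
    |r * |t| ^ (r - 2) * t| = r * |t| ^ (r - 1) := by
  rcases eq_or_ne t 0 with rfl | ht
  · simp [Real.zero_rpow (by linarith : r - 1 ≠ 0)]
  · have : 0 < |t| := abs_pos.2 ht
    rw [abs_mul, abs_mul, abs_of_pos (by linarith : 0 < r), abs_of_nonneg (by positivity),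
      mul_assoc]
    congr 1
    nth_rw 2 [← Real.rpow_one |t|]
    rw [← Real.rpow_add this]; congr 1; ring

/-- Solving `A ≤ c A^α B^α` with `α < 1` for a finite `A`. -/
lemma ennreal_le_of_le_mul_rpow {A B c : ℝ≥0∞} {α : ℝ} (hα : α < 1) (hA : A ≠ ⊤)
    (h : A ≤ c * A ^ α * B) : A ≤ (c * B) ^ (1 - α)⁻¹ := by
  have h1 : 0 < 1 - α := by linarith
  rcases eq_or_ne A 0 with rfl | hA0
  · exact zero_le
  rw [ENNReal.le_rpow_inv_iff h1, ENNReal.rpow_sub _ _ hA0 hA, ENNReal.rpow_one]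
  exact ENNReal.div_le_of_le_mul (h.trans (le_of_eq (by ring)))

/-- The Sobolev inequality on the half-space, for the exponents `2` and `2n/(n-2)`. -/
lemma exists_sobolev_halfSpace (hn : 3 ≤ n) : ∃ C : ℝ≥0∞, C ≠ ⊤ ∧ ∀ f : 𝔼 → ℝ,
    ContDiffOn ℝ 1 f (halfSpace n) → ∀ K : Set 𝔼, IsCompact K →
    (∀ y ∈ halfSpace n, y ∉ K → f y = 0) →
    ∫⁻ y in halfSpace n, ‖f y‖ₑ ^ (2 * (n : ℝ) / ((n : ℝ) - 2)) ≤
      C * (∫⁻ y in halfSpace n, ‖fderivWithin ℝ f (halfSpace n) y‖ₑ ^ (2 : ℝ)) ^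
        ((n : ℝ) / ((n : ℝ) - 2)) := by
  have hn3 : (3 : ℝ) ≤ n := by exact_mod_cast hn
  set N : ℝ := (n : ℝ) with hN
  have hN2 : 0 < N - 2 := by linarith
  have hN1 : 0 < N - 1 := by linarith
  -- The exponent for which γp = 2(γ-1) = 2n/(n-2): the inequality with exponent one for |f|^γ,
  -- followed by Cauchy–Schwarz, then has the same integral `A` on both sides.
  set γ : ℝ := 2 * (N - 1) / (N - 2) with hγ
  set p : ℝ := N / (N - 1) with hp
  have hγ1 : 1 < γ := by rw [hγ, lt_div_iff₀ hN2]; linarith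
  have hp0 : 0 < p := by rw [hp]; positivity
  have hconj : Real.HolderConjugate N p := by
    rw [Real.holderConjugate_iff]
    refine ⟨by linarith, ?_⟩
    rw [hp]; field_simp; ring
  have hexp : (1 - p / 2)⁻¹ * (p / 2) = N / (N - 2) := by
    have : 1 - p / 2 = (N - 2) / (2 * (N - 1)) := by rw [hp]; field_simp; ring
    rw [this, hp]; field_simp
  have hα : p / 2 < 1 := by rw [hp, div_div, div_lt_one (by positivity)]; linarith
  refine ⟨(ENNReal.ofReal γ ^ p) ^ (1 - p / 2)⁻¹, ?_, ?_⟩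
  · exact ENNReal.rpow_ne_top_of_nonneg (inv_nonneg.2 (by linarith))
      (ENNReal.rpow_ne_top_of_nonneg hp0.le ENNReal.ofReal_ne_top)
  intro f hf K hK h0
  set D := fderivWithin ℝ f (halfSpace n) with hD
  set A := ∫⁻ y in halfSpace n, ‖f y‖ₑ ^ (2 * N / (N - 2)) with hA
  set B := ∫⁻ y in halfSpace n, ‖D y‖ₑ ^ (2 : ℝ) with hB
  have h2s : 0 < 2 * N / (N - 2) := by positivity
  have hAt : A < ⊤ := lintegral_rpow_lt_top hf.continuousOn hK h0 h2s
  have habs : ∀ t : ℝ, ∀ s : ℝ, 0 ≤ s → ‖(|t| ^ s : ℝ)‖ₑ = ‖t‖ₑ ^ s := by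
    intro t s hs
    rw [Real.enorm_rpow_of_nonneg (abs_nonneg t) hs, Real.enorm_abs]
  have key := lintegral_rpow_le_lintegral_fderivWithin hconj (contDiffOn_abs_rpow hf hγ1) hK
    (fun y hy hyK => by rw [h0 y hy hyK]; simp [Real.zero_rpow (by linarith : γ ≠ 0)])
  have hL : ∫⁻ y in halfSpace n, ‖(|f y| ^ γ : ℝ)‖ₑ ^ p = A := by
    refine lintegral_congr fun y => ?_
    rw [habs _ _ (by linarith), ← ENNReal.rpow_mul]
    congr 1; rw [hγ, hp]; field_simp
  have hmf : AEMeasurable (fun y => ‖f y‖ₑ ^ (γ - 1)) (volume.restrict (halfSpace n)) :=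
    ((hf.continuousOn.aemeasurable measurableSet_halfSpace).enorm).pow_const _
  have hmD : AEMeasurable (fun y => ‖D y‖ₑ) (volume.restrict (halfSpace n)) :=
    ((continuousOn_fderivWithin_halfSpace hf).aestronglyMeasurable measurableSet_halfSpace).enorm
  have hR : ∫⁻ y in halfSpace n, ‖fderivWithin ℝ (fun y => |f y| ^ γ) (halfSpace n) y‖ₑ ≤
      ENNReal.ofReal γ * (A ^ (1 / 2 : ℝ) * B ^ (1 / 2 : ℝ)) := by
    have hH := ENNReal.lintegral_mul_le_Lp_mul_Lq (volume.restrict (halfSpace n))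
      Real.HolderConjugate.two_two hmf hmD
    have hAe : ∫⁻ y in halfSpace n, (‖f y‖ₑ ^ (γ - 1)) ^ (2 : ℝ) = A := by
      refine lintegral_congr fun y => ?_
      rw [← ENNReal.rpow_mul]; congr 1; rw [hγ]; field_simp; ring
    rw [hAe] at hH
    refine le_trans ?_ (mul_le_mul_right hH _)
    rw [← lintegral_const_mul' _ _ ENNReal.ofReal_ne_top]
    refine setLIntegral_mono' measurableSet_halfSpace fun y hy => ?_
    have hd := (hasFDerivWithinAt_abs_rpow
      (hf.differentiableOn one_ne_zero y hy).hasFDerivWithinAt hγ1)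
    rw [hd.fderivWithin (uniqueDiffOn_halfSpace n y hy), enorm_smul, ← Real.enorm_abs,
      abs_rpow_sub_two_mul_self hγ1, enorm_mul, habs _ _ (by linarith), Pi.mul_apply,
      Real.enorm_of_nonneg (by linarith : 0 ≤ γ), mul_assoc]
  rw [hL] at key
  -- `A` reappears with exponent p/2 < 1, so it can be divided out.
  have key2 : A ≤ ENNReal.ofReal γ ^ p * A ^ (p / 2) * B ^ (p / 2) := by
    refine key.trans ((ENNReal.rpow_le_rpow hR hp0.le).trans (le_of_eq ?_))
    rw [ENNReal.mul_rpow_of_nonneg _ _ hp0.le, ENNReal.mul_rpow_of_nonneg _ _ hp0.le,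
      ← ENNReal.rpow_mul, ← ENNReal.rpow_mul, mul_assoc]
    congr 3 <;> ring_nf
  refine (ennreal_le_of_le_mul_rpow hα hAt.ne key2).trans (le_of_eq ?_)
  rw [ENNReal.mul_rpow_of_nonneg _ _ (inv_nonneg.2 (by linarith)), ← ENNReal.rpow_mul (x := B),
    mul_comm (p / 2), hexp]

end HalfSpace

end

/-! ### The divergence theorem on the half-space -/

section

section Divergence

lemma continuous_boundaryEmb (n : ℕ) [NeZero n] : Continuous (boundaryEmb n) := by
  refine (PiLp.continuous_toLp 2 _).comp (continuous_pi fun i => ?_)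
  by_cases h : i = 0
  · simp only [h, dite_true]; exact continuous_const
  · simp only [h, dite_false]; fun_prop

/-- Integration over the boundary hyperplane in the coordinates of `Fin m → ℝ`. -/
lemma integral_comp_boundaryEmb {m : ℕ} (F : EuclideanSpace ℝ (Fin (m + 1)) → ℝ) :
    ∫ z, F (boundaryEmb (m + 1) z) =
      ∫ w : Fin m → ℝ, F (WithLp.toLp 2 ((0 : Fin (m + 1)).insertNth (0 : ℝ) w)) := by
  set e : Fin m ≃ {i : Fin (m + 1) // i ≠ 0} := finSuccAboveEquiv 0
  have h1 : MeasurePreserving (MeasurableEquiv.piCongrLeft (fun _ => ℝ) e) volume volume :=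
    volume_measurePreserving_piCongrLeft (fun _ => ℝ) e
  have h2 : MeasurePreserving
      (fun x : {i : Fin (m + 1) // i ≠ 0} → ℝ => (WithLp.toLp 2 x)) volume volume :=
    PiLp.volume_preserving_toLp _
  have hm2 : MeasurableEmbedding
      (fun x : {i : Fin (m + 1) // i ≠ 0} → ℝ => (WithLp.toLp 2 x)) :=
    (MeasurableEquiv.toLp 2 ({i : Fin (m + 1) // i ≠ 0} → ℝ)).measurableEmbedding
  rw [← h2.integral_comp hm2, ← h1.integral_comp (MeasurableEquiv.measurableEmbedding _)]
  refine integral_congr_ae (Eventually.of_forall fun w => ?_)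
  dsimp only
  congr 1
  refine WithLp.ofLp_injective 2 (funext fun i => ?_)
  refine Fin.cases ?_ (fun j => ?_) i
  · simp [boundaryEmb]
  · have hj : (⟨j.succ, Fin.succ_ne_zero j⟩ : {i : Fin (m + 1) // i ≠ 0}) = e j := by
      ext; simp [e, finSuccAboveEquiv_apply]
    simp only [boundaryEmb, Fin.succ_ne_zero, dite_false]
    rw [hj, MeasurableEquiv.coe_piCongrLeft, Equiv.piCongrLeft_apply_apply]
    simp

/-- The divergence theorem on the half-space for compactly supported vector fields. -/
theorem integral_divergence_halfSpace {n : ℕ} [NeZero n]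
    {v : Fin n → EuclideanSpace ℝ (Fin n) → ℝ} (hv : ∀ i, ContDiffOn ℝ 1 (v i) (halfSpace n))
    {K : Set (EuclideanSpace ℝ (Fin n))} (hK : IsCompact K)
    (h0 : ∀ i, ∀ y ∈ halfSpace n, y ∉ K → v i y = 0) :
    ∫ z, v 0 (boundaryEmb n z) = -∫ y in halfSpace n, ∑ i,
      fderivWithin ℝ (v i) (halfSpace n) y (EuclideanSpace.single i (1 : ℝ)) := by
  obtain ⟨m, rfl⟩ : ∃ m, n = m + 1 := ⟨n - 1, (Nat.succ_pred_eq_of_ne_zero (NeZero.ne n)).symm⟩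
  obtain ⟨r, hr0, hr⟩ := hK.isBounded.subset_ball_lt 0 0
  set R := halfSpace (m + 1) with hR
  set L : (Fin (m + 1) → ℝ) → EuclideanSpace ℝ (Fin (m + 1)) := WithLp.toLp 2 with hL
  set e : (Fin (m + 1) → ℝ) ≃L[ℝ] EuclideanSpace ℝ (Fin (m + 1)) :=
    (EuclideanSpace.equiv (Fin (m + 1)) ℝ).symm with he
  have heL : ∀ x, e x = L x := fun x => rfl
  have hLp : MeasurePreserving L volume volume := PiLp.volume_preserving_toLp _
  have hLm : MeasurableEmbedding L :=
    (MeasurableEquiv.toLp 2 (Fin (m + 1) → ℝ)).measurableEmbedding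
  -- The box [0, r] × [-r, r]^m contains the part of `K` in the half-space. Since `K` lies in the
  -- open ball of radius r, only the face in the boundary hyperplane carries a flux.
  set a : Fin (m + 1) → ℝ := Fin.cons 0 (fun _ => -r) with ha
  set b : Fin (m + 1) → ℝ := fun _ => r with hb
  have hLR : ∀ x, L x ∈ R ↔ 0 ≤ x 0 := fun x => mem_halfSpace
  have hab : a ≤ b := by
    intro i; refine Fin.cases ?_ (fun j => ?_) i
    · simpa [ha, hb] using hr0.le
    · simp only [ha, hb, Fin.cons_succ]; linarith
  have hIccR : ∀ x ∈ Icc a b, L x ∈ R := fun x hx => (hLR x).2 (by simpa [ha] using hx.1 0)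
  have hKball : ∀ x, L x ∈ K → ∀ i, |x i| < r := by
    intro x hx i
    have h1 := hr hx
    rw [mem_ball_zero_iff] at h1
    have := PiLp.norm_apply_le (L x) i
    rw [Real.norm_eq_abs] at this
    exact lt_of_le_of_lt this h1
  have hKIcc : ∀ x, L x ∈ R → L x ∈ K → x ∈ Icc a b := by
    intro x hxR hxK
    have h := hKball x hxK
    refine ⟨fun i => ?_, fun i => (abs_lt.1 (h i)).2.le⟩
    refine Fin.cases ?_ (fun j => ?_) i
    · simpa [ha] using (hLR x).1 hxR
    · simpa [ha] using (abs_lt.1 (h j.succ)).1.le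
  set div : EuclideanSpace ℝ (Fin (m + 1)) → ℝ := fun y => ∑ i,
    fderivWithin ℝ (v i) R y (EuclideanSpace.single i (1 : ℝ)) with hdiv
  have hdc : ContinuousOn div R := by
    refine continuousOn_finsetSum _ fun i _ => ?_
    exact (continuousOn_fderivWithin_halfSpace (hv i)).clm_apply continuousOn_const
  have hLc : Continuous L := e.continuous
  have hbox := integral_divergence_of_hasFDerivAt_off_countable' a b hab
    (fun i x => v i (L x)) (fun i x => (fderivWithin ℝ (v i) R (L x)).comp e.toContinuousLinearMap)
    ∅ countable_empty
    (fun i => (hv i).continuousOn.comp hLc.continuousOn hIccR)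
    (by
      intro x hx i
      -- The box theorem asks for derivatives at interior points only, and there the half-space is a
      -- neighbourhood, so the derivative within it is a full derivative.
      have hx0 : 0 < x 0 := by simpa [ha] using (hx.1 0 trivial).1
      have hmem : R ∈ 𝓝 (L x) := by
        have : IsOpen {y : EuclideanSpace ℝ (Fin (m + 1)) | 0 < y 0} :=
          isOpen_lt continuous_const (by fun_prop)
        exact mem_of_superset (this.mem_nhds hx0) fun y hy => mem_halfSpace.2 (le_of_lt hy)
      have h1 : HasFDerivAt (v i) (fderivWithin ℝ (v i) R (L x)) (L x) :=
        (((hv i).differentiableOn one_ne_zero) _ (mem_of_mem_nhds hmem)).hasFDerivWithinAt.hasFDerivAt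
          hmem
      exact h1.comp x e.hasFDerivAt)
    (by
      refine ContinuousOn.integrableOn_compact isCompact_Icc ?_
      exact (hdc.comp hLc.continuousOn hIccR))
  have hI1 : ∫ x in Icc a b, ∑ i, ((fderivWithin ℝ (v i) R (L x)).comp
      e.toContinuousLinearMap) (Pi.single i 1) = ∫ y in R, div y := by
    have : ∫ y in R, div y = ∫ x in L ⁻¹' R, div (L x) :=
      (hLp.setIntegral_preimage_emb hLm div R).symm
    rw [this]
    symm
    refine setIntegral_eq_of_subset_of_forall_sdiff_eq_zero
      (hLm.measurable measurableSet_halfSpace) hIccR ?_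
    intro x hx
    have hxK : L x ∉ K := fun h => hx.2 (hKIcc x hx.1 h)
    refine Finset.sum_eq_zero fun i _ => ?_
    rw [fderivWithin_eq_zero_of_eq_zero hK.isClosed (h0 i) hx.1 hxK]; rfl
  -- On the lateral faces some coordinate has absolute value r, which is impossible on `K`.
  have hfaces : ∀ j : Fin m, ∀ s : ℝ, |s| = r → ∀ w ∈ Icc (a ∘ j.succ.succAbove)
      (b ∘ j.succ.succAbove), v j.succ (L (j.succ.insertNth s w)) = 0 := by
    intro j s hs w hw
    refine h0 _ _ ((hLR _).2 ?_) fun h => ?_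
    · have h1 := hw.1
      obtain ⟨k, hk⟩ : ∃ k, j.succ.succAbove k = 0 :=
        Fin.exists_succAbove_eq (Fin.succ_ne_zero j).symm
      have h2 := hw.1 k
      simp only [Function.comp_apply, hk, ha, Fin.cons_zero] at h2
      have h3 := Fin.insertNth_apply_succAbove (α := fun _ => ℝ) j.succ s w k
      rw [hk] at h3
      rw [h3]; exact h2
    · have := hKball _ h j.succ
      rw [Fin.insertNth_apply_same, hs] at this
      exact lt_irrefl _ this
  rw [hI1, Fin.sum_univ_succ, Finset.sum_eq_zero, add_zero] at hbox
  · rw [integral_comp_boundaryEmb, hbox]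
    have hz1 : ∫ w in Icc (a ∘ (0 : Fin (m + 1)).succAbove) (b ∘ (0 : Fin (m + 1)).succAbove),
        v 0 (L ((0 : Fin (m + 1)).insertNth (b 0) w)) = 0 := by
      refine setIntegral_eq_zero_of_forall_eq_zero fun w _ => ?_
      refine h0 _ _ ((hLR _).2 ?_) fun h => ?_
      · simpa [hb] using hr0.le
      · have := hKball _ h 0
        rw [Fin.insertNth_apply_same, hb, abs_of_pos hr0] at this
        exact lt_irrefl _ this
    rw [hz1, zero_sub, neg_neg]
    symm
    refine setIntegral_eq_integral_of_forall_compl_eq_zero fun w hw => ?_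
    have ha0 : a 0 = 0 := by simp [ha]
    rw [ha0]
    refine h0 _ _ ((hLR _).2 ?_) fun h => hw ?_
    · simp
    · have hK' := hKball _ h
      refine ⟨fun i => ?_, fun i => ?_⟩
      · have := (abs_lt.1 (hK' i.succ)).1.le
        simpa [ha] using this
      · have := (abs_lt.1 (hK' i.succ)).2.le
        simpa [hb] using this
  · intro j _
    rw [setIntegral_eq_zero_of_forall_eq_zero, setIntegral_eq_zero_of_forall_eq_zero, sub_zero]
    · intro w hw
      exact hfaces j _ (by simp [ha, abs_of_pos hr0]) w hw
    · intro w hw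
      exact hfaces j _ (by simp [hb, abs_of_pos hr0]) w hw

end Divergence

end

/-! ### The metric in charts and the normal field -/

section

section Geometry

variable {n : ℕ} [NeZero n] {M : Type*} [TopologicalSpace M]
  [ChartedSpace (EuclideanHalfSpace n) M] [IsManifold (𝓡∂ n) ∞ M]

instance : IsManifold (𝓡∂ n) 1 M := IsManifold.of_le (n := ∞) (by norm_cast)

/-- The derivative of the inverse of the preferred chart at `x`. -/
def coordMap (x : M) (y : EuclideanSpace ℝ (Fin n)) :
    EuclideanSpace ℝ (Fin n) →L[ℝ] TangentSpace (𝓡∂ n) ((extChartAt (𝓡∂ n) x).symm y) :=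
  mfderivWithin 𝓘(ℝ, EuclideanSpace ℝ (Fin n)) (𝓡∂ n) (extChartAt (𝓡∂ n) x).symm
    (range (𝓡∂ n)) y

lemma coordVector_eq (x : M) (y : EuclideanSpace ℝ (Fin n)) (i : Fin n) :
    coordVector x y i = coordMap x y (EuclideanSpace.single i (1 : ℝ)) := rfl

lemma target_subset_halfSpace (x : M) : (extChartAt (𝓡∂ n) x).target ⊆ halfSpace n :=
  extChartAt_target_subset_range x

lemma target_eq (x : M) : ∃ U : Set (EuclideanSpace ℝ (Fin n)), IsOpen U ∧
    (extChartAt (𝓡∂ n) x).target = U ∩ halfSpace n :=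
  ⟨(𝓡∂ n).symm ⁻¹' (chartAt (EuclideanHalfSpace n) x).target,
    (chartAt (EuclideanHalfSpace n) x).open_target.preimage (𝓡∂ n).continuous_symm,
    extChartAt_target (𝓡∂ n) x⟩

lemma target_mem_nhdsWithin {x : M} {y : EuclideanSpace ℝ (Fin n)}
    (hy : y ∈ (extChartAt (𝓡∂ n) x).target) :
    (extChartAt (𝓡∂ n) x).target ∈ 𝓝[halfSpace n] y :=
  extChartAt_target_mem_nhdsWithin_of_mem hy

lemma uniqueDiffOn_target (x : M) : UniqueDiffOn ℝ (extChartAt (𝓡∂ n) x).target :=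
  uniqueDiffOn_extChartAt_target x

lemma measurableSet_target (x : M) : MeasurableSet (extChartAt (𝓡∂ n) x).target := by
  obtain ⟨U, hU, h⟩ := target_eq (n := n) x
  rw [h]; exact hU.measurableSet.inter measurableSet_halfSpace

lemma single_sum_eq (c : EuclideanSpace ℝ (Fin n)) :
    c = ∑ i, c i • EuclideanSpace.single i (1 : ℝ) := by
  ext j
  simp [Pi.single_apply]

lemma coordMap_eq_sum (x : M) (y c : EuclideanSpace ℝ (Fin n)) :
    coordMap x y c = ∑ i, c i • coordVector x y i := by
  conv_lhs => rw [single_sum_eq c]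
  simp only [map_sum, map_smul, coordVector_eq]

lemma inner_coordMap (g : Metric n M) (x : M) (y c d : EuclideanSpace ℝ (Fin n)) :
    g.inner _ (coordMap x y c) (coordMap x y d) = ∑ i, ∑ j, c i * d j * gram g x y i j := by
  rw [coordMap_eq_sum, coordMap_eq_sum]
  simp only [map_sum, map_smul, sum_apply, smul_apply,
    smul_eq_mul, gram, Finset.mul_sum]
  rw [Finset.sum_comm]
  refine Finset.sum_congr rfl fun i _ => Finset.sum_congr rfl fun j _ => by ring

lemma coordMap_injective {x : M} {y : EuclideanSpace ℝ (Fin n)}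
    (hy : y ∈ (extChartAt (𝓡∂ n) x).target) : Function.Injective (coordMap x y) :=
  (isInvertible_mfderivWithin_extChartAt_symm hy).injective

lemma gram_posDef (g : Metric n M) {x : M} {y : EuclideanSpace ℝ (Fin n)}
    (hy : y ∈ (extChartAt (𝓡∂ n) x).target) : (gram g x y).PosDef := by
  refine Matrix.PosDef.of_dotProduct_mulVec_pos ?_ fun c hc => ?_
  · ext i j
    rw [Matrix.conjTranspose_apply, star_trivial]
    exact g.symm _ _ _
  · have h1 := inner_coordMap g x y (WithLp.toLp 2 c) (WithLp.toLp 2 c)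
    have h2 : star c ⬝ᵥ (gram g x y).mulVec c = g.inner _ (coordMap x y (WithLp.toLp 2 c))
        (coordMap x y (WithLp.toLp 2 c)) := by
      rw [h1]
      simp only [dotProduct, Matrix.mulVec, star_trivial, Finset.mul_sum]
      refine Finset.sum_congr rfl fun i _ => Finset.sum_congr rfl fun j _ => ?_
      change c i * (gram g x y i j * c j) = c i * c j * gram g x y i j
      ring
    rw [h2]
    refine g.pos _ _ fun h => hc ?_
    have := coordMap_injective hy (h.trans (map_zero (coordMap x y)).symm)
    exact (WithLp.toLp_eq_zero 2).1 this

lemma contDiffOn_of_contMDiff {f : M → ℝ} (hf : ContMDiff (𝓡∂ n) 𝓘(ℝ, ℝ) ∞ f) (x : M) :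
    ContDiffOn ℝ ∞ (fun y => f ((extChartAt (𝓡∂ n) x).symm y)) (extChartAt (𝓡∂ n) x).target :=
  contMDiffOn_iff_contDiffOn.1
    (hf.comp_contMDiffOn (contMDiffOn_extChartAt_symm x))

/-- On the chart domain the coordinate vectors are the frame given by the trivialization of the
tangent bundle at `x`, hence a smooth frame, and the metric is a smooth section. -/
lemma contDiffOn_gram (g : Metric n M) (x : M) (i j : Fin n) :
    ContDiffOn ℝ ∞ (fun y => gram g x y i j) (extChartAt (𝓡∂ n) x).target := by
  set e := trivializationAt (EuclideanSpace ℝ (Fin n)) (TangentSpace (𝓡∂ n) : M → Type _) x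
  have hfr : ∀ i : Fin n, ContMDiffOn (𝓡∂ n) ((𝓡∂ n).prod 𝓘(ℝ, EuclideanSpace ℝ (Fin n))) ∞
      (fun p : M => TotalSpace.mk' (EuclideanSpace ℝ (Fin n)) p
        (e.symmL ℝ p (EuclideanSpace.single i (1 : ℝ)))) e.baseSet := by
    intro i
    rw [e.contMDiffOn_section_baseSet_iff]
    refine (contMDiffOn_const (c := EuclideanSpace.single i (1 : ℝ))).congr fun p hp => ?_
    simp [hp]
  have h := ContMDiffOn.clm_bundle_apply₂ (F₁ := EuclideanSpace ℝ (Fin n))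
    (F₂ := EuclideanSpace ℝ (Fin n)) (F₃ := ℝ) (E₃ := Bundle.Trivial M ℝ)
    (ψ := fun p : M => g.inner p) (b := fun p : M => p) (s := e.baseSet)
    g.contMDiff.contMDiffOn (hfr i) (hfr j)
  have h2 : ContMDiffOn (𝓡∂ n) 𝓘(ℝ, ℝ) ∞ (fun p : M => g.inner p
      (e.symmL ℝ p (EuclideanSpace.single i (1 : ℝ)))
      (e.symmL ℝ p (EuclideanSpace.single j (1 : ℝ)))) e.baseSet := by
    intro p hp
    have := h p hp
    rw [contMDiffWithinAt_totalSpace] at this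
    exact this.2
  have hb : e.baseSet = (chartAt (EuclideanHalfSpace n) x).source :=
    TangentBundle.trivializationAt_baseSet x
  have h3 := h2.comp (contMDiffOn_extChartAt_symm (n := ∞) (I := 𝓡∂ n) x)
    (fun y hy => by
      rw [mem_preimage, hb, ← extChartAt_source (𝓡∂ n)]
      exact (extChartAt (𝓡∂ n) x).map_target hy)
  refine (contMDiffOn_iff_contDiffOn.1 h3).congr fun y hy => ?_
  have hs : (extChartAt (𝓡∂ n) x).symm y ∈ (chartAt (EuclideanHalfSpace n) x).source := by
    rw [← extChartAt_source (𝓡∂ n)]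
    exact (extChartAt (𝓡∂ n) x).map_target hy
  have key : e.symmL ℝ ((extChartAt (𝓡∂ n) x).symm y) = coordMap x y := by
    rw [TangentBundle.symmL_trivializationAt hs, (extChartAt (𝓡∂ n) x).right_inv hy]
    rfl
  simp only [Function.comp_apply, key]
  rfl

/-- The partial derivatives of `f` in the preferred chart at `x`. -/
lemma mfderiv_coordMap {f : M → ℝ} (hf : ContMDiff (𝓡∂ n) 𝓘(ℝ, ℝ) ∞ f) {x : M}
    {y : EuclideanSpace ℝ (Fin n)} (hy : y ∈ (extChartAt (𝓡∂ n) x).target)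
    (c : EuclideanSpace ℝ (Fin n)) :
    mfderiv (𝓡∂ n) 𝓘(ℝ, ℝ) f ((extChartAt (𝓡∂ n) x).symm y) (coordMap x y c) =
      fderivWithin ℝ (fun y => f ((extChartAt (𝓡∂ n) x).symm y)) (halfSpace n) y c := by
  have h1 : MDifferentiableAt (𝓡∂ n) 𝓘(ℝ, ℝ) f ((extChartAt (𝓡∂ n) x).symm y) :=
    hf.mdifferentiable (by simp) _
  have h2 := mdifferentiableWithinAt_extChartAt_symm (I := 𝓡∂ n) hy
  have h3 := mfderiv_comp_mfderivWithin y h1 h2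
    ((𝓡∂ n).uniqueMDiffOn _ (target_subset_halfSpace x hy))
  rw [← mfderivWithin_eq_fderivWithin]
  have := congrArg (fun L => L c) h3
  exact this.symm

lemma normSq_nonneg (g : Metric n M) (p : M) (v : TangentSpace (𝓡∂ n) p) : 0 ≤ normSq g p v := by
  rcases eq_or_ne v 0 with rfl | h
  · simp [normSq]
  · exact (g.pos p v h).le

lemma inner_sq_le (g : Metric n M) (p : M) (v w : TangentSpace (𝓡∂ n) p) :
    g.inner p v w ^ 2 ≤ normSq g p v * normSq g p w :=
  LinearMap.BilinForm.apply_sq_le_of_symm (bilin g p) (normSq_nonneg g p)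
    ⟨fun v w => g.symm p v w⟩ v w

lemma sqrt_normSq_add_le (g : Metric n M) (p : M) (v w : TangentSpace (𝓡∂ n) p) :
    √(normSq g p (v + w)) ≤ √(normSq g p v) + √(normSq g p w) := by
  have hv := normSq_nonneg g p v
  have hw := normSq_nonneg g p w
  refine Real.sqrt_le_iff.2 ⟨by positivity, ?_⟩
  have h1 : normSq g p (v + w) = normSq g p v + 2 * g.inner p v w + normSq g p w := by
    simp only [normSq, map_add, add_apply]
    rw [g.symm p w v]; ring
  have h2 : g.inner p v w ≤ √(normSq g p v) * √(normSq g p w) := by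
    rw [← Real.sqrt_mul hv]
    exact Real.le_sqrt_of_sq_le (inner_sq_le g p v w)
  rw [h1, add_sq, Real.sq_sqrt hv, Real.sq_sqrt hw]
  linarith

lemma normSq_neg (g : Metric n M) (p : M) (v : TangentSpace (𝓡∂ n) p) :
    normSq g p (-v) = normSq g p v := by
  simp [normSq]

/-- Cauchy–Schwarz for df(c) = g(∇f, c), read in coordinates. -/
lemma sq_fderivWithin_le (g : Metric n M) {f : M → ℝ} (hf : ContMDiff (𝓡∂ n) 𝓘(ℝ, ℝ) ∞ f) {x : M}
    {y : EuclideanSpace ℝ (Fin n)} (hy : y ∈ (extChartAt (𝓡∂ n) x).target)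
    (c : EuclideanSpace ℝ (Fin n)) :
    (fderivWithin ℝ (fun y => f ((extChartAt (𝓡∂ n) x).symm y)) (halfSpace n) y c) ^ 2 ≤
      normSq g _ (grad g f ((extChartAt (𝓡∂ n) x).symm y)) *
        ∑ i, ∑ j, c i * c j * gram g x y i j := by
  rw [← mfderiv_coordMap hf hy, ← inner_grad g, ← inner_coordMap]
  exact inner_sq_le g _ _ _

lemma coordMap_mfderiv {x : M} {y : EuclideanSpace ℝ (Fin n)}
    (hy : y ∈ (extChartAt (𝓡∂ n) x).target)
    (v : TangentSpace (𝓡∂ n) ((extChartAt (𝓡∂ n) x).symm y)) :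
    coordMap x y (mfderiv (𝓡∂ n) 𝓘(ℝ, EuclideanSpace ℝ (Fin n)) (extChartAt (𝓡∂ n) x)
      ((extChartAt (𝓡∂ n) x).symm y) v) = v :=
  congrArg (fun L => L v) (mfderivWithin_extChartAt_symm_comp_mfderiv_extChartAt hy)

/-- The components of a tangent vector at `p` in the preferred chart at `x`. -/
def comps (x p : M) (v : TangentSpace (𝓡∂ n) p) : EuclideanSpace ℝ (Fin n) :=
  mfderiv (𝓡∂ n) 𝓘(ℝ, EuclideanSpace ℝ (Fin n)) (extChartAt (𝓡∂ n) x) p v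

lemma normSq_eq (g : Metric n M) {x p : M} (hp : p ∈ (extChartAt (𝓡∂ n) x).source)
    (v : TangentSpace (𝓡∂ n) p) :
    normSq g p v = ∑ i, ∑ j, comps x p v i * comps x p v j *
      gram g x (extChartAt (𝓡∂ n) x p) i j := by
  obtain ⟨y, hy, rfl⟩ : ∃ y ∈ (extChartAt (𝓡∂ n) x).target, (extChartAt (𝓡∂ n) x).symm y = p :=
    ⟨_, (extChartAt (𝓡∂ n) x).map_source hp, (extChartAt (𝓡∂ n) x).left_inv hp⟩
  rw [(extChartAt (𝓡∂ n) x).right_inv hy, ← inner_coordMap]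
  unfold comps
  rw [coordMap_mfderiv hy]; rfl

section Det

variable {F : Type*} [NormedAddCommGroup F] [NormedSpace ℝ F] {S : Set F} {k : ℕ∞ω}
  {ι : Type*} [Fintype ι] [DecidableEq ι]

lemma contDiffOn_det {A : F → Matrix ι ι ℝ} (hA : ∀ i j, ContDiffOn ℝ k (fun y => A y i j) S) :
    ContDiffOn ℝ k (fun y => (A y).det) S := by
  simp only [Matrix.det_apply']
  exact ContDiffOn.sum fun σ _ => contDiffOn_const.mul (contDiffOn_prod fun i _ => hA _ _)

/-- The inverse metric is handled through the adjugate, whose entries are determinants and therefore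
inherit smoothness with no condition of invertibility. -/
lemma contDiffOn_adjugate {A : F → Matrix ι ι ℝ} (hA : ∀ i j, ContDiffOn ℝ k (fun y => A y i j) S)
    (i j : ι) : ContDiffOn ℝ k (fun y => (A y).adjugate i j) S := by
  simp only [Matrix.adjugate_apply]
  refine contDiffOn_det fun a b => ?_
  simp only [Matrix.updateRow_apply]
  split_ifs
  · exact contDiffOn_const
  · exact hA a b

end Det

/-- The Gram matrix of the boundary hyperplane. -/
abbrev boundaryGram (g : Metric n M) (x : M) (y : EuclideanSpace ℝ (Fin n)) :
    Matrix {i : Fin n // i ≠ 0} {i : Fin n // i ≠ 0} ℝ :=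
  (gram g x y).submatrix Subtype.val Subtype.val

/-- This cofactor is det g · g⁰⁰; the identity is what links the normal field to the surface
density. -/
lemma adjugate_zero_zero {n : ℕ} [NeZero n] (A : Matrix (Fin n) (Fin n) ℝ) :
    A.adjugate 0 0 = (A.submatrix (Subtype.val : {i : Fin n // i ≠ 0} → Fin n) Subtype.val).det := by
  obtain ⟨m, rfl⟩ : ∃ m, n = m + 1 := ⟨n - 1, (Nat.succ_pred_eq_of_ne_zero (NeZero.ne n)).symm⟩
  rw [Matrix.adjugate_fin_succ_eq_det_submatrix,
    ← Matrix.det_submatrix_equiv_self (finSuccAboveEquiv (0 : Fin (m + 1)))]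
  simp only [Fin.val_zero, add_zero, pow_zero, one_mul, Matrix.submatrix_submatrix]
  rfl

lemma boundaryGram_posDef (g : Metric n M) {x : M} {y : EuclideanSpace ℝ (Fin n)}
    (hy : y ∈ (extChartAt (𝓡∂ n) x).target) : (boundaryGram g x y).PosDef :=
  (gram_posDef g hy).submatrix Subtype.val_injective

/-- The components of `√(det g) N`, where `N` is the unit vector field normal to the level sets of
the coordinate `y 0`. -/
def normalField (g : Metric n M) (x : M) (i : Fin n) (y : EuclideanSpace ℝ (Fin n)) : ℝ :=
  (gram g x y).adjugate i 0 / √((gram g x y).adjugate 0 0)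

lemma adjugate_zero_zero_pos (g : Metric n M) {x : M} {y : EuclideanSpace ℝ (Fin n)}
    (hy : y ∈ (extChartAt (𝓡∂ n) x).target) : 0 < (gram g x y).adjugate 0 0 := by
  rw [adjugate_zero_zero]; exact (boundaryGram_posDef g hy).det_pos

/-- The flux of the field through the boundary hyperplane is thus exactly the Riemannian surface
measure. -/
lemma normalField_zero (g : Metric n M) {x : M} {y : EuclideanSpace ℝ (Fin n)} :
    normalField g x 0 y = √(boundaryGram g x y).det := by
  rw [normalField, adjugate_zero_zero, Real.div_sqrt]

lemma contDiffOn_normalField (g : Metric n M) (x : M) (i : Fin n) :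
    ContDiffOn ℝ ∞ (normalField g x i) (extChartAt (𝓡∂ n) x).target := by
  refine ContDiffOn.div (contDiffOn_adjugate (contDiffOn_gram g x) _ _) ?_ fun y hy => ?_
  · exact (contDiffOn_adjugate (contDiffOn_gram g x) _ _).sqrt
      fun y hy => (adjugate_zero_zero_pos g hy).ne'
  · exact (Real.sqrt_pos.2 (adjugate_zero_zero_pos g hy)).ne'

/-- The field has g-length √(det g), so Cauchy–Schwarz gives constant one. This is the source of the
sharp gradient term in the trace inequality. -/
lemma abs_normalField_fderivWithin_le (g : Metric n M) {f : M → ℝ}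
    (hf : ContMDiff (𝓡∂ n) 𝓘(ℝ, ℝ) ∞ f) {x : M} {y : EuclideanSpace ℝ (Fin n)}
    (hy : y ∈ (extChartAt (𝓡∂ n) x).target) :
    |∑ i, normalField g x i y *
      fderivWithin ℝ (fun y => f ((extChartAt (𝓡∂ n) x).symm y)) (halfSpace n) y
        (EuclideanSpace.single i (1 : ℝ))| ≤
      √(gram g x y).det * √(normSq g _ (grad g f ((extChartAt (𝓡∂ n) x).symm y))) := by
  set G := gram g x y with hG
  have hA := adjugate_zero_zero_pos g hy
  rw [← hG] at hA
  set c : EuclideanSpace ℝ (Fin n) := WithLp.toLp 2 fun i => normalField g x i y with hc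
  have h1 : ∑ i, normalField g x i y *
      fderivWithin ℝ (fun y => f ((extChartAt (𝓡∂ n) x).symm y)) (halfSpace n) y
        (EuclideanSpace.single i (1 : ℝ)) =
      fderivWithin ℝ (fun y => f ((extChartAt (𝓡∂ n) x).symm y)) (halfSpace n) y c := by
    conv_rhs => rw [single_sum_eq c]
    simp only [map_sum, map_smul, smul_eq_mul, hc]
  have h2 : ∑ i, ∑ j, c i * c j * G i j = G.det := by
    -- The zeroth column of G · adj G = det G · 1: lowering the index of the field leaves a multiple
    -- of dy⁰, which makes its squared length collapse to one term.
    have h3 : ∀ i, ∑ j, G i j * G.adjugate j 0 = if i = 0 then G.det else 0 := by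
      intro i
      have := congrFun (congrFun (Matrix.mul_adjugate G) i) 0
      rw [Matrix.mul_apply] at this
      rw [this]; simp [Matrix.one_apply]
    have h4 : ∀ i, ∑ j, c i * c j * G i j = c i / √(G.adjugate 0 0) *
        ∑ j, G i j * G.adjugate j 0 := by
      intro i
      rw [Finset.mul_sum]
      refine Finset.sum_congr rfl fun j _ => ?_
      change c i * (G.adjugate j 0 / √(G.adjugate 0 0)) * G i j = _
      ring
    simp only [h4, h3, mul_ite, mul_zero, Finset.sum_ite_eq', Finset.mem_univ, if_true]
    change G.adjugate 0 0 / √(G.adjugate 0 0) / √(G.adjugate 0 0) * G.det = G.det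
    rw [div_div, Real.mul_self_sqrt hA.le, div_self hA.ne', one_mul]
  rw [h1, ← Real.sqrt_mul (gram_posDef g hy).det_pos.le, ← h2, mul_comm]
  exact Real.abs_le_sqrt (sq_fderivWithin_le g hf hy c)

/-- The components of the gradient in the preferred chart at `x`. -/
lemma comps_grad (g : Metric n M) {f : M → ℝ} (hf : ContMDiff (𝓡∂ n) 𝓘(ℝ, ℝ) ∞ f) {x p : M}
    (hp : p ∈ (extChartAt (𝓡∂ n) x).source) (i : Fin n) :
    comps x p (grad g f p) i = (gram g x (extChartAt (𝓡∂ n) x p)).det⁻¹ *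
      ∑ j, (gram g x (extChartAt (𝓡∂ n) x p)).adjugate i j *
        fderivWithin ℝ (fun y => f ((extChartAt (𝓡∂ n) x).symm y)) (halfSpace n)
          (extChartAt (𝓡∂ n) x p) (EuclideanSpace.single j (1 : ℝ)) := by
  obtain ⟨y, hy, rfl⟩ : ∃ y ∈ (extChartAt (𝓡∂ n) x).target, (extChartAt (𝓡∂ n) x).symm y = p :=
    ⟨_, (extChartAt (𝓡∂ n) x).map_source hp, (extChartAt (𝓡∂ n) x).left_inv hp⟩
  rw [(extChartAt (𝓡∂ n) x).right_inv hy]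
  set ξ := comps x ((extChartAt (𝓡∂ n) x).symm y) (grad g f ((extChartAt (𝓡∂ n) x).symm y)) with hξ
  set G := gram g x y with hG
  have hdet : G.det ≠ 0 := (gram_posDef g hy).det_pos.ne'
  have h1 : ∀ j, fderivWithin ℝ (fun y => f ((extChartAt (𝓡∂ n) x).symm y)) (halfSpace n) y
      (EuclideanSpace.single j (1 : ℝ)) = G.mulVec ξ.ofLp j := by
    intro j
    rw [← mfderiv_coordMap hf hy, ← inner_grad g]
    have h2 : coordMap x y ξ = grad g f ((extChartAt (𝓡∂ n) x).symm y) := coordMap_mfderiv hy _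
    rw [← h2, g.symm, inner_coordMap, Finset.sum_eq_single j]
    · refine Finset.sum_congr rfl fun k _ => ?_
      change (EuclideanSpace.single j (1 : ℝ) : EuclideanSpace ℝ (Fin n)) j * ξ k * G j k = G j k * ξ k
      simp [mul_comm]
    · intro b _ hb
      refine Finset.sum_eq_zero fun k _ => ?_
      simp [hb]
    · simp
  have h3 : ∑ j, G.adjugate i j * G.mulVec ξ.ofLp j = G.det * ξ i := by
    change (G.adjugate.mulVec (G.mulVec ξ.ofLp)) i = _
    rw [Matrix.mulVec_mulVec, Matrix.adjugate_mul, Matrix.smul_mulVec, Matrix.one_mulVec]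
    rfl
  simp only [h1]
  rw [h3, inv_mul_cancel_left₀ hdet]

end Geometry

end

/-! ### Change of charts, and the restriction of the measures to chart domains -/

section

section Measure

/-- One-sided domination suffices: every member is at most `m y` plus the measure ⊤ on the
complement of `U`, so the supremum is as well, and the second summand disappears on restricting to
`U`. -/
lemma iSup_measure_restrict {X M : Type*} [MeasurableSpace M] {m : X → Measure M} {U : Set M}
    (hU : MeasurableSet U) {y : X} (hle : ∀ x, (m x).restrict U ≤ m y) (h0 : m y Uᶜ = 0) :
    (⨆ x, m x).restrict U = m y := by
  have hy : (m y).restrict U = m y := by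
    rw [Measure.restrict_eq_self_of_ae_mem]
    exact h0
  refine le_antisymm ?_ ?_
  · have h : (⨆ x, m x) ≤ m y + (⊤ : Measure M).restrict Uᶜ := by
      refine iSup_le fun x => ?_
      rw [← Measure.restrict_add_restrict_compl (μ := m x) hU]
      exact add_le_add (hle x) (Measure.restrict_mono subset_rfl le_top)
    refine (Measure.restrict_mono subset_rfl h).trans ?_
    rw [Measure.restrict_add, hy, Measure.restrict_restrict hU, inter_compl_self,
      Measure.restrict_empty, add_zero]
  · rw [← hy]
    exact Measure.restrict_mono subset_rfl (le_iSup m y)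

/-- The change of variables formula for Riemannian densities. -/
lemma lintegral_image_sqrt_det {ι : Type*} [Fintype ι] [DecidableEq ι]
    {s : Set (EuclideanSpace ℝ ι)} (hs : MeasurableSet s)
    {ψ : EuclideanSpace ℝ ι → EuclideanSpace ℝ ι}
    {D : EuclideanSpace ℝ ι → EuclideanSpace ℝ ι →L[ℝ] EuclideanSpace ℝ ι}
    (hD : ∀ y ∈ s, HasFDerivWithinAt ψ (D y) s y) (hinj : InjOn ψ s)
    {G G' : EuclideanSpace ℝ ι → Matrix ι ι ℝ}
    (hG : ∀ y ∈ s, ∀ i j, G y i j = ∑ k, ∑ l, D y (EuclideanSpace.single i 1) k *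
      D y (EuclideanSpace.single j 1) l * G' (ψ y) k l) :
    ∫⁻ z in ψ '' s, ENNReal.ofReal √(G' z).det = ∫⁻ y in s, ENNReal.ofReal √(G y).det := by
  rw [lintegral_image_eq_lintegral_abs_det_fderiv_mul volume hs hD hinj]
  refine setLIntegral_congr_fun hs fun y hy => ?_
  -- With the Jacobian matrix J the hypothesis `hG` reads G = Jᵀ G' J, hence det G = (det J)² det
  -- G', and √ produces the factor |det J| of the change of variables.
  set J : Matrix ι ι ℝ := fun k i => D y (EuclideanSpace.single i 1) k with hJ
  have hdet : (D y).det = J.det := by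
    rw [ContinuousLinearMap.det,
      ← LinearMap.det_toMatrix (EuclideanSpace.basisFun ι ℝ).toBasis]
    congr 1
  have hGJ : G y = J.transpose * G' (ψ y) * J := by
    ext i j
    rw [hG y hy i j, Matrix.mul_apply, Finset.sum_comm]
    refine Finset.sum_congr rfl fun l _ => ?_
    rw [Matrix.mul_apply, Finset.sum_mul]
    refine Finset.sum_congr rfl fun k _ => ?_
    change J k i * J l j * G' (ψ y) k l = J k i * G' (ψ y) k l * J l j
    ring
  rw [hdet, ← ENNReal.ofReal_mul (abs_nonneg _), hGJ, Matrix.det_mul, Matrix.det_mul,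
    Matrix.det_transpose, ← Real.sqrt_sq_eq_abs, ← Real.sqrt_mul (sq_nonneg _)]
  congr 2; ring

variable {n : ℕ} [NeZero n] {M : Type*} [TopologicalSpace M]
  [ChartedSpace (EuclideanHalfSpace n) M] [IsManifold (𝓡∂ n) ∞ M]

/-- The inclusion of the boundary hyperplane as a continuous linear map. -/
def boundaryEmbL (n : ℕ) [NeZero n] :
    EuclideanSpace ℝ {i : Fin n // i ≠ 0} →L[ℝ] EuclideanSpace ℝ (Fin n) :=
  LinearMap.toContinuousLinearMap
    { toFun := boundaryEmb n
      map_add' := fun z w => by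
        ext i; by_cases h : i = 0 <;> simp [boundaryEmb, h]
      map_smul' := fun c z => by
        ext i; by_cases h : i = 0 <;> simp [boundaryEmb, h] }

lemma boundaryEmbL_apply (z : EuclideanSpace ℝ {i : Fin n // i ≠ 0}) :
    boundaryEmbL n z = boundaryEmb n z := rfl

lemma boundaryEmb_single (i : {i : Fin n // i ≠ 0}) :
    boundaryEmb n (EuclideanSpace.single i (1 : ℝ)) = EuclideanSpace.single i.1 (1 : ℝ) := by
  ext j
  by_cases h : j = 0
  · subst h
    simp [boundaryEmb, i.2.symm]
  · simp [boundaryEmb, h, Subtype.ext_iff]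

lemma boundaryEmb_zero (z : EuclideanSpace ℝ {i : Fin n // i ≠ 0}) : boundaryEmb n z 0 = 0 := by
  simp [boundaryEmb]

/-- The projection to the boundary hyperplane. -/
def boundaryProj (n : ℕ) [NeZero n] :
    EuclideanSpace ℝ (Fin n) →L[ℝ] EuclideanSpace ℝ {i : Fin n // i ≠ 0} :=
  LinearMap.toContinuousLinearMap
    { toFun := fun y => WithLp.toLp 2 fun i => y i.1
      map_add' := fun _ _ => rfl
      map_smul' := fun _ _ => rfl }

lemma boundaryProj_apply (y : EuclideanSpace ℝ (Fin n)) (i : {i : Fin n // i ≠ 0}) :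
    boundaryProj n y i = y i.1 := rfl

lemma boundaryProj_boundaryEmb (z : EuclideanSpace ℝ {i : Fin n // i ≠ 0}) :
    boundaryProj n (boundaryEmb n z) = z := by
  ext i; simp [boundaryProj_apply, boundaryEmb, i.2]

lemma boundaryEmb_boundaryProj {y : EuclideanSpace ℝ (Fin n)} (h : y 0 = 0) :
    boundaryEmb n (boundaryProj n y) = y := by
  ext i
  by_cases hi : i = 0
  · subst hi; rw [boundaryEmb_zero, h]
  · simp [boundaryProj_apply, boundaryEmb, hi]

lemma interior_halfSpace : interior (halfSpace n) = {y | 0 < y 0} :=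
  interior_range_modelWithCornersEuclideanHalfSpace n

/-- Being a boundary point does not depend on the chart. Hence transition maps send the boundary
hyperplane into itself. -/
lemma isBoundaryPoint_iff {x p : M} (hp : p ∈ (extChartAt (𝓡∂ n) x).source) :
    p ∈ (𝓡∂ n).boundary M ↔ extChartAt (𝓡∂ n) x p 0 = 0 := by
  have hp' : p ∈ (chartAt (EuclideanHalfSpace n) x).source := by rwa [extChartAt_source] at hp
  have h1 := (𝓡∂ n).isBoundaryPoint_iff_of_mem_atlas (n := ∞) (by simp)
    (chart_mem_atlas (EuclideanHalfSpace n) x) hp'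
  have hy := (extChartAt (𝓡∂ n) x).map_source hp
  change (𝓡∂ n).IsBoundaryPoint p ↔ _
  rw [h1]
  change extChartAt (𝓡∂ n) x p ∈ frontier (extChartAt (𝓡∂ n) x).target ↔ _
  obtain ⟨U, hU, hT⟩ := target_eq (n := n) x
  have hyU := hy
  rw [hT] at hyU
  have h0 := mem_halfSpace.1 hyU.2
  rw [← not_iff_not, ← mem_interior_iff_notMem_frontier hy, hT, interior_inter, hU.interior_eq,
    interior_halfSpace]
  constructor
  · exact fun h => (ne_of_lt h.2).symm
  · exact fun h => ⟨hyU.1, lt_of_le_of_ne h0 (Ne.symm h)⟩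

lemma inner_eq (g : Metric n M) {x p : M} (hp : p ∈ (extChartAt (𝓡∂ n) x).source)
    (v w : TangentSpace (𝓡∂ n) p) :
    g.inner p v w = ∑ i, ∑ j, comps x p v i * comps x p w j *
      gram g x (extChartAt (𝓡∂ n) x p) i j := by
  obtain ⟨y, hy, rfl⟩ : ∃ y ∈ (extChartAt (𝓡∂ n) x).target, (extChartAt (𝓡∂ n) x).symm y = p :=
    ⟨_, (extChartAt (𝓡∂ n) x).map_source hp, (extChartAt (𝓡∂ n) x).left_inv hp⟩
  rw [(extChartAt (𝓡∂ n) x).right_inv hy, ← inner_coordMap]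
  unfold comps
  rw [coordMap_mfderiv hy, coordMap_mfderiv hy]

section Transition

variable (x x' : M)

/-- The transition map from the preferred chart at `x'` to that at `x`. -/
def transition (y : EuclideanSpace ℝ (Fin n)) : EuclideanSpace ℝ (Fin n) :=
  extChartAt (𝓡∂ n) x ((extChartAt (𝓡∂ n) x').symm y)

variable {x x'}

lemma hasFDerivWithinAt_transition {y : EuclideanSpace ℝ (Fin n)}
    (hy : y ∈ (extChartAt (𝓡∂ n) x').target)
    (hyx : (extChartAt (𝓡∂ n) x').symm y ∈ (extChartAt (𝓡∂ n) x).source) :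
    HasFDerivWithinAt (transition x x') (fderivWithin ℝ (transition x x') (halfSpace n) y)
      (halfSpace n) y ∧ ∀ c, comps x _ (coordMap x' y c) =
        fderivWithin ℝ (transition x x') (halfSpace n) y c := by
  have h1 : MDifferentiableAt (𝓡∂ n) 𝓘(ℝ, EuclideanSpace ℝ (Fin n)) (extChartAt (𝓡∂ n) x)
      ((extChartAt (𝓡∂ n) x').symm y) :=
    mdifferentiableAt_extChartAt (by rwa [extChartAt_source] at hyx)
  have h2 := mdifferentiableWithinAt_extChartAt_symm (I := 𝓡∂ n) hy
  have hu := (𝓡∂ n).uniqueMDiffOn _ (target_subset_halfSpace x' hy)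
  have h3 := mfderiv_comp_mfderivWithin y h1 h2 hu
  have h4 := h1.comp_mdifferentiableWithinAt y h2
  refine ⟨?_, fun c => ?_⟩
  · exact (mdifferentiableWithinAt_iff_differentiableWithinAt.1 h4).hasFDerivWithinAt
  · rw [← mfderivWithin_eq_fderivWithin]
    exact (congrArg (fun L => L c) h3).symm

/-- By the chain rule, the derivative of the transition map gives the components, in the chart at
`x`, of the coordinate vectors of the chart at `x'`. -/
lemma gram_transition {y : EuclideanSpace ℝ (Fin n)}
    (hy : y ∈ (extChartAt (𝓡∂ n) x').target)
    (hyx : (extChartAt (𝓡∂ n) x').symm y ∈ (extChartAt (𝓡∂ n) x).source)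
    (g : Metric n M) (i j : Fin n) :
    gram g x' y i j = ∑ k, ∑ l,
      fderivWithin ℝ (transition x x') (halfSpace n) y (EuclideanSpace.single i 1) k *
      fderivWithin ℝ (transition x x') (halfSpace n) y (EuclideanSpace.single j 1) l *
      gram g x (transition x x' y) k l := by
  have := (hasFDerivWithinAt_transition hy hyx).2
  rw [← this, ← this]
  exact inner_eq g hyx _ _

end Transition

lemma transition_injOn (x x' : M) : InjOn (transition (n := n) x x')
    {y | y ∈ (extChartAt (𝓡∂ n) x').target ∧
      (extChartAt (𝓡∂ n) x').symm y ∈ (extChartAt (𝓡∂ n) x).source} :=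
  fun _ h _ h' he => (extChartAt (𝓡∂ n) x').symm.injOn h.1 h'.1
    ((extChartAt (𝓡∂ n) x).injOn h.2 h'.2 he)

variable [MeasurableSpace M] [BorelSpace M]

lemma measurableSet_inter_preimage {α β : Type*} [TopologicalSpace α] [MeasurableSpace α]
    [OpensMeasurableSpace α] [TopologicalSpace β] [MeasurableSpace β] [BorelSpace β]
    {f : α → β} {T : Set α} (hT : MeasurableSet T) (hf : ContinuousOn f T) {S : Set β}
    (hS : MeasurableSet S) : MeasurableSet (T ∩ f ⁻¹' S) := by
  have h1 : Measurable (T.domRestrict f) :=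
    (continuousOn_iff_continuous_domRestrict.1 hf).measurable
  have h2 := hT.subtype_image (h1 hS)
  convert h2 using 1
  ext y
  simp [and_comm]

lemma measurableSet_source (x : M) : MeasurableSet (extChartAt (𝓡∂ n) x).source :=
  (isOpen_extChartAt_source x).measurableSet

lemma continuousOn_symm (x : M) :
    ContinuousOn (extChartAt (𝓡∂ n) x).symm (extChartAt (𝓡∂ n) x).target :=
  continuousOn_extChartAt_symm x

/-- The chart domain in the boundary hyperplane. -/
abbrev boundaryTarget (x : M) : Set (EuclideanSpace ℝ {i : Fin n // i ≠ 0}) :=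
  boundaryEmb n ⁻¹' (extChartAt (𝓡∂ n) x).target

lemma isOpen_boundaryTarget (x : M) : IsOpen (boundaryTarget (n := n) x) := by
  obtain ⟨U, hU, hT⟩ := target_eq (n := n) x
  have : boundaryTarget (n := n) x = boundaryEmb n ⁻¹' U := by
    ext z
    simp only [boundaryTarget, hT, mem_preimage, mem_inter_iff, boundaryEmb_mem_halfSpace, and_true]
  rw [this]
  exact hU.preimage (continuous_boundaryEmb n)

lemma continuousOn_boundaryParam (x : M) :
    ContinuousOn (fun z => (extChartAt (𝓡∂ n) x).symm (boundaryEmb n z))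
      (boundaryTarget (n := n) x) :=
  (continuousOn_symm x).comp (continuous_boundaryEmb n).continuousOn fun _ h => h

lemma chartVolume_apply (g : Metric n M) (x : M) {S : Set M} (hS : MeasurableSet S) :
    chartVolume g x S = ∫⁻ y in (extChartAt (𝓡∂ n) x).target ∩ (extChartAt (𝓡∂ n) x).symm ⁻¹' S,
      ENNReal.ofReal √(gram g x y).det := by
  have hm : AEMeasurable (extChartAt (𝓡∂ n) x).symm
      ((volume : Measure (EuclideanSpace ℝ (Fin n))).restrict (extChartAt (𝓡∂ n) x).target) :=
    (continuousOn_symm x).aemeasurable (measurableSet_target x)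
  rw [chartVolume, Measure.map_apply_of_aemeasurable
    (hm.mono_ac (withDensity_absolutelyContinuous _ _)) hS, withDensity_apply', 
    Measure.restrict_restrict', inter_comm]
  exact measurableSet_target x

lemma chartSurface_apply (g : Metric n M) (x : M) {S : Set M} (hS : MeasurableSet S) :
    chartSurface g x S = ∫⁻ z in boundaryTarget (n := n) x ∩
      (fun z => (extChartAt (𝓡∂ n) x).symm (boundaryEmb n z)) ⁻¹' S,
      ENNReal.ofReal √(boundaryGram g x (boundaryEmb n z)).det := by
  have hm := (continuousOn_boundaryParam (n := n) x).aemeasurable (μ := volume)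
    (isOpen_boundaryTarget x).measurableSet
  rw [chartSurface, Measure.map_apply_of_aemeasurable
    (hm.mono_ac (withDensity_absolutelyContinuous _ _)) hS, withDensity_apply',
    Measure.restrict_restrict', inter_comm]
  exact (isOpen_boundaryTarget x).measurableSet

/-- Change of variables along the transition map, whose image lies in the part of the target that is
counted on the right. Equality on overlaps is not needed. -/
lemma chartVolume_restrict_le (g : Metric n M) (x x' : M) :
    (chartVolume g x').restrict (extChartAt (𝓡∂ n) x).source ≤ chartVolume g x := by
  refine Measure.le_iff.2 fun S hS => ?_
  have hSx := hS.inter (measurableSet_source (n := n) x)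
  rw [Measure.restrict_apply hS, chartVolume_apply g x' hSx, chartVolume_apply g x hS]
  set s := (extChartAt (𝓡∂ n) x').target ∩ (extChartAt (𝓡∂ n) x').symm ⁻¹'
    (S ∩ (extChartAt (𝓡∂ n) x).source) with hs
  have hsm : MeasurableSet s :=
    measurableSet_inter_preimage (measurableSet_target x') (continuousOn_symm x') hSx
  rw [← lintegral_image_sqrt_det hsm (ψ := transition x x')
    (D := fun y => fderivWithin ℝ (transition x x') (halfSpace n) y) (G' := gram g x)
    (fun y hy => (hasFDerivWithinAt_transition hy.1 hy.2.2).1.mono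
      (inter_subset_left.trans (target_subset_halfSpace x')))
    (fun y hy w hw h => transition_injOn x x' ⟨hy.1, hy.2.2⟩ ⟨hw.1, hw.2.2⟩ h)
    (fun y hy i j => gram_transition hy.1 hy.2.2 g i j)]
  refine lintegral_mono_set ?_
  rintro _ ⟨y, hy, rfl⟩
  refine ⟨(extChartAt (𝓡∂ n) x).map_source hy.2.2, ?_⟩
  rw [mem_preimage, transition, (extChartAt (𝓡∂ n) x).left_inv hy.2.2]
  exact hy.2.1

lemma transition_boundary {x x' : M} {z : EuclideanSpace ℝ {i : Fin n // i ≠ 0}}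
    (hz : boundaryEmb n z ∈ (extChartAt (𝓡∂ n) x').target)
    (hzx : (extChartAt (𝓡∂ n) x').symm (boundaryEmb n z) ∈ (extChartAt (𝓡∂ n) x).source) :
    transition x x' (boundaryEmb n z) 0 = 0 := by
  refine (isBoundaryPoint_iff hzx).1 ((isBoundaryPoint_iff
    ((extChartAt (𝓡∂ n) x').map_target hz)).2 ?_)
  rw [(extChartAt (𝓡∂ n) x').right_inv hz, boundaryEmb_zero]

lemma hasFDerivAt_transition_boundary {x x' : M} {z : EuclideanSpace ℝ {i : Fin n // i ≠ 0}}
    (hz : boundaryEmb n z ∈ (extChartAt (𝓡∂ n) x').target)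
    (hzx : (extChartAt (𝓡∂ n) x').symm (boundaryEmb n z) ∈ (extChartAt (𝓡∂ n) x).source) :
    HasFDerivAt (fun z => transition x x' (boundaryEmb n z))
      ((fderivWithin ℝ (transition x x') (halfSpace n) (boundaryEmb n z)).comp
        (boundaryEmbL n)) z := by
  have h := (hasFDerivWithinAt_transition hz hzx).1
  have := h.comp (s := univ) z (boundaryEmbL n).hasFDerivAt.hasFDerivWithinAt
    (fun w _ => boundaryEmb_mem_halfSpace w)
  exact hasFDerivWithinAt_univ.1 this

/-- The zeroth component of the transition map vanishes on a whole neighbourhood in the hyperplane,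
so its tangential derivatives vanish too. -/
lemma fderivWithin_transition_boundary {x x' : M} {z : EuclideanSpace ℝ {i : Fin n // i ≠ 0}}
    (hz : boundaryEmb n z ∈ (extChartAt (𝓡∂ n) x').target)
    (hzx : (extChartAt (𝓡∂ n) x').symm (boundaryEmb n z) ∈ (extChartAt (𝓡∂ n) x).source)
    (i : {i : Fin n // i ≠ 0}) :
    fderivWithin ℝ (transition x x') (halfSpace n) (boundaryEmb n z)
      (EuclideanSpace.single i.1 1) 0 = 0 := by
  have h1 := hasFDerivAt_transition_boundary hz hzx
  have h2 := ((EuclideanSpace.proj (𝕜 := ℝ) (0 : Fin n)).hasFDerivAt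
    (x := transition x x' (boundaryEmb n z))).comp z h1
  have hopen : IsOpen (boundaryTarget (n := n) x' ∩ (fun z => (extChartAt (𝓡∂ n) x').symm
      (boundaryEmb n z)) ⁻¹' (extChartAt (𝓡∂ n) x).source) :=
    (continuousOn_boundaryParam x').isOpen_inter_preimage (isOpen_boundaryTarget x')
      (isOpen_extChartAt_source x)
  have h3 : HasFDerivAt ((EuclideanSpace.proj (𝕜 := ℝ) (0 : Fin n)) ∘
      fun z => transition x x' (boundaryEmb n z))
      (0 : EuclideanSpace ℝ {i : Fin n // i ≠ 0} →L[ℝ] ℝ) z := by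
    refine (hasFDerivAt_const (0 : ℝ) z).congr_of_eventuallyEq ?_
    filter_upwards [hopen.mem_nhds ⟨hz, hzx⟩] with w hw
    exact transition_boundary hw.1 hw.2
  have h4 := congrArg (fun L => L (EuclideanSpace.single i (1 : ℝ))) (h2.unique h3)
  rw [← boundaryEmb_single]
  exact h4

/-- The volume argument one dimension lower, for the transition map between the boundary
hyperplanes. -/
lemma chartSurface_restrict_le (g : Metric n M) (x x' : M) :
    (chartSurface g x').restrict (extChartAt (𝓡∂ n) x).source ≤ chartSurface g x := by
  refine Measure.le_iff.2 fun S hS => ?_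
  have hSx := hS.inter (measurableSet_source (n := n) x)
  rw [Measure.restrict_apply hS, chartSurface_apply g x' hSx, chartSurface_apply g x hS]
  set s := boundaryTarget (n := n) x' ∩ (fun z => (extChartAt (𝓡∂ n) x').symm (boundaryEmb n z)) ⁻¹'
    (S ∩ (extChartAt (𝓡∂ n) x).source) with hs
  have hsm : MeasurableSet s :=
    measurableSet_inter_preimage (isOpen_boundaryTarget x').measurableSet
      (continuousOn_boundaryParam x') hSx
  set ψ := fun z => boundaryProj n (transition x x' (boundaryEmb n z)) with hψ
  have hemb : ∀ z ∈ s, boundaryEmb n (ψ z) = transition x x' (boundaryEmb n z) := fun z hz =>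
    boundaryEmb_boundaryProj (transition_boundary hz.1 hz.2.2)
  have key := lintegral_image_sqrt_det hsm (ψ := ψ)
    (D := fun z => (boundaryProj n).comp
      ((fderivWithin ℝ (transition x x') (halfSpace n) (boundaryEmb n z)).comp (boundaryEmbL n)))
    (G := fun z => boundaryGram g x' (boundaryEmb n z))
    (G' := fun z => boundaryGram g x (boundaryEmb n z))
    (fun z hz => ((boundaryProj n).hasFDerivAt.comp z
      (hasFDerivAt_transition_boundary hz.1 hz.2.2)).hasFDerivWithinAt)
    (fun z hz w hw h => by
      have h1 := congrArg (boundaryEmb n) h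
      rw [hemb z hz, hemb w hw] at h1
      have h2 := transition_injOn x x' ⟨hz.1, hz.2.2⟩ ⟨hw.1, hw.2.2⟩ h1
      rw [← boundaryProj_boundaryEmb z, h2, boundaryProj_boundaryEmb])
    (fun z hz i j => by
      have h0 := fderivWithin_transition_boundary hz.1 hz.2.2
      simp only [Matrix.submatrix_apply, ContinuousLinearMap.comp_apply, boundaryEmbL_apply,
        boundaryEmb_single, boundaryProj_apply, hemb z hz]
      rw [gram_transition hz.1 hz.2.2]
      -- Tangential derivatives have no zeroth component, so the double sum in the transformation
      -- law of g involves the boundary block only.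
      have hsum : ∀ F : Fin n → ℝ, F 0 = 0 → ∑ k, F k = ∑ k : {i : Fin n // i ≠ 0}, F k.1 := by
        intro F hF
        rw [← Finset.sum_subtype (Finset.univ.filter (· ≠ 0)) (by simp) F,
          Finset.sum_filter_of_ne]
        rintro k - hk rfl
        exact hk hF
      rw [hsum _ (by simp [h0])]
      refine Finset.sum_congr rfl fun k _ => ?_
      rw [hsum _ (by simp [h0])])
  rw [← key]
  refine lintegral_mono_set ?_
  rintro _ ⟨z, hz, rfl⟩
  refine ⟨?_, ?_⟩
  · rw [boundaryTarget, mem_preimage, hemb z hz]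
    exact (extChartAt (𝓡∂ n) x).map_source hz.2.2
  · rw [mem_preimage, hemb z hz, transition, (extChartAt (𝓡∂ n) x).left_inv hz.2.2]
    exact hz.2.1

/-- This turns the supremum in the definition into a computable object: over a chart domain,
integrals for `vol g` are integrals over the chart target with density √(det g). -/
lemma vol_restrict_source (g : Metric n M) (x : M) :
    (vol g).restrict (extChartAt (𝓡∂ n) x).source = chartVolume g x := by
  refine iSup_measure_restrict (measurableSet_source x) (fun x' => chartVolume_restrict_le g x x') ?_
  rw [chartVolume_apply g x (measurableSet_source x).compl]
  have : (extChartAt (𝓡∂ n) x).target ∩ (extChartAt (𝓡∂ n) x).symm ⁻¹'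
      (extChartAt (𝓡∂ n) x).sourceᶜ = ∅ := by
    ext y
    simp only [mem_inter_iff, mem_preimage, mem_compl_iff, mem_empty_iff_false, iff_false, not_and,
      not_not]
    exact fun hy => (extChartAt (𝓡∂ n) x).map_target hy
  rw [this]; simp

lemma surface_restrict_source (g : Metric n M) (x : M) :
    (surface g).restrict (extChartAt (𝓡∂ n) x).source = chartSurface g x := by
  refine iSup_measure_restrict (measurableSet_source x) (fun x' => chartSurface_restrict_le g x x') ?_
  rw [chartSurface_apply g x (measurableSet_source x).compl]
  have : boundaryTarget (n := n) x ∩ (fun z => (extChartAt (𝓡∂ n) x).symm (boundaryEmb n z)) ⁻¹'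
      (extChartAt (𝓡∂ n) x).sourceᶜ = ∅ := by
    ext y
    simp only [mem_inter_iff, mem_preimage, mem_compl_iff, mem_empty_iff_false, iff_false, not_and,
      not_not]
    exact fun hy => (extChartAt (𝓡∂ n) x).map_target hy
  rw [this]; simp

end Measure

end

/-! ### Integration in charts, finiteness of the measures, measurability of gradients -/

section

section Integrals

variable {n : ℕ} [NeZero n] {M : Type*} [TopologicalSpace M]
  [ChartedSpace (EuclideanHalfSpace n) M] [IsManifold (𝓡∂ n) ∞ M]
  [MeasurableSpace M] [BorelSpace M]

lemma continuousOn_sqrt_det_gram (g : Metric n M) (x : M) :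
    ContinuousOn (fun y => √(gram g x y).det) (extChartAt (𝓡∂ n) x).target :=
  (contDiffOn_det (contDiffOn_gram g x)).continuousOn.sqrt

lemma continuousOn_sqrt_det_boundaryGram (g : Metric n M) (x : M) :
    ContinuousOn (fun z => √(boundaryGram g x (boundaryEmb n z)).det) (boundaryTarget (n := n) x) :=
  ((contDiffOn_det (A := fun y => boundaryGram g x y)
    fun i j => contDiffOn_gram g x i.1 j.1).continuousOn.comp
    (continuous_boundaryEmb n).continuousOn fun _ h => h).sqrt

lemma setLIntegral_source_vol (g : Metric n M) (x : M) {G : M → ℝ≥0∞} (hG : Measurable G) :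
    ∫⁻ p in (extChartAt (𝓡∂ n) x).source, G p ∂(vol g) =
      ∫⁻ y in (extChartAt (𝓡∂ n) x).target, ENNReal.ofReal √(gram g x y).det *
        G ((extChartAt (𝓡∂ n) x).symm y) := by
  have hm : AEMeasurable (extChartAt (𝓡∂ n) x).symm
      ((volume : Measure (EuclideanSpace ℝ (Fin n))).restrict (extChartAt (𝓡∂ n) x).target) :=
    (continuousOn_symm x).aemeasurable (measurableSet_target x)
  have hd : AEMeasurable (fun y => ENNReal.ofReal √(gram g x y).det)
      ((volume : Measure (EuclideanSpace ℝ (Fin n))).restrict (extChartAt (𝓡∂ n) x).target) :=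
    ((continuousOn_sqrt_det_gram g x).aemeasurable (measurableSet_target x)).ennreal_ofReal
  rw [vol_restrict_source, chartVolume, lintegral_map' hG.aemeasurable
    (hm.mono_ac (withDensity_absolutelyContinuous _ _))]
  exact lintegral_withDensity_eq_lintegral_mul₀ hd (hG.comp_aemeasurable hm)

lemma setLIntegral_source_surface (g : Metric n M) (x : M) {G : M → ℝ≥0∞} (hG : Measurable G) :
    ∫⁻ p in (extChartAt (𝓡∂ n) x).source, G p ∂(surface g) =
      ∫⁻ z in boundaryTarget (n := n) x, ENNReal.ofReal √(boundaryGram g x (boundaryEmb n z)).det *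
        G ((extChartAt (𝓡∂ n) x).symm (boundaryEmb n z)) := by
  have hb := (isOpen_boundaryTarget (n := n) x).measurableSet
  have hm := (continuousOn_boundaryParam (n := n) x).aemeasurable (μ := volume) hb
  have hd : AEMeasurable (fun z => ENNReal.ofReal √(boundaryGram g x (boundaryEmb n z)).det)
      (volume.restrict (boundaryTarget (n := n) x)) :=
    ((continuousOn_sqrt_det_boundaryGram g x).aemeasurable hb).ennreal_ofReal
  rw [surface_restrict_source, chartSurface, lintegral_map' hG.aemeasurable
    (hm.mono_ac (withDensity_absolutelyContinuous _ _))]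
  exact lintegral_withDensity_eq_lintegral_mul₀ hd (hG.comp_aemeasurable hm)

variable [CompactSpace M]

lemma exists_finset_chart_cover : ∃ t : Finset M, ∀ p : M, ∃ x ∈ t,
    p ∈ (extChartAt (𝓡∂ n) x).source := by
  obtain ⟨t, ht⟩ := isCompact_univ.elim_finite_subcover
    (fun x : M => (extChartAt (𝓡∂ n) x).source) (fun x => isOpen_extChartAt_source x)
    (fun p _ => mem_iUnion.2 ⟨p, mem_extChartAt_source p⟩)
  exact ⟨t, fun p => by simpa using ht (mem_univ p)⟩

lemma aemeasurable_of_source {β : Type*} [MeasurableSpace β] {μ : Measure M} {f : M → β}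
    (h : ∀ x : M, AEMeasurable f (μ.restrict (extChartAt (𝓡∂ n) x).source)) : AEMeasurable f μ := by
  obtain ⟨t, ht⟩ := exists_finset_chart_cover (n := n) (M := M)
  have h1 : (⋃ x : t, (extChartAt (𝓡∂ n) x.1).source) = univ := by
    refine eq_univ_of_forall fun p => ?_
    obtain ⟨x, hx, hp⟩ := ht p
    exact mem_iUnion.2 ⟨⟨x, hx⟩, hp⟩
  rw [← Measure.restrict_univ (μ := μ), ← h1, aemeasurable_iUnion_iff]
  exact fun x => h x

lemma measure_eq_zero_of_source {μ : Measure M} {S : Set M}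
    (h : ∀ x : M, μ (S ∩ (extChartAt (𝓡∂ n) x).source) = 0) : μ S = 0 := by
  obtain ⟨t, ht⟩ := exists_finset_chart_cover (n := n) (M := M)
  have h1 : S ⊆ ⋃ x : t, S ∩ (extChartAt (𝓡∂ n) x.1).source := by
    intro p hp
    obtain ⟨x, hx, hpx⟩ := ht p
    exact mem_iUnion.2 ⟨⟨x, hx⟩, hp, hpx⟩
  exact measure_mono_null h1 (measure_iUnion_null_iff.2 fun x => h x)

/-- Each chart measure is carried by points with zeroth coordinate 0, and these are boundary points.
-/
lemma surface_compl_boundary (g : Metric n M) : surface g ((𝓡∂ n).boundary M)ᶜ = 0 := by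
  have hB : MeasurableSet ((𝓡∂ n).boundary M) :=
    ((𝓡∂ n).isClosed_boundary (M := M) (n := ∞) (by simp)).measurableSet
  refine measure_eq_zero_of_source (n := n) fun x => ?_
  rw [← Measure.restrict_apply hB.compl, surface_restrict_source, chartSurface_apply g x hB.compl]
  have : boundaryTarget (n := n) x ∩ (fun z => (extChartAt (𝓡∂ n) x).symm (boundaryEmb n z)) ⁻¹'
      ((𝓡∂ n).boundary M)ᶜ = ∅ := by
    refine eq_empty_of_forall_notMem fun z hz => hz.2 ?_
    rw [isBoundaryPoint_iff ((extChartAt (𝓡∂ n) x).map_target hz.1),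
      (extChartAt (𝓡∂ n) x).right_inv hz.1, boundaryEmb_zero]
  rw [this]; simp

lemma ae_mem_boundary (g : Metric n M) : ∀ᵐ p ∂(surface g), p ∈ (𝓡∂ n).boundary M :=
  surface_compl_boundary g

variable [T2Space M]

lemma isFiniteMeasure_of_source {μ : Measure M}
    (h : ∀ x : M, ∀ K : Set M, IsCompact K → K ⊆ (extChartAt (𝓡∂ n) x).source → μ K < ⊤) :
    IsFiniteMeasure μ := by
  refine ⟨isCompact_univ.measure_lt_top_of_nhdsWithin fun x _ => ?_⟩
  obtain ⟨K, hK, hxK, hKs⟩ := exists_compact_subset (isOpen_extChartAt_source (I := 𝓡∂ n) x)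
    (mem_extChartAt_source x)
  exact ⟨K, by simpa using mem_interior_iff_mem_nhds.1 hxK, h x K hK hKs⟩

lemma isCompact_image_extChartAt {x : M} {K : Set M} (hK : IsCompact K)
    (hKs : K ⊆ (extChartAt (𝓡∂ n) x).source) : IsCompact (extChartAt (𝓡∂ n) x '' K) :=
  hK.image_of_continuousOn ((continuousOn_extChartAt x).mono hKs)

lemma isCompact_of_inter_preimage {x : M} {K : Set M} 
    (hKs : K ⊆ (extChartAt (𝓡∂ n) x).source) :
    (extChartAt (𝓡∂ n) x).target ∩ (extChartAt (𝓡∂ n) x).symm ⁻¹' K =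
      extChartAt (𝓡∂ n) x '' K := by
  rw [← (extChartAt (𝓡∂ n) x).image_eq_target_inter_inv_preimage hKs]

instance (g : Metric n M) : IsFiniteMeasure (vol g) := by
  refine isFiniteMeasure_of_source (n := n) fun x K hK hKs => ?_
  rw [← Measure.restrict_eq_self _ hKs, vol_restrict_source,
    chartVolume_apply g x hK.measurableSet, isCompact_of_inter_preimage hKs]
  have hc := isCompact_image_extChartAt hK hKs
  have hsub : extChartAt (𝓡∂ n) x '' K ⊆ (extChartAt (𝓡∂ n) x).target := by
    rintro _ ⟨p, hp, rfl⟩; exact (extChartAt (𝓡∂ n) x).map_source (hKs hp)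
  obtain ⟨C, hC⟩ := hc.exists_bound_of_continuousOn ((continuousOn_sqrt_det_gram g x).mono hsub)
  refine (setLIntegral_mono' hc.measurableSet (g := fun _ => ENNReal.ofReal C) fun y hy =>
    ENNReal.ofReal_le_ofReal ((Real.le_norm_self _).trans (hC y hy))).trans_lt ?_
  rw [setLIntegral_const]
  exact ENNReal.mul_lt_top ENNReal.ofReal_lt_top hc.measure_lt_top

instance (g : Metric n M) : IsFiniteMeasure (surface g) := by
  refine isFiniteMeasure_of_source (n := n) fun x K hK hKs => ?_
  rw [← Measure.restrict_eq_self _ hKs, surface_restrict_source,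
    chartSurface_apply g x hK.measurableSet]
  have hc := isCompact_image_extChartAt hK hKs
  set S := boundaryTarget (n := n) x ∩
    (fun z => (extChartAt (𝓡∂ n) x).symm (boundaryEmb n z)) ⁻¹' K with hS
  have hmS : MeasurableSet S := measurableSet_inter_preimage
    (isOpen_boundaryTarget x).measurableSet (continuousOn_boundaryParam x) hK.measurableSet
  have hSK : ∀ z ∈ S, boundaryEmb n z ∈ extChartAt (𝓡∂ n) x '' K := fun z hz =>
    ⟨_, hz.2, (extChartAt (𝓡∂ n) x).right_inv hz.1⟩
  have hsub : extChartAt (𝓡∂ n) x '' K ⊆ (extChartAt (𝓡∂ n) x).target := by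
    rintro _ ⟨p, hp, rfl⟩; exact (extChartAt (𝓡∂ n) x).map_source (hKs hp)
  obtain ⟨C, hC⟩ := hc.exists_bound_of_continuousOn (f := fun y => √(boundaryGram g x y).det)
    ((contDiffOn_det (A := fun y => boundaryGram g x y)
      fun i j => contDiffOn_gram g x i.1 j.1).continuousOn.sqrt.mono hsub)
  refine (setLIntegral_mono' hmS (g := fun _ => ENNReal.ofReal C) fun z hz =>
    ENNReal.ofReal_le_ofReal ((Real.le_norm_self _).trans (hC _ (hSK z hz)))).trans_lt ?_
  rw [setLIntegral_const]
  refine ENNReal.mul_lt_top ENNReal.ofReal_lt_top ?_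
  refine (measure_mono fun z hz => ?_).trans_lt
    (hc.image (boundaryProj n).continuous).measure_lt_top
  exact ⟨_, hSK z hz, boundaryProj_boundaryEmb z⟩

/-- Measurability of a field is a condition on its components, and |X|² is a quadratic form in them
with continuous coefficients; finitely many charts suffice. -/
lemma aemeasurable_normSq (g : Metric n M) {X : (p : M) → TangentSpace (𝓡∂ n) p}
    (hX : AEMeasurableField g X) : AEMeasurable (fun p => normSq g p (X p)) (vol g) := by
  refine aemeasurable_of_source (n := n) fun x => ?_
  have h1 : AEMeasurable (fun p => comps x p (X p))
      ((vol g).restrict (extChartAt (𝓡∂ n) x).source) := by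
    rw [extChartAt_source]; exact hX x
  have h2 : ∀ i, AEMeasurable (fun p => comps x p (X p) i)
      ((vol g).restrict (extChartAt (𝓡∂ n) x).source) := fun i =>
    (EuclideanSpace.proj (𝕜 := ℝ) i).continuous.measurable.comp_aemeasurable h1
  have h3 : ∀ i j, AEMeasurable (fun p => gram g x (extChartAt (𝓡∂ n) x p) i j)
      ((vol g).restrict (extChartAt (𝓡∂ n) x).source) := fun i j =>
    ((contDiffOn_gram g x i j).continuousOn.comp (continuousOn_extChartAt x)
      (extChartAt (𝓡∂ n) x).mapsTo).aemeasurable (measurableSet_source x)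
  refine AEMeasurable.congr (f := fun p => ∑ i, ∑ j, comps x p (X p) i * comps x p (X p) j *
    gram g x (extChartAt (𝓡∂ n) x p) i j) ?_ ?_
  · exact Finset.aemeasurable_fun_sum _ fun i _ => Finset.aemeasurable_fun_sum _ fun j _ =>
      ((h2 i).mul (h2 j)).mul (h3 i j)
  · filter_upwards [ae_restrict_mem (measurableSet_source x)] with p hp
    exact (normSq_eq g hp (X p)).symm

/-- In coordinates ∇f = (det g)⁻¹ adj(g) df, which is visibly continuous. -/
lemma continuousOn_comps_grad (g : Metric n M) {f : M → ℝ} (hf : ContMDiff (𝓡∂ n) 𝓘(ℝ, ℝ) ∞ f)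
    (x : M) (i : Fin n) :
    ContinuousOn (fun p => comps x p (grad g f p) i) (extChartAt (𝓡∂ n) x).source := by
  have hfd : ContinuousOn (fderivWithin ℝ (fun y => f ((extChartAt (𝓡∂ n) x).symm y))
      (halfSpace n)) (extChartAt (𝓡∂ n) x).target := by
    have h1 := (contDiffOn_of_contMDiff hf x).continuousOn_fderivWithin (uniqueDiffOn_target x)
      (by simp)
    refine h1.congr fun y hy => ?_
    exact fderivWithin_of_mem_nhdsWithin (target_mem_nhdsWithin hy)
      (uniqueDiffOn_halfSpace n y (target_subset_halfSpace x hy))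
      ((contDiffOn_of_contMDiff hf x).differentiableOn (by simp) y hy)
  refine ContinuousOn.congr (f := fun p => (gram g x (extChartAt (𝓡∂ n) x p)).det⁻¹ *
      ∑ j, (gram g x (extChartAt (𝓡∂ n) x p)).adjugate i j *
        fderivWithin ℝ (fun y => f ((extChartAt (𝓡∂ n) x).symm y)) (halfSpace n)
          (extChartAt (𝓡∂ n) x p) (EuclideanSpace.single j (1 : ℝ))) ?_
    fun p hp => comps_grad g hf hp i
  refine ContinuousOn.comp (t := (extChartAt (𝓡∂ n) x).target) (g := fun y => (gram g x y).det⁻¹ *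
      ∑ j, (gram g x y).adjugate i j *
        fderivWithin ℝ (fun y => f ((extChartAt (𝓡∂ n) x).symm y)) (halfSpace n)
          y (EuclideanSpace.single j (1 : ℝ))) ?_ (continuousOn_extChartAt x)
          (extChartAt (𝓡∂ n) x).mapsTo
  refine ContinuousOn.mul ((contDiffOn_det (contDiffOn_gram g x)).continuousOn.inv₀
    fun y hy => (gram_posDef g hy).det_pos.ne') (continuousOn_finsetSum _ fun j _ => ?_)
  exact (contDiffOn_adjugate (contDiffOn_gram g x) i j).continuousOn.mul
    (hfd.clm_apply continuousOn_const)

lemma aemeasurableField_grad (g : Metric n M) {f : M → ℝ} (hf : ContMDiff (𝓡∂ n) 𝓘(ℝ, ℝ) ∞ f) :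
    AEMeasurableField g (grad g f) := by
  intro x
  rw [← extChartAt_source (𝓡∂ n)]
  have h : ContinuousOn (fun p => comps x p (grad g f p)) (extChartAt (𝓡∂ n) x).source :=
    (PiLp.continuous_toLp 2 _).comp_continuousOn
      (continuousOn_pi.2 fun i => continuousOn_comps_grad g hf x i)
  exact h.aemeasurable (measurableSet_source x)

lemma AEMeasurableField.sub {g : Metric n M} {X Y : (p : M) → TangentSpace (𝓡∂ n) p}
    (hX : AEMeasurableField g X) (hY : AEMeasurableField g Y) :
    AEMeasurableField g (fun p => X p - Y p) := by
  intro x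
  refine ((hX x).sub (hY x)).congr (Eventually.of_forall fun p => ?_)
  exact (map_sub _ _ _).symm

lemma continuous_normSq_grad (g : Metric n M) {f : M → ℝ} (hf : ContMDiff (𝓡∂ n) 𝓘(ℝ, ℝ) ∞ f) :
    Continuous fun p => normSq g p (grad g f p) := by
  refine continuous_iff_continuousAt.2 fun x => ?_
  have hs : (extChartAt (𝓡∂ n) x).source ∈ 𝓝 x := extChartAt_source_mem_nhds x
  refine ContinuousOn.continuousAt (s := (extChartAt (𝓡∂ n) x).source) ?_ hs
  refine ContinuousOn.congr (f := fun p => ∑ i, ∑ j, comps x p (grad g f p) i *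
    comps x p (grad g f p) j * gram g x (extChartAt (𝓡∂ n) x p) i j) ?_
    fun p hp => normSq_eq g hp _
  refine continuousOn_finsetSum _ fun i _ => continuousOn_finsetSum _ fun j _ => ?_
  exact ((continuousOn_comps_grad g hf x i).mul (continuousOn_comps_grad g hf x j)).mul
    ((contDiffOn_gram g x i j).continuousOn.comp (continuousOn_extChartAt x)
      (extChartAt (𝓡∂ n) x).mapsTo)

/-- Both sides pair with every vector to the same value, and g is definite. -/
lemma grad_sub (g : Metric n M) {f h : M → ℝ} (hf : ContMDiff (𝓡∂ n) 𝓘(ℝ, ℝ) ∞ f)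
    (hh : ContMDiff (𝓡∂ n) 𝓘(ℝ, ℝ) ∞ h) (p : M) :
    grad g (fun p => f p - h p) p = grad g f p - grad g h p := by
  have h1 := ((hf.mdifferentiable (by simp) p).hasMFDerivAt.sub
    (hh.mdifferentiable (by simp) p).hasMFDerivAt).mfderiv
  have h2 : ∀ v, g.inner p (grad g (fun p => f p - h p) p - (grad g f p - grad g h p)) v = 0 := by
    intro v
    rw [map_sub, sub_apply, inner_grad, map_sub, sub_apply, inner_grad, inner_grad]
    exact sub_eq_zero.2 (congrArg (fun L : TangentSpace (𝓡∂ n) p →L[ℝ] ℝ => L v) h1)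
  by_contra hne
  exact (g.pos p _ (sub_ne_zero.2 hne)).ne' (h2 _)

end Integrals

end

/-! ### The trace inequality in one chart -/

section

section Local

variable {n : ℕ} [NeZero n] {M : Type*} [TopologicalSpace M]
  [ChartedSpace (EuclideanHalfSpace n) M] [IsManifold (𝓡∂ n) ∞ M]
  [MeasurableSpace M] [BorelSpace M] [CompactSpace M] [T2Space M]

/-- The image of the support of `η` in the preferred chart at `x`. -/
abbrev chartSupport (η : M → ℝ) (x : M) : Set (EuclideanSpace ℝ (Fin n)) :=
  extChartAt (𝓡∂ n) x '' tsupport η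

section

variable {η : M → ℝ} {x : M}

lemma isCompact_chartSupport (hs : tsupport η ⊆ (extChartAt (𝓡∂ n) x).source) :
    IsCompact (chartSupport (n := n) η x) :=
  isCompact_image_extChartAt (isClosed_tsupport η).isCompact hs

lemma chartSupport_subset (hs : tsupport η ⊆ (extChartAt (𝓡∂ n) x).source) :
    chartSupport (n := n) η x ⊆ (extChartAt (𝓡∂ n) x).target := by
  rintro _ ⟨p, hp, rfl⟩
  exact (extChartAt (𝓡∂ n) x).map_source (hs hp)

lemma eq_zero_of_notMem_chartSupport {y : EuclideanSpace ℝ (Fin n)}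
    (hy : y ∈ (extChartAt (𝓡∂ n) x).target) (hyK : y ∉ chartSupport (n := n) η x) :
    η ((extChartAt (𝓡∂ n) x).symm y) = 0 := by
  by_contra h
  exact hyK ⟨_, subset_tsupport η h, (extChartAt (𝓡∂ n) x).right_inv hy⟩

lemma contDiffOn_indicator_target {k : ℕ∞ω} (hs : tsupport η ⊆ (extChartAt (𝓡∂ n) x).source)
    {F : EuclideanSpace ℝ (Fin n) → ℝ} (hF : ContDiffOn ℝ k F (extChartAt (𝓡∂ n) x).target)
    (h0 : ∀ y ∈ (extChartAt (𝓡∂ n) x).target, y ∉ chartSupport (n := n) η x → F y = 0) :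
    ContDiffOn ℝ k ((extChartAt (𝓡∂ n) x).target.indicator F) (halfSpace n) := by
  obtain ⟨U, hU, hT⟩ := target_eq (n := n) x
  exact contDiffOn_indicator_of_eq_zero hU hT (isCompact_chartSupport hs).isClosed
    (chartSupport_subset hs) hF h0

lemma indicator_target_eq_zero {F : EuclideanSpace ℝ (Fin n) → ℝ}
    (h0 : ∀ y ∈ (extChartAt (𝓡∂ n) x).target, y ∉ chartSupport (n := n) η x → F y = 0)
    {y : EuclideanSpace ℝ (Fin n)} (hyK : y ∉ chartSupport (n := n) η x) :
    (extChartAt (𝓡∂ n) x).target.indicator F y = 0 := by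
  by_cases hy : y ∈ (extChartAt (𝓡∂ n) x).target
  · rw [indicator_of_mem hy, h0 y hy hyK]
  · exact indicator_of_notMem hy F

lemma indicator_target_eventuallyEq {F : EuclideanSpace ℝ (Fin n) → ℝ}
    {y : EuclideanSpace ℝ (Fin n)} (hy : y ∈ (extChartAt (𝓡∂ n) x).target) :
    (extChartAt (𝓡∂ n) x).target.indicator F =ᶠ[𝓝[halfSpace n] y] F := by
  filter_upwards [target_mem_nhdsWithin hy] with z hz using indicator_of_mem hz F

lemma differentiableWithinAt_of_contMDiff {f : M → ℝ} (hf : ContMDiff (𝓡∂ n) 𝓘(ℝ, ℝ) ∞ f)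
    {y : EuclideanSpace ℝ (Fin n)} (hy : y ∈ (extChartAt (𝓡∂ n) x).target) :
    DifferentiableWithinAt ℝ (fun y => f ((extChartAt (𝓡∂ n) x).symm y)) (halfSpace n) y :=
  ((contDiffOn_of_contMDiff hf x).differentiableOn (by simp) y hy).mono_of_mem_nhdsWithin
    (target_mem_nhdsWithin hy)

end

/-- The trace inequality for functions multiplied by a cutoff supported in a chart. -/
lemma exists_local_trace (g : Metric n M) {η : M → ℝ} (hη : ContMDiff (𝓡∂ n) 𝓘(ℝ, ℝ) ∞ η)
    (hη0 : ∀ p, 0 ≤ η p) {x : M} (hs : tsupport η ⊆ (extChartAt (𝓡∂ n) x).source) :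
    ∃ C : ℝ, 0 ≤ C ∧ ∀ r : ℝ, 1 < r → ∀ f : M → ℝ, ContMDiff (𝓡∂ n) 𝓘(ℝ, ℝ) ∞ f →
      ∫⁻ p, ENNReal.ofReal (η p * |f p| ^ r) ∂(surface g) ≤
        ∫⁻ p, ENNReal.ofReal (η p * (r * |f p| ^ (r - 1) * √(normSq g p (grad g f p)))) ∂(vol g) +
        ENNReal.ofReal C * ∫⁻ p, ENNReal.ofReal (|f p| ^ r) ∂(vol g) := by
  set T := (extChartAt (𝓡∂ n) x).target with hT
  set P := (extChartAt (𝓡∂ n) x).symm with hP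
  set K := chartSupport (n := n) η x with hKdef
  have hK : IsCompact K := isCompact_chartSupport hs
  have hKT : K ⊆ T := chartSupport_subset hs
  have hTR : T ⊆ halfSpace n := target_subset_halfSpace x
  have hη' : ContDiffOn ℝ ∞ (fun y => η (P y)) T := contDiffOn_of_contMDiff hη x
  have hηK : ∀ y ∈ T, y ∉ K → η (P y) = 0 := fun y hy hyK => eq_zero_of_notMem_chartSupport hy hyK
  -- The field η √(det g) N extended by zero. Its divergence does not involve `f` or `r`, so the
  -- constant C below depends on neither.
  set W : Fin n → EuclideanSpace ℝ (Fin n) → ℝ := fun i => T.indicator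
    fun y => η (P y) * normalField g x i y with hW
  have hWs : ∀ i, ContDiffOn ℝ 1 (W i) (halfSpace n) := fun i =>
    (contDiffOn_indicator_target hs (hη'.mul (contDiffOn_normalField g x i))
      fun y hy hyK => by rw [hηK y hy hyK, zero_mul]).of_le (by norm_cast)
  have hWK : ∀ i, ∀ y ∈ halfSpace n, y ∉ K → W i y = 0 := fun i y _ hyK =>
    indicator_target_eq_zero (fun y hy hyK => by rw [hηK y hy hyK, zero_mul]) hyK
  set dW : EuclideanSpace ℝ (Fin n) → ℝ := fun y => ∑ i, fderivWithin ℝ (W i) (halfSpace n) y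
    (EuclideanSpace.single i (1 : ℝ)) with hdW
  have hdet : ∀ y ∈ T, 0 < √(gram g x y).det := fun y hy =>
    Real.sqrt_pos.2 (gram_posDef g hy).det_pos
  -- Dividing by √(det g) makes the bound one with respect to the Riemannian volume.
  obtain ⟨C, hC⟩ : ∃ C, ∀ y ∈ K, ‖dW y / √(gram g x y).det‖ ≤ C := by
    refine hK.exists_bound_of_continuousOn (ContinuousOn.div ?_
      ((continuousOn_sqrt_det_gram g x).mono hKT) fun y hy => (hdet y (hKT hy)).ne')
    exact continuousOn_finsetSum _ fun i _ =>
      ((continuousOn_fderivWithin_halfSpace (hWs i)).mono (hKT.trans hTR)).clm_apply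
        continuousOn_const
  have hdWT : ∀ y ∈ T, |dW y| ≤ max C 0 * √(gram g x y).det := by
    intro y hy
    by_cases hyK : y ∈ K
    · have := hC y hyK
      rw [norm_div, Real.norm_eq_abs, Real.norm_of_nonneg (hdet y hy).le,
        div_le_iff₀ (hdet y hy)] at this
      exact this.trans (mul_le_mul_of_nonneg_right (le_max_left _ _) (hdet y hy).le)
    · have : dW y = 0 := Finset.sum_eq_zero fun i _ => by
        rw [fderivWithin_eq_zero_of_eq_zero hK.isClosed (hWK i) (hTR hy) hyK]; rfl
      rw [this, abs_zero]
      exact mul_nonneg (le_max_right _ _) (hdet y hy).le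
  -- If `K` is empty, `C` carries no information on its sign; the maximum keeps the constant
  -- nonnegative.
  refine ⟨max C 0, le_max_right _ _, fun r hr f hf => ?_⟩
  have hf' : ContDiffOn ℝ ∞ (fun y => f (P y)) T := contDiffOn_of_contMDiff hf x
  have hfr : ContDiffOn ℝ 1 (fun y => |f (P y)| ^ r) T :=
    contDiffOn_abs_rpow (hf'.of_le (by norm_cast)) hr
  set v : Fin n → EuclideanSpace ℝ (Fin n) → ℝ := fun i => T.indicator
    fun y => η (P y) * normalField g x i y * |f (P y)| ^ r with hv
  have hv0 : ∀ i, ∀ y ∈ T, y ∉ K → η (P y) * normalField g x i y * |f (P y)| ^ r = 0 :=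
    fun i y hy hyK => by rw [hηK y hy hyK, zero_mul, zero_mul]
  have hvs : ∀ i, ContDiffOn ℝ 1 (v i) (halfSpace n) := fun i =>
    contDiffOn_indicator_target hs (((hη'.mul (contDiffOn_normalField g x i)).of_le
      (by norm_cast)).mul hfr) (hv0 i)
  have hvK : ∀ i, ∀ y ∈ halfSpace n, y ∉ K → v i y = 0 := fun i y _ hyK =>
    indicator_target_eq_zero (hv0 i) hyK
  set dv : EuclideanSpace ℝ (Fin n) → ℝ := fun y => ∑ i, fderivWithin ℝ (v i) (halfSpace n) y
    (EuclideanSpace.single i (1 : ℝ)) with hdv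
  have hdvT : ∀ y ∈ T, |dv y| ≤ √(gram g x y).det * (max C 0 * |f (P y)| ^ r +
      η (P y) * (r * |f (P y)| ^ (r - 1) * √(normSq g (P y) (grad g f (P y))))) := by
    intro y hy
    have hu := uniqueDiffOn_halfSpace n y (hTR hy)
    have hfd := (differentiableWithinAt_of_contMDiff hf hy).hasFDerivWithinAt
    -- Product rule for v = |f|^r W: the first term becomes |f|^r div W, and the second, summed over
    -- i, contains df(√(det g) N).
    have hpart : ∀ i, fderivWithin ℝ (v i) (halfSpace n) y (EuclideanSpace.single i (1 : ℝ)) =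
        |f (P y)| ^ r * fderivWithin ℝ (W i) (halfSpace n) y (EuclideanSpace.single i (1 : ℝ)) +
        η (P y) * (r * |f (P y)| ^ (r - 2) * f (P y)) * (normalField g x i y *
          fderivWithin ℝ (fun y => f (P y)) (halfSpace n) y (EuclideanSpace.single i (1 : ℝ))) := by
      intro i
      have h1 : v i =ᶠ[𝓝[halfSpace n] y] fun y => W i y * |f (P y)| ^ r := by
        filter_upwards [target_mem_nhdsWithin hy] with z hz
        have hzT : z ∈ T := hz
        change T.indicator _ z = T.indicator _ z * _
        rw [indicator_of_mem hzT, indicator_of_mem hzT]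
      have h2 : HasFDerivWithinAt (fun y => W i y * |f (P y)| ^ r) _ _ y := ((hWs i).differentiableOn one_ne_zero y (hTR hy)).hasFDerivWithinAt.mul
        (hasFDerivWithinAt_abs_rpow hfd hr)
      rw [h1.fderivWithin_eq (h1.self_of_nhdsWithin (hTR hy)), h2.fderivWithin hu]
      have h3 : W i y = η (P y) * normalField g x i y := indicator_of_mem hy _
      simp only [add_apply, smul_apply, smul_eq_mul, h3]
      ring
    have hsum : dv y = |f (P y)| ^ r * dW y + η (P y) * (r * |f (P y)| ^ (r - 2) * f (P y)) *
        ∑ i, normalField g x i y *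
          fderivWithin ℝ (fun y => f (P y)) (halfSpace n) y (EuclideanSpace.single i (1 : ℝ)) := by
      rw [hdv]
      simp only [hpart, Finset.sum_add_distrib, Finset.mul_sum, hdW]
    have hfr0 : 0 ≤ |f (P y)| ^ r := by positivity
    have hfr1 : 0 ≤ r * |f (P y)| ^ (r - 1) := by positivity
    rw [hsum]
    refine (abs_add_le _ _).trans ?_
    rw [abs_mul, abs_mul, abs_mul, abs_of_nonneg hfr0, abs_of_nonneg (hη0 _),
      abs_rpow_sub_two_mul_self hr]
    have e1 := mul_le_mul_of_nonneg_left (hdWT y hy) hfr0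
    have e2 := mul_le_mul_of_nonneg_left (abs_normalField_fderivWithin_le g hf hy)
      (mul_nonneg (hη0 (P y)) hfr1)
    refine (add_le_add e1 e2).trans (le_of_eq ?_)
    ring
  have hdvR : ∀ y ∈ halfSpace n, y ∉ T → dv y = 0 := fun y hy hyT =>
    Finset.sum_eq_zero fun i _ => by
      rw [fderivWithin_eq_zero_of_eq_zero hK.isClosed (hvK i) hy fun h => hyT (hKT h)]; rfl
  have hdivthm := integral_divergence_halfSpace hvs hK hvK
  have hcont_f : Continuous f := hf.continuous
  have hcont_η : Continuous η := hη.continuous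
  have hcr : Continuous fun p => |f p| ^ r := hcont_f.abs.rpow_const fun _ => Or.inr (by linarith)
  have hcr1 : Continuous fun p => |f p| ^ (r - 1) :=
    hcont_f.abs.rpow_const fun _ => Or.inr (by linarith)
  have hcn : Continuous fun p => √(normSq g p (grad g f p)) := (continuous_normSq_grad g hf).sqrt
  have hm1 : Measurable fun p => ENNReal.ofReal (η p * |f p| ^ r) :=
    (show Continuous fun p => η p * |f p| ^ r from hcont_η.mul hcr).measurable.ennreal_ofReal
  have hm2 : Measurable fun p => ENNReal.ofReal (max C 0 * |f p| ^ r +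
      η p * (r * |f p| ^ (r - 1) * √(normSq g p (grad g f p)))) :=
    (show Continuous fun p => max C 0 * |f p| ^ r +
      η p * (r * |f p| ^ (r - 1) * √(normSq g p (grad g f p))) by fun_prop).measurable.ennreal_ofReal
  have hηsrc : ∀ p, p ∉ (extChartAt (𝓡∂ n) x).source → η p = 0 := fun p hp =>
    image_eq_zero_of_notMem_tsupport fun h => hp (hs h)
  have hbint : Integrable (fun z => v 0 (boundaryEmb n z)) := by
    refine Continuous.integrable_of_hasCompactSupport ?_ ?_
    · exact (hvs 0).continuousOn.comp_continuous (continuous_boundaryEmb n)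
        boundaryEmb_mem_halfSpace
    · refine HasCompactSupport.intro (hK.image (boundaryProj n).continuous) fun z hz => ?_
      refine hvK 0 _ (boundaryEmb_mem_halfSpace z) fun h => hz ?_
      exact ⟨_, h, boundaryProj_boundaryEmb z⟩
  have hv0nn : ∀ z, 0 ≤ v 0 (boundaryEmb n z) := fun z => by
    refine indicator_nonneg (fun y hy => ?_) _
    rw [normalField_zero]
    have := hη0 (P y)
    positivity
  calc ∫⁻ p, ENNReal.ofReal (η p * |f p| ^ r) ∂(surface g)
      = ∫⁻ p in (extChartAt (𝓡∂ n) x).source, ENNReal.ofReal (η p * |f p| ^ r) ∂(surface g) := by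
        rw [← lintegral_indicator (measurableSet_source x)]
        refine lintegral_congr fun p => ?_
        by_cases hp : p ∈ (extChartAt (𝓡∂ n) x).source
        · rw [indicator_of_mem hp]
        · rw [indicator_of_notMem hp, hηsrc p hp]; simp
    _ = ∫⁻ z in boundaryTarget (n := n) x, ENNReal.ofReal (v 0 (boundaryEmb n z)) := by
        rw [setLIntegral_source_surface g x hm1]
        refine setLIntegral_congr_fun (isOpen_boundaryTarget x).measurableSet fun z hz => ?_
        have h3 : v 0 (boundaryEmb n z) = η (P (boundaryEmb n z)) *
          normalField g x 0 (boundaryEmb n z) * |f (P (boundaryEmb n z))| ^ r :=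
          indicator_of_mem (show boundaryEmb n z ∈ T from hz) _
        rw [← ENNReal.ofReal_mul (Real.sqrt_nonneg _), h3, normalField_zero]
        congr 1; ring
    _ ≤ ∫⁻ z, ENNReal.ofReal (v 0 (boundaryEmb n z)) := setLIntegral_le_lintegral _ _
    _ = ENNReal.ofReal (∫ z, v 0 (boundaryEmb n z)) :=
        (ofReal_integral_eq_lintegral_ofReal hbint (Eventually.of_forall hv0nn)).symm
    -- The divergence theorem enters here; its sign is immaterial since only the absolute value of
    -- the interior integral is kept.
    _ ≤ ‖∫ y in halfSpace n, dv y‖ₑ := by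
        rw [hdivthm, ← ofReal_norm]
        exact ENNReal.ofReal_le_ofReal (neg_le_abs _)
    _ ≤ ∫⁻ y in halfSpace n, ‖dv y‖ₑ := enorm_integral_le_lintegral_enorm _
    _ = ∫⁻ y in T, ‖dv y‖ₑ := by
        rw [← lintegral_indicator measurableSet_halfSpace,
          ← lintegral_indicator (measurableSet_target x)]
        refine lintegral_congr fun y => ?_
        by_cases hy : y ∈ T
        · rw [indicator_of_mem hy, indicator_of_mem (hTR hy)]
        · rw [indicator_of_notMem hy]
          by_cases hyR : y ∈ halfSpace n
          · rw [indicator_of_mem hyR, hdvR y hyR hy, enorm_zero]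
          · rw [indicator_of_notMem hyR]
    _ ≤ ∫⁻ y in T, ENNReal.ofReal √(gram g x y).det * ENNReal.ofReal (max C 0 * |f (P y)| ^ r +
          η (P y) * (r * |f (P y)| ^ (r - 1) * √(normSq g (P y) (grad g f (P y))))) := by
        refine setLIntegral_mono' (measurableSet_target x) fun y hy => ?_
        rw [← ENNReal.ofReal_mul (Real.sqrt_nonneg _), ← ofReal_norm]
        exact ENNReal.ofReal_le_ofReal (hdvT y hy)
    _ = ∫⁻ p in (extChartAt (𝓡∂ n) x).source, ENNReal.ofReal (max C 0 * |f p| ^ r +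
          η p * (r * |f p| ^ (r - 1) * √(normSq g p (grad g f p)))) ∂(vol g) :=
        (setLIntegral_source_vol g x hm2).symm
    _ ≤ ∫⁻ p, ENNReal.ofReal (max C 0 * |f p| ^ r +
          η p * (r * |f p| ^ (r - 1) * √(normSq g p (grad g f p)))) ∂(vol g) :=
        setLIntegral_le_lintegral _ _
    _ = _ := by
        rw [← lintegral_const_mul' _ _ ENNReal.ofReal_ne_top, add_comm,
          ← lintegral_add_left (hcr.measurable.ennreal_ofReal.const_mul _)]
        refine lintegral_congr fun p => ?_
        have := hη0 p
        rw [ENNReal.ofReal_add (by positivity) (by positivity),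
          ENNReal.ofReal_mul (le_max_right _ _)]

end Local

end

/-! ### The Sobolev inequality in one chart, and the inequalities on the compact manifold -/

section

section Global

variable {n : ℕ} [NeZero n] {M : Type*} [TopologicalSpace M]
  [ChartedSpace (EuclideanHalfSpace n) M] [IsManifold (𝓡∂ n) ∞ M]
  [MeasurableSpace M] [BorelSpace M] [CompactSpace M] [T2Space M]

/-- A crude bound for the largest eigenvalue of g. The Sobolev inequality only serves to obtain
convergence, so its constant does not matter. -/
lemma sum_gram_le (g : Metric n M) (x : M) (y c : EuclideanSpace ℝ (Fin n)) :
    ∑ i, ∑ j, c i * c j * gram g x y i j ≤ (∑ i, ∑ j, |gram g x y i j|) * ‖c‖ ^ 2 := by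
  rw [Finset.sum_mul]
  refine Finset.sum_le_sum fun i _ => ?_
  rw [Finset.sum_mul]
  refine Finset.sum_le_sum fun j _ => ?_
  refine (le_abs_self _).trans ?_
  rw [abs_mul, abs_mul, mul_comm, sq]
  have h1 := PiLp.norm_apply_le c i
  have h2 := PiLp.norm_apply_le c j
  rw [Real.norm_eq_abs] at h1 h2
  gcongr

lemma norm_fderivWithin_sq_le (g : Metric n M) {f : M → ℝ} (hf : ContMDiff (𝓡∂ n) 𝓘(ℝ, ℝ) ∞ f)
    {x : M} {y : EuclideanSpace ℝ (Fin n)} (hy : y ∈ (extChartAt (𝓡∂ n) x).target) :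
    ‖fderivWithin ℝ (fun y => f ((extChartAt (𝓡∂ n) x).symm y)) (halfSpace n) y‖ ^ 2 ≤
      (∑ i, ∑ j, |gram g x y i j|) *
        normSq g _ (grad g f ((extChartAt (𝓡∂ n) x).symm y)) := by
  set N := normSq g _ (grad g f ((extChartAt (𝓡∂ n) x).symm y)) with hN
  have hN0 : 0 ≤ N := normSq_nonneg _ _ _
  set Λ := ∑ i, ∑ j, |gram g x y i j| with hΛ
  have hΛ0 : 0 ≤ Λ := Finset.sum_nonneg fun i _ => Finset.sum_nonneg fun j _ => abs_nonneg _
  have h : ‖fderivWithin ℝ (fun y => f ((extChartAt (𝓡∂ n) x).symm y)) (halfSpace n) y‖ ≤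
      √(Λ * N) := by
    refine ContinuousLinearMap.opNorm_le_bound _ (Real.sqrt_nonneg _) fun c => ?_
    rw [Real.norm_eq_abs]
    refine abs_le_of_sq_le_sq ?_ (by positivity)
    rw [mul_pow, Real.sq_sqrt (by positivity)]
    refine (sq_fderivWithin_le g hf hy c).trans ?_
    rw [← hN]
    have := mul_le_mul_of_nonneg_left (sum_gram_le g x y c) hN0
    rw [← hΛ] at this
    linarith
  calc _ ≤ √(Λ * N) ^ 2 := by gcongr
    _ = _ := Real.sq_sqrt (by positivity)

/-- The Sobolev inequality for functions multiplied by a cutoff supported in a chart. -/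
lemma exists_local_sobolev (hn : 3 ≤ n) (g : Metric n M) {η : M → ℝ}
    (hη : ContMDiff (𝓡∂ n) 𝓘(ℝ, ℝ) ∞ η) {x : M}
    (hs : tsupport η ⊆ (extChartAt (𝓡∂ n) x).source) :
    ∃ C : ℝ≥0∞, C ≠ ⊤ ∧ ∀ f : M → ℝ, ContMDiff (𝓡∂ n) 𝓘(ℝ, ℝ) ∞ f →
      ∫⁻ p, ‖η p * f p‖ₑ ^ (2 * (n : ℝ) / ((n : ℝ) - 2)) ∂(vol g) ≤
        C * (∫⁻ p, ENNReal.ofReal (normSq g p (grad g f p) + f p ^ 2) ∂(vol g)) ^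
          ((n : ℝ) / ((n : ℝ) - 2)) := by
  have hn3 : (3 : ℝ) ≤ n := by exact_mod_cast hn
  have hN2 : (0 : ℝ) < n - 2 := by linarith
  set q : ℝ := 2 * (n : ℝ) / ((n : ℝ) - 2) with hq
  set s : ℝ := (n : ℝ) / ((n : ℝ) - 2) with hsdef
  have hq0 : 0 < q := by rw [hq]; positivity
  have hs0 : 0 < s := by rw [hsdef]; positivity
  obtain ⟨C₀, hC₀, hSob⟩ := exists_sobolev_halfSpace (n := n) hn
  set T := (extChartAt (𝓡∂ n) x).target with hT
  set P := (extChartAt (𝓡∂ n) x).symm with hP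
  set K := chartSupport (n := n) η x with hKdef
  have hK : IsCompact K := isCompact_chartSupport hs
  have hKT : K ⊆ T := chartSupport_subset hs
  have hTR : T ⊆ halfSpace n := target_subset_halfSpace x
  have hη' : ContDiffOn ℝ ∞ (fun y => η (P y)) T := contDiffOn_of_contMDiff hη x
  have hηK : ∀ y ∈ T, y ∉ K → η (P y) = 0 := fun y hy hyK => eq_zero_of_notMem_chartSupport hy hyK
  have hdet : ∀ y ∈ T, 0 < √(gram g x y).det := fun y hy =>
    Real.sqrt_pos.2 (gram_posDef g hy).det_pos
  have hdc : ContinuousOn (fun y => √(gram g x y).det) K := (continuousOn_sqrt_det_gram g x).mono hKT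
  obtain ⟨C₁, hC₁⟩ := hK.exists_bound_of_continuousOn hdc
  set Dη : EuclideanSpace ℝ (Fin n) → EuclideanSpace ℝ (Fin n) →L[ℝ] ℝ :=
    fderivWithin ℝ (fun y => η (P y)) (halfSpace n) with hDη
  have hDηc : ContinuousOn Dη T := by
    refine (hη'.continuousOn_fderivWithin (uniqueDiffOn_target x) (by simp)).congr fun y hy => ?_
    exact fderivWithin_of_mem_nhdsWithin (target_mem_nhdsWithin hy)
      (uniqueDiffOn_halfSpace n y (hTR hy)) (hη'.differentiableOn (by simp) y hy)
  -- From |D(ηf)|² ≤ 2η²|Df|² + 2f²|Dη|² and |Df|² ≤ Λ|∇f|², with Λ the sum of the |g_ij|: the sum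
  -- of the two coefficients serves as a common factor of |∇f|² + f².
  obtain ⟨C₂, hC₂⟩ : ∃ C, ∀ y ∈ K, ‖(2 * η (P y) ^ 2 * (∑ i, ∑ j, |gram g x y i j|) +
      2 * ‖Dη y‖ ^ 2) / √(gram g x y).det‖ ≤ C := by
    refine hK.exists_bound_of_continuousOn (ContinuousOn.div (ContinuousOn.add
      (ContinuousOn.mul ?_ ?_) ?_) hdc fun y hy => (hdet y (hKT hy)).ne')
    · exact continuousOn_const.mul ((hη'.continuousOn.mono hKT).pow 2)
    · exact continuousOn_finsetSum _ fun i _ => continuousOn_finsetSum _ fun j _ =>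
        ((contDiffOn_gram g x i j).continuousOn.mono hKT).abs
    · exact continuousOn_const.mul ((hDηc.mono hKT).norm.pow 2)
  refine ⟨ENNReal.ofReal C₁ * (C₀ * ENNReal.ofReal C₂ ^ s), ?_, fun f hf => ?_⟩
  · exact ENNReal.mul_ne_top ENNReal.ofReal_ne_top (ENNReal.mul_ne_top hC₀
      (ENNReal.rpow_ne_top_of_nonneg hs0.le ENNReal.ofReal_ne_top))
  have hf' : ContDiffOn ℝ ∞ (fun y => f (P y)) T := contDiffOn_of_contMDiff hf x
  set F := T.indicator fun y => η (P y) * f (P y) with hF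
  have hF0 : ∀ y ∈ T, y ∉ K → η (P y) * f (P y) = 0 := fun y hy hyK => by
    rw [hηK y hy hyK, zero_mul]
  have hFs : ContDiffOn ℝ 1 F (halfSpace n) :=
    (contDiffOn_indicator_target hs (hη'.mul hf') hF0).of_le (by norm_cast)
  have hFK : ∀ y ∈ halfSpace n, y ∉ K → F y = 0 := fun y _ hyK => indicator_target_eq_zero hF0 hyK
  set DF := fderivWithin ℝ F (halfSpace n) with hDF
  have hDFK : ∀ y ∈ halfSpace n, y ∉ K → DF y = 0 := fun y hy hyK =>
    fderivWithin_eq_zero_of_eq_zero hK.isClosed hFK hy hyK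
  have hDFle : ∀ y ∈ K, ‖DF y‖ ^ 2 ≤ C₂ * (√(gram g x y).det *
      (normSq g (P y) (grad g f (P y)) + f (P y) ^ 2)) := by
    intro y hyK
    have hy := hKT hyK
    have hu := uniqueDiffOn_halfSpace n y (hTR hy)
    have h1 : HasFDerivWithinAt (fun y => η (P y) * f (P y)) _ (halfSpace n) y :=
      (differentiableWithinAt_of_contMDiff hη hy).hasFDerivWithinAt.mul
        (differentiableWithinAt_of_contMDiff hf hy).hasFDerivWithinAt
    have h2 : F =ᶠ[𝓝[halfSpace n] y] fun y => η (P y) * f (P y) := indicator_target_eventuallyEq hy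
    have h3 : DF y = η (P y) • fderivWithin ℝ (fun y => f (P y)) (halfSpace n) y +
        f (P y) • Dη y := by
      rw [hDF, h2.fderivWithin_eq (h2.self_of_nhdsWithin (hTR hy)), h1.fderivWithin hu]
    set L := fderivWithin ℝ (fun y => f (P y)) (halfSpace n) y with hL
    set Λ := ∑ i, ∑ j, |gram g x y i j| with hΛ
    have hΛ0 : 0 ≤ Λ := Finset.sum_nonneg fun i _ => Finset.sum_nonneg fun j _ => abs_nonneg _
    have hLle : ‖L‖ ^ 2 ≤ Λ * normSq g (P y) (grad g f (P y)) := norm_fderivWithin_sq_le g hf hy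
    have hN0 := normSq_nonneg g (P y) (grad g f (P y))
    set N := normSq g (P y) (grad g f (P y)) with hN
    have h4 : ‖DF y‖ ≤ |η (P y)| * ‖L‖ + |f (P y)| * ‖Dη y‖ := by
      rw [h3]
      refine (norm_add_le _ _).trans ?_
      rw [norm_smul, norm_smul, Real.norm_eq_abs, Real.norm_eq_abs]
    have h5 : ‖DF y‖ ^ 2 ≤ 2 * (η (P y) ^ 2 * ‖L‖ ^ 2) + 2 * (f (P y) ^ 2 * ‖Dη y‖ ^ 2) := by
      refine (pow_le_pow_left₀ (norm_nonneg _) h4 2).trans ?_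
      rw [← sq_abs (η (P y)), ← sq_abs (f (P y)), ← mul_pow, ← mul_pow]
      have := sq_nonneg (|η (P y)| * ‖L‖ - |f (P y)| * ‖Dη y‖)
      linarith [add_sq (|η (P y)| * ‖L‖) (|f (P y)| * ‖Dη y‖),
        sub_sq (|η (P y)| * ‖L‖) (|f (P y)| * ‖Dη y‖)]
    have h6 := hC₂ y hyK
    rw [norm_div, Real.norm_of_nonneg (by positivity), Real.norm_of_nonneg (hdet y hy).le,
      div_le_iff₀ (hdet y hy)] at h6
    have h7 : 2 * (η (P y) ^ 2 * ‖L‖ ^ 2) ≤ 2 * η (P y) ^ 2 * Λ * N := by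
      have := mul_le_mul_of_nonneg_left hLle (sq_nonneg (η (P y)))
      linarith
    have h8 := mul_le_mul_of_nonneg_right h6 (add_nonneg hN0 (sq_nonneg (f (P y))))
    have h9 : 0 ≤ 2 * η (P y) ^ 2 * Λ * f (P y) ^ 2 := by positivity
    have h10 : 0 ≤ 2 * ‖Dη y‖ ^ 2 * N := by positivity
    calc ‖DF y‖ ^ 2 ≤ _ := h5
      _ ≤ (2 * η (P y) ^ 2 * Λ + 2 * ‖Dη y‖ ^ 2) * (N + f (P y) ^ 2) := by linarith
      _ ≤ _ := h8
      _ = _ := by ring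
  have hC₂0 : ∀ y ∈ K, 0 ≤ C₂ := fun y hy => (norm_nonneg _).trans (hC₂ y hy)
  have hC₁0 : ∀ y ∈ K, 0 ≤ C₁ := fun y hy => (norm_nonneg _).trans (hC₁ y hy)
  have hm1 : Measurable fun p => ‖η p * f p‖ₑ ^ q :=
    ((hη.continuous.mul hf.continuous).measurable.enorm.pow_const q)
  have hm2 : Measurable fun p => ENNReal.ofReal (normSq g p (grad g f p) + f p ^ 2) :=
    (show Continuous fun p => normSq g p (grad g f p) + f p ^ 2 from
      (continuous_normSq_grad g hf).add (hf.continuous.pow 2)).measurable.ennreal_ofReal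
  have hηsrc : ∀ p, p ∉ (extChartAt (𝓡∂ n) x).source → η p = 0 := fun p hp =>
    image_eq_zero_of_notMem_tsupport fun h => hp (hs h)
  have hgrad : ∫⁻ y in halfSpace n, ‖DF y‖ₑ ^ (2 : ℝ) ≤ ENNReal.ofReal C₂ *
      ∫⁻ p, ENNReal.ofReal (normSq g p (grad g f p) + f p ^ 2) ∂(vol g) := by
    refine le_trans ?_ (mul_le_mul_right (setLIntegral_le_lintegral
      (extChartAt (𝓡∂ n) x).source _) _)
    rw [setLIntegral_source_vol g x hm2, ← lintegral_const_mul' _ _ ENNReal.ofReal_ne_top,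
      ← lintegral_indicator measurableSet_halfSpace, ← lintegral_indicator (measurableSet_target x)]
    refine lintegral_mono fun y => ?_
    by_cases hyK : y ∈ K
    · rw [indicator_of_mem (hTR (hKT hyK)), indicator_of_mem (hKT hyK),
        ← ENNReal.ofReal_mul (Real.sqrt_nonneg _), ← ENNReal.ofReal_mul (hC₂0 y hyK),
        ← ofReal_norm, ENNReal.rpow_two, ← ENNReal.ofReal_pow (norm_nonneg _)]
      exact ENNReal.ofReal_le_ofReal (hDFle y hyK)
    · have : (halfSpace n).indicator (fun y => ‖DF y‖ₑ ^ (2 : ℝ)) y = 0 := by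
        by_cases hyR : y ∈ halfSpace n
        · have h0 : ‖DF y‖ₑ = 0 := by rw [hDFK y hyR hyK, ← ofReal_norm, norm_zero, ENNReal.ofReal_zero]
          rw [indicator_of_mem hyR, h0]; simp
        · exact indicator_of_notMem hyR _
      rw [this]; exact zero_le
  have hfun : ∫⁻ p, ‖η p * f p‖ₑ ^ q ∂(vol g) ≤
      ENNReal.ofReal C₁ * ∫⁻ y in halfSpace n, ‖F y‖ₑ ^ q := by
    have h1 : ∫⁻ p, ‖η p * f p‖ₑ ^ q ∂(vol g) =
        ∫⁻ p in (extChartAt (𝓡∂ n) x).source, ‖η p * f p‖ₑ ^ q ∂(vol g) := by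
      rw [← lintegral_indicator (measurableSet_source x)]
      refine lintegral_congr fun p => ?_
      by_cases hp : p ∈ (extChartAt (𝓡∂ n) x).source
      · rw [indicator_of_mem hp]
      · rw [indicator_of_notMem hp, hηsrc p hp]; simp [hq0]
    rw [h1, setLIntegral_source_vol g x hm1, ← lintegral_const_mul' _ _ ENNReal.ofReal_ne_top,
      ← lintegral_indicator measurableSet_halfSpace, ← lintegral_indicator (measurableSet_target x)]
    refine lintegral_mono fun y => ?_
    by_cases hyK : y ∈ K
    · have hFy : F y = η (P y) * f (P y) := indicator_of_mem (hKT hyK) _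
      rw [indicator_of_mem (hTR (hKT hyK)), indicator_of_mem (hKT hyK), hFy]
      gcongr
      exact (Real.le_norm_self _).trans (hC₁ y hyK)
    · have : T.indicator (fun y => ENNReal.ofReal √(gram g x y).det * ‖η (P y) * f (P y)‖ₑ ^ q) y
          = 0 := by
        by_cases hyT : y ∈ T
        · rw [indicator_of_mem hyT, hF0 y hyT hyK]; simp [hq0]
        · exact indicator_of_notMem hyT _
      rw [this]; exact zero_le
  refine hfun.trans ?_
  rw [mul_assoc]
  gcongr
  refine (hSob F hFs K hK hFK).trans ?_
  rw [mul_assoc, ← ENNReal.mul_rpow_of_nonneg _ _ hs0.le]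
  gcongr

lemma exists_partition_of_unity : ∃ (t : Finset M) (χ : t → M → ℝ),
    (∀ x, ContMDiff (𝓡∂ n) 𝓘(ℝ, ℝ) ∞ (χ x)) ∧ (∀ x p, 0 ≤ χ x p) ∧
    (∀ x : t, tsupport (χ x) ⊆ (extChartAt (𝓡∂ n) x.1).source) ∧ ∀ p, ∑ x, χ x p = 1 := by
  obtain ⟨t, ht⟩ := exists_finset_chart_cover (n := n) (M := M)
  obtain ⟨f, hf⟩ := SmoothPartitionOfUnity.exists_isSubordinate (𝓡∂ n) (isClosed_univ (X := M))
    (fun x : t => (extChartAt (𝓡∂ n) x.1).source) (fun x => isOpen_extChartAt_source x.1)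
    (fun p _ => by
      obtain ⟨x, hx, hp⟩ := ht p
      exact mem_iUnion.2 ⟨⟨x, hx⟩, hp⟩)
  refine ⟨t, fun x => f x, fun x => (f x).contMDiff, fun x p => f.nonneg x p, hf, fun p => ?_⟩
  rw [← finsum_eq_sum_of_fintype]
  exact f.sum_eq_one (mem_univ p)

/-- The trace inequality for smooth functions on a compact manifold with boundary. -/
theorem exists_trace_inequality (g : Metric n M) {φ : M → ℝ} (hφ : ContMDiff (𝓡∂ n) 𝓘(ℝ, ℝ) ∞ φ)
    (hφ0 : ∀ p, 0 ≤ φ p) :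
    ∃ C : ℝ, 0 ≤ C ∧ ∀ r : ℝ, 1 < r → ∀ f : M → ℝ, ContMDiff (𝓡∂ n) 𝓘(ℝ, ℝ) ∞ f →
      ∫⁻ p, ENNReal.ofReal (φ p * |f p| ^ r) ∂(surface g) ≤
        ∫⁻ p, ENNReal.ofReal (φ p * (r * |f p| ^ (r - 1) * √(normSq g p (grad g f p)))) ∂(vol g) +
        ENNReal.ofReal C * ∫⁻ p, ENNReal.ofReal (|f p| ^ r) ∂(vol g) := by
  obtain ⟨t, χ, hχ, hχ0, hχs, hχ1⟩ := exists_partition_of_unity (n := n) (M := M)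
  -- The cutoffs are χφ, not φ alone. Since the χ sum to 1, the local gradient terms add up to
  -- exactly the one with weight φ; only the constants `C x` accumulate.
  have hloc := fun x : t => exists_local_trace g (η := fun p => χ x p * φ p) ((hχ x).mul hφ)
    (fun p => mul_nonneg (hχ0 x p) (hφ0 p)) (x := x.1)
    ((tsupport_mul_subset_left (f := χ x) (g := φ)).trans (hχs x))
  choose C hC0 hC using hloc
  refine ⟨∑ x, C x, Finset.sum_nonneg fun x _ => hC0 x, fun r hr f hf => ?_⟩
  have hφc := hφ.continuous
  have hfc := hf.continuous
  have hχc := fun x => (hχ x).continuous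
  have hcr : Continuous fun p => |f p| ^ r := hfc.abs.rpow_const fun _ => Or.inr (by linarith)
  have hcr1 : Continuous fun p => |f p| ^ (r - 1) := hfc.abs.rpow_const fun _ => Or.inr (by linarith)
  have hcn : Continuous fun p => √(normSq g p (grad g f p)) := (continuous_normSq_grad g hf).sqrt
  have hsplit : ∀ (μ : Measure M) (h : M → ℝ), Continuous h → (∀ p, 0 ≤ h p) →
      ∫⁻ p, ENNReal.ofReal (φ p * h p) ∂μ = ∑ x, ∫⁻ p, ENNReal.ofReal (χ x p * φ p * h p) ∂μ := by
    intro μ h hc h0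
    rw [← lintegral_finsetSum]
    · refine lintegral_congr fun p => ?_
      rw [← ENNReal.ofReal_sum_of_nonneg fun x _ =>
        mul_nonneg (mul_nonneg (hχ0 x p) (hφ0 p)) (h0 p)]
      simp only [mul_assoc]
      rw [← Finset.sum_mul, hχ1, one_mul]
    · intro x _
      have := hχc x
      exact (show Continuous fun p => χ x p * φ p * h p by fun_prop).measurable.ennreal_ofReal
  rw [hsplit _ _ hcr fun p => by positivity, hsplit _ (fun p => r * |f p| ^ (r - 1) *
    √(normSq g p (grad g f p))) (by fun_prop) fun p => by positivity,
    ENNReal.ofReal_sum_of_nonneg fun x _ => hC0 x, Finset.sum_mul, ← Finset.sum_add_distrib]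
  exact Finset.sum_le_sum fun x _ => hC x r hr f hf

/-- The Sobolev inequality for smooth functions on a compact manifold with boundary. -/
theorem exists_sobolev_inequality (hn : 3 ≤ n) (g : Metric n M) :
    ∃ C : ℝ≥0∞, C ≠ ⊤ ∧ ∀ f : M → ℝ, ContMDiff (𝓡∂ n) 𝓘(ℝ, ℝ) ∞ f →
      ∫⁻ p, ‖f p‖ₑ ^ (2 * (n : ℝ) / ((n : ℝ) - 2)) ∂(vol g) ≤
        C * (∫⁻ p, ENNReal.ofReal (normSq g p (grad g f p) + f p ^ 2) ∂(vol g)) ^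
          ((n : ℝ) / ((n : ℝ) - 2)) := by
  obtain ⟨t, χ, hχ, hχ0, hχs, hχ1⟩ := exists_partition_of_unity (n := n) (M := M)
  have hn3 : (3 : ℝ) ≤ n := by exact_mod_cast hn
  have hN2 : (0 : ℝ) < n - 2 := by linarith
  set q : ℝ := 2 * (n : ℝ) / ((n : ℝ) - 2) with hq
  have hq1 : 1 ≤ q := by rw [hq, le_div_iff₀ hN2]; linarith
  choose C hCt hC using fun x : t => exists_local_sobolev hn g (hχ x) (hχs x)
  refine ⟨(Fintype.card t : ℝ≥0∞) ^ (q - 1) * ∑ x, C x, ?_, fun f hf => ?_⟩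
  · exact ENNReal.mul_ne_top (ENNReal.rpow_ne_top_of_nonneg (by linarith) (by simp))
      (ENNReal.sum_ne_top.2 fun x _ => hCt x)
  have hpt : ∀ p, ‖f p‖ₑ ^ q ≤ (Fintype.card t : ℝ≥0∞) ^ (q - 1) * ∑ x, ‖χ x p * f p‖ₑ ^ q := by
    intro p
    have h1 : f p = ∑ x, χ x p * f p := by rw [← Finset.sum_mul, hχ1, one_mul]
    have h2 : ‖f p‖ₑ ≤ ∑ x, ‖χ x p * f p‖ₑ := by
      conv_lhs => rw [h1]
      exact enorm_sum_le _ _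
    refine (ENNReal.rpow_le_rpow h2 (by linarith)).trans ?_
    -- The power mean inequality accounts for the factor (number of charts)^(q-1).
    have := ENNReal.rpow_sum_le_const_mul_sum_rpow (Finset.univ : Finset t)
      (fun x => ‖χ x p * f p‖ₑ) hq1
    simpa using this
  calc ∫⁻ p, ‖f p‖ₑ ^ q ∂(vol g)
      ≤ ∫⁻ p, (Fintype.card t : ℝ≥0∞) ^ (q - 1) * ∑ x, ‖χ x p * f p‖ₑ ^ q ∂(vol g) :=
        lintegral_mono hpt
    _ = (Fintype.card t : ℝ≥0∞) ^ (q - 1) * ∑ x, ∫⁻ p, ‖χ x p * f p‖ₑ ^ q ∂(vol g) := by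
        rw [lintegral_const_mul' _ _ (ENNReal.rpow_ne_top_of_nonneg (by linarith) (by simp)),
          lintegral_finsetSum]
        intro x _
        exact ((hχ x).continuous.mul hf.continuous).measurable.enorm.pow_const q
    _ ≤ _ := by
        rw [mul_assoc, Finset.sum_mul]
        gcongr with x
        exact hC x f hf

end Global

end

/-! ### Limits in Lᵖ, Young's inequality, and the Sobolev and trace maps on H¹ -/

section

lemma exists_tendsto_eLpNorm_of_cauchy {α : Type*} {m : MeasurableSpace α} {μ : Measure α}
    {p : ℝ≥0∞} (hp : 1 ≤ p) {f : ℕ → α → ℝ} (hf : ∀ k, MemLp (f k) p μ) {δ : ℕ → ℝ≥0∞}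
    (hδ : Tendsto δ atTop (𝓝 0))
    (h : ∀ k l, eLpNorm (fun x => f k x - f l x) p μ ≤ δ k + δ l) :
    ∃ w, MemLp w p μ ∧ Tendsto (fun k => eLpNorm (fun x => f k x - w x) p μ) atTop (𝓝 0) := by
  have : Fact (1 ≤ p) := ⟨hp⟩
  have hc : CauchySeq fun k => (hf k).toLp (f k) := by
    refine EMetric.cauchySeq_iff.2 fun ε hε => ?_
    have hε2 : 0 < ε / 2 := ENNReal.half_pos hε.ne'
    obtain ⟨N, hN⟩ := eventually_atTop.1 (hδ.eventually (gt_mem_nhds hε2))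
    refine ⟨N, fun k hk l hl => ?_⟩
    rw [Lp.edist_toLp_toLp]
    calc _ ≤ δ k + δ l := h k l
      _ < ε / 2 + ε / 2 := ENNReal.add_lt_add (hN k hk) (hN l hl)
      _ = ε := ENNReal.add_halves ε
  obtain ⟨F, hF⟩ := cauchySeq_tendsto_of_complete hc
  refine ⟨F, Lp.memLp F, ?_⟩
  rw [← Lp.toLp_coeFn F (Lp.memLp F)] at hF
  exact (Lp.tendsto_Lp_iff_tendsto_eLpNorm'' f hf F (Lp.memLp F)).1 hF

lemma lintegral_ofReal_abs_rpow {α : Type*} {m : MeasurableSpace α} {μ : Measure α}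
    {r : ℝ} (hr : 0 < r) (f : α → ℝ) :
    ∫⁻ x, ENNReal.ofReal (|f x| ^ r) ∂μ = eLpNorm f (ENNReal.ofReal r) μ ^ r := by
  rw [eLpNorm_eq_eLpNorm' (by simpa using hr) ENNReal.ofReal_ne_top, ENNReal.toReal_ofReal hr.le,
    ← lintegral_rpow_enorm_eq_rpow_eLpNorm' hr]
  refine lintegral_congr fun x => ?_
  rw [← ENNReal.ofReal_rpow_of_nonneg (abs_nonneg _) hr.le, ← Real.norm_eq_abs, ofReal_norm]

lemma lintegral_ofReal_sq {α : Type*} {m : MeasurableSpace α} {μ : Measure α} (f : α → ℝ) :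
    ∫⁻ x, ENNReal.ofReal (f x ^ 2) ∂μ = eLpNorm f 2 μ ^ (2 : ℝ) := by
  have := lintegral_ofReal_abs_rpow (μ := μ) two_pos f
  simpa using this

lemma eLpNorm_le_add_sub {α : Type*} {m : MeasurableSpace α} {μ : Measure α} {p : ℝ≥0∞}
    (hp : 1 ≤ p) {f u : α → ℝ} (hf : AEStronglyMeasurable f μ) (hu : AEStronglyMeasurable u μ) :
    eLpNorm f p μ ≤ eLpNorm u p μ + eLpNorm (fun x => f x - u x) p μ := by
  have := eLpNorm_add_le hu (hf.sub hu) hp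
  rwa [add_sub_cancel] at this

lemma eLpNorm_sub_le_add {α : Type*} {m : MeasurableSpace α} {μ : Measure α} {p : ℝ≥0∞}
    (hp : 1 ≤ p) {f h u : α → ℝ} (hf : AEStronglyMeasurable f μ) (hh : AEStronglyMeasurable h μ)
    (hu : AEStronglyMeasurable u μ) :
    eLpNorm (fun x => f x - h x) p μ ≤
      eLpNorm (fun x => f x - u x) p μ + eLpNorm (fun x => h x - u x) p μ := by
  have h1 : (fun x => f x - h x) = (fun x => f x - u x) - (fun x => h x - u x) := by
    ext x; simp
  rw [h1]
  exact eLpNorm_sub_le (hf.sub hu) (hh.sub hu) hp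

/-- Limits of a sequence in two `Lᵖ` spaces agree. -/
lemma tendsto_eLpNorm_of_cauchy {α : Type*} {m : MeasurableSpace α} {μ : Measure α}
    {p r : ℝ≥0∞} (hp : 1 ≤ p) (hr : r ≠ 0) {f : ℕ → α → ℝ} (hf : ∀ k, MemLp (f k) p μ)
    {δ : ℕ → ℝ≥0∞} (hδ : Tendsto δ atTop (𝓝 0))
    (h : ∀ k l, eLpNorm (fun x => f k x - f l x) p μ ≤ δ k + δ l) {u : α → ℝ}
    (hu : AEStronglyMeasurable u μ)
    (hfu : Tendsto (fun k => eLpNorm (fun x => f k x - u x) r μ) atTop (𝓝 0)) :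
    MemLp u p μ ∧ Tendsto (fun k => eLpNorm (fun x => f k x - u x) p μ) atTop (𝓝 0) := by
  obtain ⟨w, hw, hfw⟩ := exists_tendsto_eLpNorm_of_cauchy hp hf hδ h
  have h1 := tendstoInMeasure_of_tendsto_eLpNorm (zero_lt_one.trans_le hp).ne'
    (fun k => (hf k).1) hw.1 hfw
  have h2 := tendstoInMeasure_of_tendsto_eLpNorm hr (fun k => (hf k).1) hu hfu
  have hwu : w =ᵐ[μ] u := tendstoInMeasure_ae_unique h1 h2
  refine ⟨hw.ae_eq hwu, hfw.congr fun k => eLpNorm_congr_ae ?_⟩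
  filter_upwards [hwu] with x hx
  rw [hx]

lemma tendsto_const_add_rpow {a : ℝ≥0∞} {δ : ℕ → ℝ≥0∞} (hδ : Tendsto δ atTop (𝓝 0)) (r : ℝ) :
    Tendsto (fun k => (a + δ k) ^ r) atTop (𝓝 (a ^ r)) := by
  have := (ENNReal.continuous_rpow_const (y := r)).tendsto (a + 0) |>.comp
    (tendsto_const_nhds.add hδ)
  rwa [add_zero] at this

lemma le_rpow_inv_mul {A B C : ℝ≥0∞} {r : ℝ} (hr : 0 < r) (h : A ^ r ≤ C * B ^ r) :
    A ≤ C ^ r⁻¹ * B := by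
  have := ENNReal.rpow_le_rpow h (inv_nonneg.2 hr.le)
  rwa [ENNReal.rpow_rpow_inv hr.ne', ENNReal.mul_rpow_of_nonneg _ _ (inv_nonneg.2 hr.le),
    ENNReal.rpow_rpow_inv hr.ne'] at this

/-- The difference of the two sides is D times 2(n-1)(N/(n-2) - κt/(2s))² with s = √(n(n-1)), so the
coefficients of the theorem leave no slack. -/
lemma young_gradient {n D κ t N : ℝ} (hn : 2 < n) (hD : 0 ≤ D) :
    D * (κ / √(n * (n - 1))) * (2 * (n - 1) / (n - 2) * t * N) ≤
      D * (2 * (n - 1) / (n - 2) ^ 2 * N ^ 2 + 1 / (2 * n) * (κ ^ 2 * t ^ 2)) := by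
  rw [mul_assoc]
  refine mul_le_mul_of_nonneg_left ?_ hD
  have h1 : 0 < n - 1 := by linarith
  have h2 : 0 < n - 2 := by linarith
  have h0 : 0 < n := by linarith
  set s := √(n * (n - 1)) with hs
  have hs0 : 0 < s := Real.sqrt_pos.2 (by positivity)
  have hs2 : s ^ 2 = n * (n - 1) := Real.sq_sqrt (by positivity)
  have key : 2 * (n - 1) / (n - 2) ^ 2 * N ^ 2 + 1 / (2 * n) * (κ ^ 2 * t ^ 2) -
      κ / s * (2 * (n - 1) / (n - 2) * t * N) =
      2 * (n - 1) * (N / (n - 2) - κ * t / (2 * s)) ^ 2 := by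
    have : 1 / (2 * n) = 2 * (n - 1) / (4 * s ^ 2) := by
      rw [hs2]; field_simp; ring
    rw [this]; field_simp; ring
  have : 0 ≤ 2 * (n - 1) * (N / (n - 2) - κ * t / (2 * s)) ^ 2 := by positivity
  linarith

variable {n : ℕ} [NeZero n] {M : Type*} [TopologicalSpace M]
  [ChartedSpace (EuclideanHalfSpace n) M] [IsManifold (𝓡∂ n) ∞ M] [MeasurableSpace M]
  [BorelSpace M] [CompactSpace M] [T2Space M]

/-- The length `|X|` of a vector field. -/
def fieldNorm (g : Metric n M) (X : (p : M) → TangentSpace (𝓡∂ n) p) (p : M) : ℝ :=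
  √(normSq g p (X p))

lemma fieldNorm_sq (g : Metric n M) (X : (p : M) → TangentSpace (𝓡∂ n) p) (p : M) :
    fieldNorm g X p ^ 2 = normSq g p (X p) :=
  Real.sq_sqrt (normSq_nonneg g p _)

lemma aestronglyMeasurable_fieldNorm (g : Metric n M) {X : (p : M) → TangentSpace (𝓡∂ n) p}
    (hX : AEMeasurableField g X) : AEStronglyMeasurable (fieldNorm g X) (vol g) :=
  (Real.continuous_sqrt.measurable.comp_aemeasurable
    (aemeasurable_normSq g hX)).aestronglyMeasurable

lemma lintegral_normSq (g : Metric n M) (X : (p : M) → TangentSpace (𝓡∂ n) p) :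
    ∫⁻ p, ENNReal.ofReal (normSq g p (X p)) ∂(vol g) =
      eLpNorm (fieldNorm g X) 2 (vol g) ^ (2 : ℝ) := by
  rw [← lintegral_ofReal_sq]
  simp_rw [fieldNorm_sq]

lemma fieldNorm_sub_comm (g : Metric n M) (X Y : (p : M) → TangentSpace (𝓡∂ n) p) :
    fieldNorm g (fun p => X p - Y p) = fieldNorm g (fun p => Y p - X p) := by
  ext p
  rw [fieldNorm, fieldNorm, ← neg_sub, normSq_neg]

lemma eLpNorm_fieldNorm_le_add (g : Metric n M) {X Y : (p : M) → TangentSpace (𝓡∂ n) p}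
    (hX : AEMeasurableField g X) (hY : AEMeasurableField g Y) :
    eLpNorm (fieldNorm g X) 2 (vol g) ≤ eLpNorm (fieldNorm g Y) 2 (vol g) +
      eLpNorm (fieldNorm g fun p => X p - Y p) 2 (vol g) := by
  refine le_trans (eLpNorm_mono_real fun p => ?_)
    (eLpNorm_add_le (aestronglyMeasurable_fieldNorm g hY)
      (aestronglyMeasurable_fieldNorm g (hX.sub hY)) one_le_two)
  have := sqrt_normSq_add_le g p (Y p) (X p - Y p)
  rw [add_sub_cancel] at this
  exact (Real.norm_of_nonneg (Real.sqrt_nonneg _)).trans_le this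

lemma memLp_of_continuous {f : M → ℝ} (hf : Continuous f) {μ : Measure M} [IsFiniteMeasure μ]
    (p : ℝ≥0∞) : MemLp f p μ := by
  obtain ⟨C, hC⟩ := isCompact_univ.exists_bound_of_continuousOn hf.continuousOn
  exact MemLp.of_bound hf.aestronglyMeasurable C (Eventually.of_forall fun x => hC x (mem_univ x))

/-- The norm of `H¹(M)`, up to equivalence. -/
def normH1 (g : Metric n M) (f : M → ℝ) : ℝ≥0∞ :=
  eLpNorm (fieldNorm g (grad g f)) 2 (vol g) + eLpNorm f 2 (vol g)

/-- Replaces the Hilbert norm by a sum of two norms, for which the triangle inequality can be used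
term by term. -/
lemma lintegral_normSq_add_sq_le (g : Metric n M) {f : M → ℝ}
    (hf : ContMDiff (𝓡∂ n) 𝓘(ℝ, ℝ) ∞ f) :
    ∫⁻ p, ENNReal.ofReal (normSq g p (grad g f p) + f p ^ 2) ∂(vol g) ≤
      normH1 g f ^ (2 : ℝ) := by
  simp_rw [ENNReal.ofReal_add (normSq_nonneg _ _ _) (sq_nonneg _)]
  rw [lintegral_add_right _ (hf.continuous.measurable.pow_const 2).ennreal_ofReal, lintegral_normSq,
    lintegral_ofReal_sq]
  exact ENNReal.add_rpow_le_rpow_add _ _ one_le_two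

lemma exists_eLpNorm_le_normH1 (hn : 3 ≤ n) (g : Metric n M) : ∃ C : ℝ≥0∞, C ≠ ⊤ ∧
    ∀ f, ContMDiff (𝓡∂ n) 𝓘(ℝ, ℝ) ∞ f →
      eLpNorm f (ENNReal.ofReal (2 * (n : ℝ) / ((n : ℝ) - 2))) (vol g) ≤ C * normH1 g f := by
  obtain ⟨C, hC, h⟩ := exists_sobolev_inequality hn g
  have hn3 : (3 : ℝ) ≤ n := by exact_mod_cast hn
  have h2 : (0 : ℝ) < (n : ℝ) - 2 := by linarith
  set r := 2 * (n : ℝ) / ((n : ℝ) - 2) with hr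
  have hr0 : 0 < r := by positivity
  refine ⟨C ^ r⁻¹, ENNReal.rpow_ne_top_of_nonneg (by positivity) hC, fun f hf => ?_⟩
  refine le_rpow_inv_mul hr0 ?_
  rw [← lintegral_ofReal_abs_rpow hr0]
  have h1 : ∀ p, ENNReal.ofReal (|f p| ^ r) = ‖f p‖ₑ ^ r := fun p => by
    rw [← ENNReal.ofReal_rpow_of_nonneg (abs_nonneg _) hr0.le, ← Real.norm_eq_abs, ofReal_norm]
  simp_rw [h1]
  refine (h f hf).trans ?_
  gcongr
  refine (ENNReal.rpow_le_rpow (lintegral_normSq_add_sq_le g hf) (by positivity)).trans_eq ?_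
  rw [← ENNReal.rpow_mul, hr]
  congr 1; ring

/-- The trace inequality with φ = 1 and r = 2, followed by 2|f||∇f| ≤ f² + |∇f|². -/
lemma exists_eLpNorm_surface_le_normH1 (g : Metric n M) : ∃ C : ℝ≥0∞, C ≠ ⊤ ∧
    ∀ f, ContMDiff (𝓡∂ n) 𝓘(ℝ, ℝ) ∞ f → eLpNorm f 2 (surface g) ≤ C * normH1 g f := by
  obtain ⟨C, hC0, h⟩ := exists_trace_inequality g (φ := fun _ => 1) contMDiff_const
    (fun _ => zero_le_one)
  refine ⟨(1 + ENNReal.ofReal C) ^ (2 : ℝ)⁻¹,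
    ENNReal.rpow_ne_top_of_nonneg (by positivity) (by simp), fun f hf => ?_⟩
  refine le_rpow_inv_mul two_pos ?_
  have h1 := h 2 one_lt_two f hf
  simp only [one_mul, Real.rpow_two, sq_abs] at h1
  rw [lintegral_ofReal_sq] at h1
  refine h1.trans ?_
  rw [add_mul, one_mul]
  refine add_le_add ?_ (mul_le_mul_right ?_ _)
  · refine (lintegral_mono fun p => ENNReal.ofReal_le_ofReal ?_).trans
      (lintegral_normSq_add_sq_le g hf)
    rw [← Real.sq_sqrt (normSq_nonneg g p (grad g f p))]
    norm_num
    nlinarith [sq_nonneg (|f p| - √(normSq g p (grad g f p))), sq_abs (f p)]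
  · refine (lintegral_mono fun p => ENNReal.ofReal_le_ofReal ?_).trans
      (lintegral_normSq_add_sq_le g hf)
    linarith [normSq_nonneg g p (grad g f p)]

namespace TendstoH1

variable {g : Metric n M} {f : ℕ → M → ℝ} {u : M → ℝ} {X : (p : M) → TangentSpace (𝓡∂ n) p}

lemma tendsto_fieldNorm (h : TendstoH1 g f u X) :
    Tendsto (fun k => eLpNorm (fieldNorm g fun p => grad g (f k) p - X p) 2 (vol g)) atTop
      (𝓝 0) := by
  have h1 := h.tendsto_grad
  simp_rw [lintegral_normSq] at h1
  have := (ENNReal.continuous_rpow_const (y := (2 : ℝ)⁻¹)).tendsto 0 |>.comp h1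
  rw [ENNReal.zero_rpow_of_pos (by positivity)] at this
  exact this.congr fun k => ENNReal.rpow_rpow_inv two_ne_zero _

/-- The triangle inequality through the limit pair (u, X). With the Cauchy property in this form,
any linear estimate by `normH1` transfers it to another Lᵖ space. -/
lemma exists_cauchy (h : TendstoH1 g f u X) : ∃ δ : ℕ → ℝ≥0∞, Tendsto δ atTop (𝓝 0) ∧
    ∀ k l, normH1 g (fun p => f k p - f l p) ≤ δ k + δ l := by
  refine ⟨_, by simpa using h.tendsto_fieldNorm.add h.tendsto_fun, fun k l => ?_⟩
  rw [add_add_add_comm]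
  refine add_le_add ?_ (eLpNorm_sub_le_add one_le_two
    (h.smooth k).continuous.aestronglyMeasurable (h.smooth l).continuous.aestronglyMeasurable
    h.aestronglyMeasurable)
  have hk := (aemeasurableField_grad g (h.smooth k)).sub h.aemeasurableField
  have hl := (aemeasurableField_grad g (h.smooth l)).sub h.aemeasurableField
  have h1 : grad g (fun p => f k p - f l p) = fun p => grad g (f k) p - grad g (f l) p :=
    funext fun p => grad_sub g (h.smooth k) (h.smooth l) p
  have h2 := eLpNorm_fieldNorm_le_add g ((aemeasurableField_grad g (h.smooth k)).sub
    (aemeasurableField_grad g (h.smooth l))) hk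
  rw [h1]
  refine h2.trans (add_le_add le_rfl (le_of_eq ?_))
  rw [fieldNorm_sub_comm]
  simp only [sub_sub_sub_cancel_left]

lemma memLp_fieldNorm (h : TendstoH1 g f u X) : MemLp (fieldNorm g X) 2 (vol g) := by
  have hX := aestronglyMeasurable_fieldNorm g h.aemeasurableField
  refine ⟨hX, ?_⟩
  obtain ⟨k, hk⟩ := (h.tendsto_fieldNorm.eventually (gt_mem_nhds one_pos)).exists
  refine (eLpNorm_fieldNorm_le_add g h.aemeasurableField
    (aemeasurableField_grad g (h.smooth k))).trans_lt (ENNReal.add_lt_top.2 ⟨?_, ?_⟩)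
  · exact (memLp_of_continuous (continuous_normSq_grad g (h.smooth k)).sqrt 2).2
  · rw [fieldNorm_sub_comm]
    exact hk.trans ENNReal.one_lt_top

/-- By the Sobolev inequality the sequence is Cauchy in L^{2n/(n-2)}. Its limit there must be `u`,
since both convergences imply convergence in measure. -/
lemma tendsto_eLpNorm_sobolev (hn : 3 ≤ n) (h : TendstoH1 g f u X) :
    MemLp u (ENNReal.ofReal (2 * (n : ℝ) / ((n : ℝ) - 2))) (vol g) ∧
    Tendsto (fun k => eLpNorm (fun p => f k p - u p)
      (ENNReal.ofReal (2 * (n : ℝ) / ((n : ℝ) - 2))) (vol g)) atTop (𝓝 0) := by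
  obtain ⟨C, hC, hS⟩ := exists_eLpNorm_le_normH1 hn g
  obtain ⟨δ, hδ, hfδ⟩ := h.exists_cauchy
  have hn3 : (3 : ℝ) ≤ n := by exact_mod_cast hn
  have hp : 1 ≤ ENNReal.ofReal (2 * (n : ℝ) / ((n : ℝ) - 2)) := by
    rw [ENNReal.one_le_ofReal, one_le_div (by linarith)]; linarith
  refine tendsto_eLpNorm_of_cauchy hp two_ne_zero
    (fun k => memLp_of_continuous (h.smooth k).continuous _)
    (δ := fun k => C * δ k) ?_ (fun k l => ?_) h.aestronglyMeasurable h.tendsto_fun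
  · simpa using ENNReal.Tendsto.const_mul hδ (Or.inr hC)
  · rw [← mul_add]
    exact (hS _ ((h.smooth k).sub (h.smooth l))).trans (mul_le_mul_right (hfδ k l) _)

/-- The boundary restrictions are Cauchy in L²(∂M) by the trace estimate, and L²(∂M) is complete. -/
lemma exists_isTrace (h : TendstoH1 g f u X) : ∃ w, IsTrace g u X w := by
  obtain ⟨C, hC, hS⟩ := exists_eLpNorm_surface_le_normH1 g
  obtain ⟨δ, hδ, hfδ⟩ := h.exists_cauchy
  obtain ⟨w, hw, hfw⟩ := exists_tendsto_eLpNorm_of_cauchy (μ := surface g) one_le_two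
    (fun k => memLp_of_continuous (h.smooth k).continuous _)
    (δ := fun k => C * δ k) (by simpa using ENNReal.Tendsto.const_mul hδ (Or.inr hC))
    (fun k l => by
      rw [← mul_add]
      exact (hS _ ((h.smooth k).sub (h.smooth l))).trans (mul_le_mul_right (hfδ k l) _))
  exact ⟨w, hw.1, f, h, hfw⟩

end TendstoH1

end

/-! ### The boundary inequality with weight, for smooth functions and for H¹ -/

section

variable {n : ℕ} [NeZero n] {M : Type*} [TopologicalSpace M]
  [ChartedSpace (EuclideanHalfSpace n) M] [IsManifold (𝓡∂ n) ∞ M] [MeasurableSpace M]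
  [BorelSpace M] [CompactSpace M] [T2Space M]

/-- The strict sign of `K` keeps the argument away from 0, where √|·| is not differentiable; the
weight must be smooth to serve in the trace inequality. -/
lemma contMDiff_sqrt_abs {K : M → ℝ} (hK : ContMDiff (𝓡∂ n) 𝓘(ℝ, ℝ) ∞ K) (hK0 : ∀ p, K p < 0) :
    ContMDiff (𝓡∂ n) 𝓘(ℝ, ℝ) ∞ fun p => √|K p| := by
  intro p
  have h : ContDiffAt ℝ ∞ (fun t : ℝ => √|t|) (K p) :=
    (contDiffAt_abs (hK0 p).ne).sqrt (abs_pos.2 (hK0 p).ne).ne'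
  exact h.contMDiffAt.comp p (hK p)

/-- The weight `D √|K| / √(n(n-1))`. -/
def boundaryWeight (n : ℕ) (D : ℝ) (K : M → ℝ) (p : M) : ℝ :=
  D * (√|K p| / √((n : ℝ) * ((n : ℝ) - 1)))

/-- The trace inequality with this weight and r = 2(n-1)/(n-2), then Young's inequality pointwise
under the volume integral. `D = 0` is still admitted here. -/
lemma exists_smooth_boundary_inequality (hn : 3 ≤ n) (g : Metric n M) {K : M → ℝ}
    (hK : ContMDiff (𝓡∂ n) 𝓘(ℝ, ℝ) ∞ K) (hK0 : ∀ p, K p < 0) {D : ℝ} (hD : 0 ≤ D) :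
    ∃ C : ℝ, 0 ≤ C ∧ ∀ f, ContMDiff (𝓡∂ n) 𝓘(ℝ, ℝ) ∞ f →
      ∫⁻ p, ENNReal.ofReal (boundaryWeight n D K p *
          |f p| ^ (2 * ((n : ℝ) - 1) / ((n : ℝ) - 2))) ∂(surface g) ≤
        ENNReal.ofReal D * (ENNReal.ofReal (2 * ((n : ℝ) - 1) / ((n : ℝ) - 2) ^ 2) *
            ∫⁻ p, ENNReal.ofReal (normSq g p (grad g f p)) ∂(vol g) +
          ENNReal.ofReal (1 / (2 * (n : ℝ))) *
            ∫⁻ p, ENNReal.ofReal (|K p| * |f p| ^ (2 * (n : ℝ) / ((n : ℝ) - 2))) ∂(vol g)) +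
        ENNReal.ofReal C *
          ∫⁻ p, ENNReal.ofReal (|f p| ^ (2 * ((n : ℝ) - 1) / ((n : ℝ) - 2))) ∂(vol g) := by
  have hn3 : (3 : ℝ) ≤ n := by exact_mod_cast hn
  have hn1 : (0 : ℝ) < (n : ℝ) - 1 := by linarith
  have hn2 : (0 : ℝ) < (n : ℝ) - 2 := by linarith
  have hφ : ContMDiff (𝓡∂ n) 𝓘(ℝ, ℝ) ∞ (boundaryWeight n D K) :=
    contMDiff_const.mul ((contMDiff_sqrt_abs hK hK0).div_const _)
  obtain ⟨C, hC, h⟩ := exists_trace_inequality g hφ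
    (fun p => mul_nonneg hD (div_nonneg (Real.sqrt_nonneg _) (Real.sqrt_nonneg _)))
  refine ⟨C, hC, fun f hf => ?_⟩
  set q := 2 * ((n : ℝ) - 1) / ((n : ℝ) - 2) with hq
  set r := 2 * (n : ℝ) / ((n : ℝ) - 2) with hr
  have hq1 : 1 < q := by rw [hq, one_lt_div hn2]; linarith
  have hr0 : 0 < r := by positivity
  refine (h q hq1 f hf).trans (add_le_add ?_ le_rfl)
  have hcf : Continuous fun p => |f p| ^ r := hf.continuous.abs.rpow_const fun _ => Or.inr hr0.le
  have hm : Measurable fun p => ENNReal.ofReal (|K p| * |f p| ^ r) :=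
    (hK.continuous.abs.mul hcf).measurable.ennreal_ofReal
  have hm' : Measurable fun p => ENNReal.ofReal (normSq g p (grad g f p)) :=
    (continuous_normSq_grad g hf).measurable.ennreal_ofReal
  rw [← lintegral_const_mul _ hm, ← lintegral_const_mul _ hm',
    ← lintegral_add_left (hm'.const_mul _), ← lintegral_const_mul' _ _ ENNReal.ofReal_ne_top]
  refine lintegral_mono fun p => ?_
  rw [← ENNReal.ofReal_mul (by positivity), ← ENNReal.ofReal_mul (by positivity),
    ← ENNReal.ofReal_add (mul_nonneg (by positivity) (normSq_nonneg _ _ _)) (by positivity),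
    ← ENNReal.ofReal_mul hD]
  refine ENNReal.ofReal_le_ofReal ?_
  have hy := young_gradient (n := (n : ℝ)) (κ := √|K p|) (t := |f p| ^ (q - 1))
    (N := √(normSq g p (grad g f p))) (by linarith) hD
  rw [Real.sq_sqrt (abs_nonneg _), Real.sq_sqrt (normSq_nonneg _ _ _), ← Real.rpow_mul_natCast
    (abs_nonneg _)] at hy
  -- Criticality of the exponents: squaring |f|^{q-1} gives precisely the power that occurs with
  -- |K|.
  have he : (q - 1) * ((2 : ℕ) : ℝ) = r := by rw [hq, hr]; push_cast; field_simp; ring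
  rwa [he] at hy

/-- The weight is moved inside the norm as |K|^{1/r}, so that Minkowski's inequality applies to the
weighted term. -/
lemma lintegral_weight_rpow {α : Type*} {m : MeasurableSpace α} {μ : Measure α} {r : ℝ}
    (hr : 0 < r) (K f : α → ℝ) :
    ∫⁻ x, ENNReal.ofReal (|K x| * |f x| ^ r) ∂μ =
      eLpNorm (fun x => |K x| ^ r⁻¹ * f x) (ENNReal.ofReal r) μ ^ r := by
  rw [← lintegral_ofReal_abs_rpow hr]
  refine lintegral_congr fun x => ?_
  rw [abs_mul, Real.mul_rpow (abs_nonneg _) (abs_nonneg _), abs_of_nonneg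
    (Real.rpow_nonneg (abs_nonneg _) _), Real.rpow_inv_rpow (abs_nonneg _) hr.ne']

/-- Along an approximating sequence the right side converges, while the left side is lower
semicontinuous for almost everywhere convergence. So convergence of the traces in L²(∂M) is enough,
although q > 2. -/
lemma boundary_inequality_of_isTrace (hn : 3 ≤ n) (g : Metric n M) {K : M → ℝ}
    (hK : ContMDiff (𝓡∂ n) 𝓘(ℝ, ℝ) ∞ K) (hK0 : ∀ p, K p < 0) {D : ℝ} (hD : 0 ≤ D) :
    ∃ C : ℝ, 0 ≤ C ∧ ∀ u X w, IsTrace g u X w →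
      ∫⁻ p, ENNReal.ofReal (boundaryWeight n D K p *
          |w p| ^ (2 * ((n : ℝ) - 1) / ((n : ℝ) - 2))) ∂(surface g) ≤
        ENNReal.ofReal D * (ENNReal.ofReal (2 * ((n : ℝ) - 1) / ((n : ℝ) - 2) ^ 2) *
            ∫⁻ p, ENNReal.ofReal (normSq g p (X p)) ∂(vol g) +
          ENNReal.ofReal (1 / (2 * (n : ℝ))) *
            ∫⁻ p, ENNReal.ofReal (|K p| * |u p| ^ (2 * (n : ℝ) / ((n : ℝ) - 2))) ∂(vol g)) +
        ENNReal.ofReal C *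
          ∫⁻ p, ENNReal.ofReal (|u p| ^ (2 * ((n : ℝ) - 1) / ((n : ℝ) - 2))) ∂(vol g) := by
  obtain ⟨C, hC, hsm⟩ := exists_smooth_boundary_inequality hn g hK hK0 hD
  refine ⟨C, hC, fun u X w ⟨hwm, f, hf, hfw⟩ => ?_⟩
  have hn3 : (3 : ℝ) ≤ n := by exact_mod_cast hn
  have hn1 : (0 : ℝ) < (n : ℝ) - 1 := by linarith
  have hn2 : (0 : ℝ) < (n : ℝ) - 2 := by linarith
  obtain ⟨hu, hfu⟩ := hf.tendsto_eLpNorm_sobolev hn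
  set q := 2 * ((n : ℝ) - 1) / ((n : ℝ) - 2) with hq
  set r := 2 * (n : ℝ) / ((n : ℝ) - 2) with hr
  have hq1 : 1 < q := by rw [hq, one_lt_div hn2]; linarith
  have hq0 : 0 < q := by linarith
  have hqr : q ≤ r := by rw [hq, hr]; gcongr; linarith
  have hr0 : 0 < r := by positivity
  have h1q : 1 ≤ ENNReal.ofReal q := by rw [ENNReal.one_le_ofReal]; exact hq1.le
  have h1r : 1 ≤ ENNReal.ofReal r := by rw [ENNReal.one_le_ofReal]; linarith
  have hfm : ∀ k, AEStronglyMeasurable (f k) (vol g) :=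
    fun k => (hf.smooth k).continuous.aestronglyMeasurable
  have hum := hf.aestronglyMeasurable
  have hκ : Continuous fun p => |K p| ^ r⁻¹ :=
    hK.continuous.abs.rpow_const fun _ => Or.inr (by positivity)
  obtain ⟨B, hB⟩ := isCompact_univ.exists_bound_of_continuousOn hκ.continuousOn
  set a := ENNReal.ofReal (2 * ((n : ℝ) - 1) / ((n : ℝ) - 2) ^ 2)
  set b := ENNReal.ofReal (1 / (2 * (n : ℝ)))
  set δ : ℕ → ℝ≥0∞ := fun k => eLpNorm (fieldNorm g fun p => grad g (f k) p - X p) 2 (vol g)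
  set β : ℕ → ℝ≥0∞ := fun k => eLpNorm
    (fun p => |K p| ^ r⁻¹ * f k p - |K p| ^ r⁻¹ * u p) (ENNReal.ofReal r) (vol g) with hβ
  set γ : ℕ → ℝ≥0∞ := fun k => eLpNorm (fun p => f k p - u p) (ENNReal.ofReal q) (vol g) with hγ
  have hδ0 : Tendsto δ atTop (𝓝 0) := hf.tendsto_fieldNorm
  have hβ0 : Tendsto β atTop (𝓝 0) := by
    refine tendsto_of_tendsto_of_tendsto_of_le_of_le tendsto_const_nhds
      (h := fun k => ENNReal.ofReal B * eLpNorm (fun p => f k p - u p) (ENNReal.ofReal r) (vol g))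
      ?_ (fun _ => zero_le) fun k => ?_
    · simpa using ENNReal.Tendsto.const_mul hfu (Or.inr ENNReal.ofReal_ne_top)
    · refine eLpNorm_le_mul_eLpNorm_of_ae_le_mul (Eventually.of_forall fun p => ?_) _
      rw [← mul_sub, norm_mul]
      exact mul_le_mul_of_nonneg_right (hB p (mem_univ p)) (norm_nonneg _)
  -- L^r convergence implies L^q convergence, since q ≤ r and the volume is finite.
  have hγ0 : Tendsto γ atTop (𝓝 0) := by
    refine tendsto_of_tendsto_of_tendsto_of_le_of_le tendsto_const_nhds ?_
      (fun _ => zero_le) fun k => eLpNorm_le_eLpNorm_mul_rpow_measure_univ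
        (ENNReal.ofReal_le_ofReal hqr) ((hfm k).sub hum)
    have := ENNReal.Tendsto.mul_const (b := vol g univ ^
      (1 / (ENNReal.ofReal q).toReal - 1 / (ENNReal.ofReal r).toReal)) hfu
      (Or.inr (ENNReal.rpow_ne_top_of_nonneg ?_ (measure_ne_top _ _)))
    · simpa using this
    · rw [ENNReal.toReal_ofReal hq0.le, ENNReal.toReal_ofReal hr0.le, sub_nonneg]
      exact one_div_le_one_div_of_le hq0 hqr
  -- The right side for `f k`, with every norm majorized by the norm of its limit plus an error
  -- tending to 0.
  set U : ℕ → ℝ≥0∞ := fun k => ENNReal.ofReal D *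
    (a * (eLpNorm (fieldNorm g X) 2 (vol g) + δ k) ^ (2 : ℝ) +
      b * (eLpNorm (fun p => |K p| ^ r⁻¹ * u p) (ENNReal.ofReal r) (vol g) + β k) ^ r) +
    ENNReal.ofReal C * (eLpNorm u (ENNReal.ofReal q) (vol g) + γ k) ^ q with hU
  have hfU : ∀ k, ∫⁻ p, ENNReal.ofReal (boundaryWeight n D K p * |f k p| ^ q) ∂(surface g) ≤
      U k := by
    intro k
    refine (hsm (f k) (hf.smooth k)).trans ?_
    rw [lintegral_normSq, lintegral_weight_rpow hr0, lintegral_ofReal_abs_rpow hq0]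
    simp only [hU]
    gcongr
    · exact eLpNorm_fieldNorm_le_add g (aemeasurableField_grad g (hf.smooth k))
        hf.aemeasurableField
    · exact eLpNorm_le_add_sub h1r (hκ.aestronglyMeasurable.mul (hfm k))
        (hκ.aestronglyMeasurable.mul hum)
    · exact eLpNorm_le_add_sub h1q (hfm k) hum
  have hUlim : Tendsto U atTop (𝓝 (ENNReal.ofReal D *
      (a * eLpNorm (fieldNorm g X) 2 (vol g) ^ (2 : ℝ) +
        b * eLpNorm (fun p => |K p| ^ r⁻¹ * u p) (ENNReal.ofReal r) (vol g) ^ r) +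
      ENNReal.ofReal C * eLpNorm u (ENNReal.ofReal q) (vol g) ^ q)) :=
    (ENNReal.Tendsto.const_mul
      ((ENNReal.Tendsto.const_mul (tendsto_const_add_rpow hδ0 _)
        (Or.inr ENNReal.ofReal_ne_top)).add
      (ENNReal.Tendsto.const_mul (tendsto_const_add_rpow hβ0 _)
        (Or.inr ENNReal.ofReal_ne_top))) (Or.inr ENNReal.ofReal_ne_top)).add
      (ENNReal.Tendsto.const_mul (tendsto_const_add_rpow hγ0 _) (Or.inr ENNReal.ofReal_ne_top))
  rw [lintegral_normSq, lintegral_weight_rpow hr0, lintegral_ofReal_abs_rpow hq0]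
  -- An almost everywhere convergent subsequence on ∂M, as Fatou's lemma requires.
  obtain ⟨ns, hns, hae⟩ := (tendstoInMeasure_of_tendsto_eLpNorm two_ne_zero
    (fun k => (hf.smooth k).continuous.aestronglyMeasurable) hwm hfw).exists_seq_tendsto_ae
  have hφc : Continuous (boundaryWeight n D K) :=
    continuous_const.mul (hK.continuous.abs.sqrt.div_const _)
  calc ∫⁻ p, ENNReal.ofReal (boundaryWeight n D K p * |w p| ^ q) ∂(surface g)
      = ∫⁻ p, liminf (fun j => ENNReal.ofReal (boundaryWeight n D K p * |f (ns j) p| ^ q)) atTop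
          ∂(surface g) := by
        refine lintegral_congr_ae ?_
        filter_upwards [hae] with p hp
        refine (Tendsto.liminf_eq ?_).symm
        exact ENNReal.tendsto_ofReal (tendsto_const_nhds.mul
          (hp.abs.rpow_const (Or.inr hq0.le)))
    _ ≤ liminf (fun j => ∫⁻ p, ENNReal.ofReal (boundaryWeight n D K p * |f (ns j) p| ^ q)
          ∂(surface g)) atTop :=
        lintegral_liminf_le fun j => (hφc.mul ((hf.smooth (ns j)).continuous.abs.rpow_const
          fun _ => Or.inr hq0.le)).measurable.ennreal_ofReal
    _ ≤ liminf (fun j => U (ns j)) atTop := liminf_le_liminf (Eventually.of_forall fun j => hfU _)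
    _ = _ := (hUlim.comp hns.tendsto_atTop).liminf_eq

lemma isCompact_boundary : IsCompact ((𝓡∂ n).boundary M) :=
  ((𝓡∂ n).isClosed_boundary (M := M) (n := ∞) (by simp)).isCompact

/-- Compactness of ∂M bounds the set, so the supremum is a genuine upper bound; the inserted 0
covers an empty boundary and negative values. -/
lemma barD_nonneg_and_le {K H : M → ℝ} (hK : Continuous K) (hK0 : ∀ p, K p < 0)
    (hH : ContinuousOn H ((𝓡∂ n).boundary M)) :
    0 ≤ barD n H K ∧ ∀ p ∈ (𝓡∂ n).boundary M, frakD n H K p ≤ barD n H K := by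
  have hc : ContinuousOn (frakD n H K) ((𝓡∂ n).boundary M) :=
    continuousOn_const.mul (hH.div hK.abs.sqrt.continuousOn fun p _ =>
      (Real.sqrt_pos.2 (abs_pos.2 (hK0 p).ne)).ne')
  have hb : BddAbove (insert 0 (frakD n H K '' (𝓡∂ n).boundary M)) :=
    ((isCompact_boundary.image_of_continuousOn hc).bddAbove).insert 0
  exact ⟨le_csSup hb (mem_insert _ _), fun p hp =>
    le_csSup hb (mem_insert_of_mem _ (mem_image_of_mem _ hp))⟩

/-- The weight is 𝔇_n solved for H, with `D` in place of 𝔇_n. -/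
lemma le_boundaryWeight (hn : 3 ≤ n) {K H : M → ℝ} (hK0 : ∀ p, K p < 0) {D : ℝ} {p : M}
    (h : frakD n H K p ≤ D) : H p ≤ boundaryWeight n D K p := by
  have hn3 : (3 : ℝ) ≤ n := by exact_mod_cast hn
  have h1 : 0 < √((n : ℝ) * ((n : ℝ) - 1)) := Real.sqrt_pos.2 (by nlinarith)
  have h2 : 0 < √|K p| := Real.sqrt_pos.2 (abs_pos.2 (hK0 p).ne)
  have h3 : H p = frakD n H K p * (√|K p| / √((n : ℝ) * ((n : ℝ) - 1))) := by
    rw [frakD]; field_simp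
  rw [h3]
  exact mul_le_mul_of_nonneg_right h (by positivity)

/-- Nothing is assumed about `H` off ∂M, and nothing is needed, because the surface measure is
concentrated there. -/
lemma aestronglyMeasurable_surface (g : Metric n M) {H : M → ℝ}
    (hH : ContinuousOn H ((𝓡∂ n).boundary M)) : AEStronglyMeasurable H (surface g) := by
  have h := hH.aestronglyMeasurable (μ := surface g) isCompact_boundary.measurableSet
  rwa [Measure.restrict_eq_self_of_ae_mem (ae_mem_boundary g)] at h

end

end RiemannianBoundary

end

/-! ### The main theorem: integrability and comparison of H with the weight -/

theorem mainTheorem9 {n : ℕ} [NeZero n] (hn : 3 ≤ n)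
    {M : Type*} [TopologicalSpace M] [CompactSpace M] [T2Space M]
    [ChartedSpace (EuclideanHalfSpace n) M] [IsManifold (𝓡∂ n) ∞ M]
    [MeasurableSpace M] [BorelSpace M]
    (g : RiemannianBoundary.Metric n M) (K H : M → ℝ)
    (hK : ContMDiff (𝓡∂ n) 𝓘(ℝ, ℝ) ∞ K) (hKneg : ∀ p, K p < 0)
    (hH : ContMDiffOn (𝓡∂ n) 𝓘(ℝ, ℝ) ∞ H ((𝓡∂ n).boundary M)) :
    ∀ ε : ℝ, 0 < ε → ∃ C : ℝ, 0 < C ∧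
      ∀ (u : M → ℝ) (X : (p : M) → TangentSpace (𝓡∂ n) p), RiemannianBoundary.IsH1 g u X →
        (∃ w : M → ℝ, RiemannianBoundary.IsTrace g u X w) ∧
        ∀ w : M → ℝ, RiemannianBoundary.IsTrace g u X w →
          Integrable (fun p => H p * |w p| ^ (2 * ((n : ℝ) - 1) / ((n : ℝ) - 2)))
            (RiemannianBoundary.surface g) ∧
          Integrable (fun p => RiemannianBoundary.normSq g p (X p))
            (RiemannianBoundary.vol g) ∧
          Integrable (fun p => |K p| * |u p| ^ (2 * (n : ℝ) / ((n : ℝ) - 2)))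
            (RiemannianBoundary.vol g) ∧
          Integrable (fun p => |u p| ^ (2 * ((n : ℝ) - 1) / ((n : ℝ) - 2)))
            (RiemannianBoundary.vol g) ∧
          ∫ p, H p * |w p| ^ (2 * ((n : ℝ) - 1) / ((n : ℝ) - 2))
              ∂(RiemannianBoundary.surface g) ≤
            (RiemannianBoundary.barD n H K + ε) *
              (2 * ((n : ℝ) - 1) / ((n : ℝ) - 2) ^ 2 *
                  ∫ p, RiemannianBoundary.normSq g p (X p) ∂(RiemannianBoundary.vol g) +
                1 / (2 * (n : ℝ)) *
                  ∫ p, |K p| * |u p| ^ (2 * (n : ℝ) / ((n : ℝ) - 2))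
                    ∂(RiemannianBoundary.vol g)) +
            C * ∫ p, |u p| ^ (2 * ((n : ℝ) - 1) / ((n : ℝ) - 2))
              ∂(RiemannianBoundary.vol g) := by
  intro ε hε
  obtain ⟨hD0, hDle⟩ := RiemannianBoundary.barD_nonneg_and_le hK.continuous hKneg hH.continuousOn
  -- The ε only makes `D`, and with it the weight φ, strictly positive, so that H/φ is defined and
  -- bounded on ∂M.
  set D := RiemannianBoundary.barD n H K + ε with hD
  have hDpos : 0 < D := by positivity
  obtain ⟨C, hC, hmain⟩ :=
    RiemannianBoundary.boundary_inequality_of_isTrace hn g hK hKneg hDpos.le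
  -- The constant obtained may be 0, whereas a positive one is asked for.
  refine ⟨C + 1, by positivity, fun u X hu => ?_⟩
  obtain ⟨f, hf⟩ := hu
  refine ⟨hf.exists_isTrace, fun w hw => ?_⟩
  have hn3 : (3 : ℝ) ≤ n := by exact_mod_cast hn
  have hn1 : (0 : ℝ) < (n : ℝ) - 1 := by linarith
  have hn2 : (0 : ℝ) < (n : ℝ) - 2 := by linarith
  have hineq := hmain u X w hw
  have hmem := (hf.tendsto_eLpNorm_sobolev hn).1
  set q := 2 * ((n : ℝ) - 1) / ((n : ℝ) - 2) with hq
  set r := 2 * (n : ℝ) / ((n : ℝ) - 2) with hr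
  have hq0 : 0 < q := by positivity
  have hqr : q ≤ r := by rw [hq, hr]; gcongr; linarith
  have hr0 : 0 < r := by positivity
  have hX : Integrable (fun p => RiemannianBoundary.normSq g p (X p))
      (RiemannianBoundary.vol g) := by
    have := hf.memLp_fieldNorm.integrable_sq
    simpa only [RiemannianBoundary.fieldNorm_sq] using this
  have hur : Integrable (fun p => |u p| ^ r) (RiemannianBoundary.vol g) := by
    have := hmem.integrable_norm_rpow (by simpa using hr0) ENNReal.ofReal_ne_top
    simpa only [ENNReal.toReal_ofReal hr0.le, Real.norm_eq_abs] using this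
  have huq : Integrable (fun p => |u p| ^ q) (RiemannianBoundary.vol g) := by
    have := (hmem.mono_exponent (ENNReal.ofReal_le_ofReal hqr)).integrable_norm_rpow
      (by simpa using hq0) ENNReal.ofReal_ne_top
    simpa only [ENNReal.toReal_ofReal hq0.le, Real.norm_eq_abs] using this
  obtain ⟨B, hB⟩ := isCompact_univ.exists_bound_of_continuousOn hK.continuous.continuousOn
  have hKu : Integrable (fun p => |K p| * |u p| ^ r) (RiemannianBoundary.vol g) :=
    hur.bdd_mul hK.continuous.abs.aestronglyMeasurable
      (Eventually.of_forall fun p => by simpa using hB p (mem_univ p))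
  set φ := RiemannianBoundary.boundaryWeight n D K with hφ
  have hφc : Continuous φ := continuous_const.mul (hK.continuous.abs.sqrt.div_const _)
  have hφ0 : ∀ p, 0 < φ p := fun p => mul_pos hDpos (div_pos
    (Real.sqrt_pos.2 (abs_pos.2 (hKneg p).ne)) (Real.sqrt_pos.2 (by positivity)))
  set I₁ := ∫ p, RiemannianBoundary.normSq g p (X p) ∂(RiemannianBoundary.vol g) with hI₁
  set I₂ := ∫ p, |K p| * |u p| ^ r ∂(RiemannianBoundary.vol g) with hI₂
  set I₃ := ∫ p, |u p| ^ q ∂(RiemannianBoundary.vol g) with hI₃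
  have hI₁0 : 0 ≤ I₁ := integral_nonneg fun p => RiemannianBoundary.normSq_nonneg g p _
  have hI₂0 : 0 ≤ I₂ := integral_nonneg fun p => by positivity
  have hI₃0 : 0 ≤ I₃ := integral_nonneg fun p => by positivity
  rw [← ofReal_integral_eq_lintegral_ofReal hX
      (Eventually.of_forall fun p => RiemannianBoundary.normSq_nonneg g p _),
    ← ofReal_integral_eq_lintegral_ofReal hKu (Eventually.of_forall fun p => by positivity),
    ← ofReal_integral_eq_lintegral_ofReal huq (Eventually.of_forall fun p => by positivity),
    ← ENNReal.ofReal_mul (by positivity), ← ENNReal.ofReal_mul (by positivity),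
    ← ENNReal.ofReal_add (by positivity) (by positivity), ← ENNReal.ofReal_mul hDpos.le,
    ← ENNReal.ofReal_mul hC, ← ENNReal.ofReal_add (by positivity) (by positivity)] at hineq
  have hwm : AEStronglyMeasurable (fun p => |w p| ^ q) (RiemannianBoundary.surface g) :=
    (hw.1.aemeasurable.abs.pow_const q).aestronglyMeasurable
  have hφw0 : ∀ p, 0 ≤ φ p * |w p| ^ q := fun p => mul_nonneg (hφ0 p).le (by positivity)
  -- The L² trace is not integrable to the power q a priori; finiteness comes from the inequality
  -- itself, whose right side is finite.
  have hφw : Integrable (fun p => φ p * |w p| ^ q) (RiemannianBoundary.surface g) := by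
    refine ⟨hφc.aestronglyMeasurable.mul hwm, ?_⟩
    rw [hasFiniteIntegral_iff_ofReal (Eventually.of_forall hφw0)]
    exact hineq.trans_lt ENNReal.ofReal_lt_top
  rw [← ofReal_integral_eq_lintegral_ofReal hφw (Eventually.of_forall hφw0),
    ENNReal.ofReal_le_ofReal_iff (by positivity)] at hineq
  -- H|w|^q is a bounded multiple of φ|w|^q on ∂M, hence integrable.
  have hHc : ContinuousOn (fun p => H p / φ p) ((𝓡∂ n).boundary M) :=
    hH.continuousOn.div hφc.continuousOn fun p _ => (hφ0 p).ne'
  obtain ⟨A, hA⟩ := RiemannianBoundary.isCompact_boundary.exists_bound_of_continuousOn hHc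
  have hHw : Integrable (fun p => H p * |w p| ^ q) (RiemannianBoundary.surface g) := by
    refine (hφw.bdd_mul (RiemannianBoundary.aestronglyMeasurable_surface g hHc)
      ((RiemannianBoundary.ae_mem_boundary g).mono hA)).congr (Eventually.of_forall fun p => ?_)
    have := (hφ0 p).ne'
    simp only
    field_simp
  refine ⟨hHw, hX, hKu, huq, ?_⟩
  have hle : ∫ p, H p * |w p| ^ q ∂(RiemannianBoundary.surface g) ≤
      ∫ p, φ p * |w p| ^ q ∂(RiemannianBoundary.surface g) := by
    refine integral_mono_ae hHw hφw ?_
    filter_upwards [RiemannianBoundary.ae_mem_boundary g] with p hp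
    refine mul_le_mul_of_nonneg_right (RiemannianBoundary.le_boundaryWeight hn hKneg
      ((hDle p hp).trans ?_)) (by positivity)
    rw [hD]; linarith
  linarith
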